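/- Let $d\ge 1$ be an integer, $\delta\in(0,1)$, $L>0$, $T\in(-\infty,\infty]$. Write $z=(t,x,v)\in\mathbb R\times\mathbb R^d\times\mathbb R^d$, $G=(-\infty,T)\times\mathbb R^{2d}$, $\|\cdot\|=\|\cdot\|_{L_2(G)}$; all functions are real-valued and derivatives are understood in the sense of distributions on $G$. Let $a=(a^{ij}(z))_{i,j=1}^d$ (not necessarily symmetric) be measurable on $\mathbb R^{1+2d}$ with $$\delta|\xi|^2\le a^{ij}(z)\xi_i\xi_j,\qquad |a^{ij}(z)|\le\delta^{-1}\qquad\text{for all } z\in\mathbb R^{1+2d},\ \xi\in\mathbb R^d,$$ and let the $\mathbb R^d$-valued functions $b,\bar b$ and the scalar function $c$ be measurable with $|b|+|\bar b|+|c|\le L$ on $\mathbb R^{1+2d}$. Let $\mathbb H^{-1}_2(G)$ be the set of distributions $\operatorname{div}_vF+h$ with $F,h\in L_2(G)$, and let $\mathfrak S_2(G)$ be the set of functions $u$ with $u,D_vu\in L_2(G)$ and $\partial_tu-v\cdot D_xu\in\mathbb H^{-1}_2(G)$. For $u\in L_2(G)$, $(-\Delta_x)^{1/6}u$ is the distribution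 $\phi\mapsto\int_G u\,(-\Delta_x)^{1/6}\phi\,dz$, $\phi\in C_0^\infty(G)$, where $(-\Delta_x)^{1/6}\phi$ is defined by the Fourier multiplier $|\xi|^{1/3}$ in the variable $x$. Then there exist $N=N(d,\delta)>0$ and $\lambda_0=\lambda_0(d,\delta,L)>0$ such that for every $\lambda\ge\lambda_0$ and all $u\in\mathfrak S_2(G)$, $\vec f,g\in L_2(G)$ satisfying $$\partial_tu-v\cdot D_xu-D_{v_i}(a^{ij}D_{v_j}u)+\operatorname{div}_v(\bar b u)+b\cdot D_vu+(c+\lambda)u=\operatorname{div}_v\vec f+g\quad\text{in } G,$$ one has $$\lambda^{1/2}\|u\|+\|D_vu\|\le N\|\vec f\|+N\lambda^{-1/2}\|g\|$$ and, in addition, $(-\Delta_x)^{1/6}u\in L_2(G)$ with $$\|(-\Delta_x)^{1/6}u\|\le N\|\vec f\|+N\lambda^{-1/2}\|g\|.$$ -/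

import Mathlib

open MeasureTheory
open scoped Distributions FourierTransform

noncomputable section

namespace Kinetic

/-- `ℝⁿ` with its Euclidean norm. -/
abbrev Euc (n : ℕ) := EuclideanSpace ℝ (Fin n)

/-- Points `z = (t, x, v)` with `t ∈ ℝ`, `x ∈ ℝᵈ`, `v ∈ ℝ^{d₁}`; this space carries Lebesgue
measure `volume`. -/
abbrev Phase (d d₁ : ℕ) := ℝ × Euc d × Euc d₁

/-- The open set `(-∞, T) × ℝᵈ × ℝ^{d₁}`, for `T ∈ (-∞, ∞]`. -/
def before (d d₁ : ℕ) (T : WithTop ℝ) : TopologicalSpace.Opens (Phase d d₁) where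
  carrier := {z | (z.1 : WithTop ℝ) < T}
  is_open' := by
    induction T with
    | top => simp
    | coe T =>
      simp only [WithTop.coe_lt_coe]
      exact isOpen_lt continuous_fst continuous_const

variable {d d₁ : ℕ}

/-- `h ∈ L₂(G)`. -/
def MemL2 {F : Type*} [NormedAddCommGroup F] (G : TopologicalSpace.Opens (Phase d d₁))
    (h : Phase d d₁ → F) : Prop :=
  MemLp h 2 (volume.restrict (G : Set (Phase d d₁)))

/-- The norm of `L₂(G)`. -/
def normL2 {F : Type*} [NormedAddCommGroup F] (G : TopologicalSpace.Opens (Phase d d₁))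
    (h : Phase d d₁ → F) : ℝ :=
  (eLpNorm h 2 (volume.restrict (G : Set (Phase d d₁)))).toReal

/-! ### The distributions on `G` that occur in the equation

Distributions on `G` are represented by their values on real test functions `φ ∈ C₀^∞(G)`. -/

/-- The function `h` as a distribution: `φ ↦ ∫_G h φ`. -/
def toDistr (G : TopologicalSpace.Opens (Phase d d₁)) (h : Phase d d₁ → ℝ) (φ : 𝓓(G, ℝ)) : ℝ :=
  ∫ z in (G : Set (Phase d d₁)), h z * φ z

/-- The distribution `div_v F`: `φ ↦ -∫_G F · D_v φ`. -/
def divV (G : TopologicalSpace.Opens (Phase d d₁)) (F : Phase d d₁ → Euc d₁) (φ : 𝓓(G, ℝ)) : ℝ :=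
  -∫ z in (G : Set (Phase d d₁)), fderiv ℝ φ z (0, 0, F z)

/-- The distribution `∂_t u + α(v) · D_x u`: `φ ↦ -∫_G u (∂_t φ + α(v) · D_x φ)`. -/
def transport (G : TopologicalSpace.Opens (Phase d d₁)) (α : Euc d₁ → Euc d)
    (u : Phase d d₁ → ℝ) (φ : 𝓓(G, ℝ)) : ℝ :=
  -∫ z in (G : Set (Phase d d₁)),
    u z * (fderiv ℝ φ z (1, 0, 0) + fderiv ℝ φ z (0, α z.2.2, 0))

/-- `p ∈ L₂(G)` is the weak gradient `D_v u` of `u` on `G`: for every vector `e`,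
`p · e = div_v (u e)` as distributions. -/
def IsGradV (G : TopologicalSpace.Opens (Phase d d₁)) (u : Phase d d₁ → ℝ)
    (p : Phase d d₁ → Euc d₁) : Prop :=
  MemL2 G p ∧ ∀ (e : Euc d₁) (φ : 𝓓(G, ℝ)),
    toDistr G (fun z => inner ℝ (p z) e) φ = divV G (fun z => u z • e) φ

/-- The space `ℍ₂⁻¹(G)` of distributions of the form `div_v F + h` with `F, h ∈ L₂(G)`. -/
def MemHNegOne (G : TopologicalSpace.Opens (Phase d d₁)) (l : 𝓓(G, ℝ) → ℝ) : Prop :=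
  ∃ (F : Phase d d₁ → Euc d₁) (h : Phase d d₁ → ℝ), MemL2 G F ∧ MemL2 G h ∧
    ∀ φ : 𝓓(G, ℝ), l φ = divV G F φ + toDistr G h φ

/-- The kinetic space `𝔖₂(G, α)`: `u, D_v u ∈ L₂(G)` and `∂_t u + α(v) · D_x u ∈ ℍ₂⁻¹(G)`. -/
def MemKinetic (G : TopologicalSpace.Opens (Phase d d₁)) (α : Euc d₁ → Euc d)
    (u : Phase d d₁ → ℝ) : Prop :=
  MemL2 G u ∧ (∃ p, IsGradV G u p) ∧ MemHNegOne G (transport G α u)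

/-- Bounded (Lebesgue) measurable leading coefficients with
`δ |ξ|² ≤ aⁱʲ ξᵢ ξⱼ` and `|aⁱʲ| ≤ δ⁻¹`; symmetry is not required. -/
structure Elliptic (δ : ℝ) (a : Phase d d₁ → Matrix (Fin d₁) (Fin d₁) ℝ) : Prop where
  measurable : ∀ i j, AEMeasurable (fun z => a z i j) volume
  lower : ∀ z (ξ : Euc d₁), δ * ‖ξ‖ ^ 2 ≤ ∑ i, ∑ j, a z i j * ξ i * ξ j
  upper : ∀ z i j, |a z i j| ≤ δ⁻¹

/-- (Lebesgue) measurable lower-order coefficients with `|b| + |b̄| + |c| ≤ L`. -/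
structure LowerOrder (L : ℝ) (b bbar : Phase d d₁ → Euc d₁) (c : Phase d d₁ → ℝ) : Prop where
  measurable_b : AEMeasurable b volume
  measurable_bbar : AEMeasurable bbar volume
  measurable_c : AEMeasurable c volume
  bound : ∀ z, ‖b z‖ + ‖bbar z‖ + |c z| ≤ L

/-- With `p = D_v u`, the equation
`∂_t u + α(v) · D_x u - D_{v_i} (aⁱʲ D_{v_j} u) + div_v (b̄ u) + b · D_v u + (c + lam) u`
`= div_v f + g` in the sense of distributions on `G`. -/
def SolvesEq (G : TopologicalSpace.Opens (Phase d d₁)) (α : Euc d₁ → Euc d)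
    (a : Phase d d₁ → Matrix (Fin d₁) (Fin d₁) ℝ) (b bbar : Phase d d₁ → Euc d₁)
    (c : Phase d d₁ → ℝ) (lam : ℝ) (u : Phase d d₁ → ℝ) (p : Phase d d₁ → Euc d₁)
    (f : Phase d d₁ → Euc d₁) (g : Phase d d₁ → ℝ) : Prop :=
  ∀ φ : 𝓓(G, ℝ),
    transport G α u φ - divV G (fun z => Matrix.toEuclideanLin (a z) (p z)) φ
      + divV G (fun z => u z • bbar z) φ + toDistr G (fun z => inner ℝ (b z) (p z)) φ
      + toDistr G (fun z => (c z + lam) * u z) φ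
    = divV G f φ + toDistr G g φ

/-- `(-Δ)ˢ ψ` for a function on `ℝᵈ`: the Fourier multiplier with symbol `|ξ|^{2s}`. Since Mathlib's
Fourier transform has the kernel `exp(-2πi x·ξ)`, the symbol reads `|2πξ|^{2s}` here. -/
def fracLaplacian (s : ℝ) (ψ : Euc d → ℂ) : Euc d → ℂ :=
  𝓕⁻ (fun ξ : Euc d => (((2 * Real.pi * ‖ξ‖) ^ (2 * s) : ℝ) : ℂ) * 𝓕 ψ ξ)

/-- `(-Δ_x)ˢ φ` for a real function `φ` of `(t, x, v)` (its values are real up to the embedding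
of `ℝ` in `ℂ`). -/
def fracLaplacianX (s : ℝ) (φ : Phase d d₁ → ℝ) (z : Phase d d₁) : ℝ :=
  (fracLaplacian s (fun y : Euc d => (φ (z.1, y, z.2.2) : ℂ)) z.2.1).re

/-- The distribution `(-Δ_x)ˢ u` on `G`, `φ ↦ ∫_G u (-Δ_x)ˢ φ`, is the function `w`. It is used for
sets `G` that are unions of full fibres in `x`. -/
def IsFracLaplacianX (s : ℝ) (G : TopologicalSpace.Opens (Phase d d₁)) (u w : Phase d d₁ → ℝ) :
    Prop :=
  ∀ φ : 𝓓(G, ℝ), toDistr G w φ = ∫ z in (G : Set (Phase d d₁)), u z * fracLaplacianX s φ z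

end Kinetic

end

open MeasureTheory
open scoped Distributions FourierTransform

noncomputable section

namespace Kinetic

open Filter Topology Set
open scoped ENNReal ContDiff SchwartzMap

/-! ### The `L₂` Fourier transform and its agreement with the integral formula. -/

section FourierL2

variable {E : Type*} [NormedAddCommGroup E] [InnerProductSpace ℝ E] [FiniteDimensional ℝ E]
  [MeasurableSpace E] [BorelSpace E]

/-! Collect everything except transport into one flux and one source, so that the equation reads
`∂_t u - v · D_x u = div_v F + h` with `F = a D_v u - b̄ u + f` and `h = -b · D_v u - (c + λ) u +
g`, both in `L₂`. No regularity of the coefficients is needed after this. In the coordinates of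
`shear`, constant along the characteristics, the transport operator is `∂_t`, while `D_v` becomes
`D_v + t D_x`. A Fourier transform in `(x, v)`, with `t` as a parameter, turns the latter into
multiplication by `i` times `symb = 2π(tξ + η)`. The equation is then, for almost every frequency
`(ξ, η)`, an ordinary differential equation `y' = S` in `t` with `S = i symb · F̂ + ĥ`, and almost
every `y` is absolutely continuous (`ae_slice_primitive`, `exists_fourierEquation`).

Energy estimate. On a half-line, `Re ∫ ȳ y'` is half the limit of `|y|²` at the right end, since
square integrability excludes a contribution from `-∞`; hence it is nonnegative
(`integral_mul_deriv_nonneg`). Summed over frequencies, Plancherel turns this into `0 ≤ ∫ (u h - D_v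
u · F)`. Ellipticity and Young's inequality then bound `D_v u` and `λ^{1/2} u`, the lower-order
terms being absorbed by large `λ` (`source_mul_sub_inner_flux_le`).

Gain in `x`. Let `r³ = 2π|ξ|`, so that `r` is the symbol of `(-Δ_x)^{1/6}`. Since `symb` moves with
constant speed `r³`, its modulus `q` is below `r` only for a time of order `r⁻²`. Where `q ≥ r`,
`r|y| ≤ q|y|` is controlled by `D_v u`. Where `q < r`, the solution is traced back over a time
`4/r²` to a stretch with `q ≥ r`; in between `q ≤ 5r`, so the change of `y` is controlled by `F̂`
and `ĥ` (`sq_le_window_integral`). A window of length `4/r²` costs only a factor 4 after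
multiplication by `r²` and integration in `t` (`lintegral_gain_le`). For frequencies with `r² ≤ λ`
the bound on `λ^{1/2} u` suffices, and for the others `r⁻² ≤ λ⁻¹` gives the weight of `ĥ`
(`FourierEquation.gain`).

Finally the multiplier `r` is undone. At a fixed time the shear is a translation in `x` depending on
`v`, and Fourier multipliers in `x` commute with translations; duality with test functions then
identifies the inverse transform of `r Û` with `(-Δ_x)^{1/6} u` (`fracLaplacianX_shear`,
`exists_isFracLaplacianX`). -/

lemma integral_smul_lp_fourier (f : Lp (α := E) ℂ 2) (χ : 𝓢(E, ℂ)) :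
    ∫ x, χ x • (𝓕 f : Lp (α := E) ℂ 2) x = ∫ x, (𝓕 χ) x • f x := by
  have h := congrArg (fun l => l χ) (Lp.fourier_toTemperedDistribution_eq f)
  simp only [TemperedDistribution.fourier_apply, Lp.toTemperedDistribution_apply] at h
  exact h.symm

lemma integral_smul_lp_fourierInv (f : Lp (α := E) ℂ 2) (χ : 𝓢(E, ℂ)) :
    ∫ x, χ x • (𝓕⁻ f : Lp (α := E) ℂ 2) x = ∫ x, (𝓕⁻ χ) x • f x := by
  have h := congrArg (fun l => l χ) (Lp.fourierInv_toTemperedDistribution_eq f)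
  simp only [TemperedDistribution.fourierInv_apply, Lp.toTemperedDistribution_apply] at h
  exact h.symm

lemma continuous_fourier_of_integrable {g : E → ℂ} (hg : Integrable g) : Continuous (𝓕 g) :=
  VectorFourier.fourierIntegral_continuous Real.continuous_fourierChar
    (innerSL ℝ).continuous₂ hg

lemma continuous_fourierInv_of_integrable {g : E → ℂ} (hg : Integrable g) :
    Continuous (𝓕⁻ g) := by
  have : 𝓕⁻ g = fun x => 𝓕 g (-x) := funext fun x => Real.fourierInv_eq_fourier_neg g x
  rw [this]
  exact (continuous_fourier_of_integrable hg).comp continuous_neg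

lemma integral_smul_fourier_of_integrable {f g : E → ℂ} (hf : Integrable f) (hg : Integrable g) :
    ∫ x, f x • 𝓕 g x = ∫ x, 𝓕 f x • g x := by
  have := VectorFourier.integral_fourierIntegral_smul_eq_flip (L := innerₗ E)
    Real.continuous_fourierChar continuous_inner hf hg
  rw [flip_innerₗ] at this
  exact this.symm

lemma integral_smul_fourierInv_of_integrable {f g : E → ℂ} (hf : Integrable f)
    (hg : Integrable g) : ∫ x, f x • 𝓕⁻ g x = ∫ x, 𝓕⁻ f x • g x := by
  simp only [Real.fourierInv_eq_fourier_neg]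
  rw [← integral_neg_eq_self (fun x => f x • 𝓕 g (-x)),
    ← integral_neg_eq_self (fun x => 𝓕 f (-x) • g x)]
  simp only [neg_neg]
  have h := integral_smul_fourier_of_integrable hf.comp_neg hg
  rw [h]
  rw [← integral_neg_eq_self]
  refine integral_congr_ae (.of_forall fun x => ?_)
  simp only
  congr 1
  have := Real.fourierInv_eq_fourier_comp_neg f
  rw [← this, Real.fourierInv_eq_fourier_neg, neg_neg]

lemma ae_eq_of_integral_schwartz_smul_eq {f g : E → ℂ} (hf : LocallyIntegrable f)
    (hg : LocallyIntegrable g) (h : ∀ χ : 𝓢(E, ℂ), ∫ x, χ x • f x = ∫ x, χ x • g x) :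
    f =ᵐ[volume] g := by
  refine ae_eq_of_integral_contDiff_smul_eq hf hg fun χ hχ hc => ?_
  have h1 : ContDiff ℝ ∞ (fun x => (χ x : ℂ)) := Complex.ofRealCLM.contDiff.comp hχ
  have h2 : HasCompactSupport (fun x => (χ x : ℂ)) := hc.comp_left Complex.ofReal_zero
  simpa using h (h2.toSchwartzMap h1)

/-- Both sides pair equally with Schwartz functions: the left one because the `L₂` transform agrees
with that of tempered distributions, the right one by Fubini. The integral formula is what makes the
transform measurable in a parameter. -/
lemma fourier_toLp_ae_eq {g : E → ℂ} (hg : Integrable g) (hg2 : MemLp g 2) :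
    (𝓕 (hg2.toLp g) : Lp (α := E) ℂ 2) =ᵐ[volume] 𝓕 g := by
  refine ae_eq_of_integral_schwartz_smul_eq
    ((Lp.memLp _).locallyIntegrable (by norm_num))
    (continuous_fourier_of_integrable hg).locallyIntegrable fun χ => ?_
  rw [integral_smul_lp_fourier, integral_smul_fourier_of_integrable χ.integrable hg,
    SchwartzMap.fourier_coe]
  refine integral_congr_ae ?_
  filter_upwards [hg2.coeFn_toLp] with x hx
  rw [hx]

lemma fourierInv_toLp_ae_eq {g : E → ℂ} (hg : Integrable g) (hg2 : MemLp g 2) :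
    (𝓕⁻ (hg2.toLp g) : Lp (α := E) ℂ 2) =ᵐ[volume] 𝓕⁻ g := by
  refine ae_eq_of_integral_schwartz_smul_eq
    ((Lp.memLp _).locallyIntegrable (by norm_num))
    (continuous_fourierInv_of_integrable hg).locallyIntegrable fun χ => ?_
  rw [integral_smul_lp_fourierInv, integral_smul_fourierInv_of_integrable χ.integrable hg,
    SchwartzMap.fourierInv_coe]
  refine integral_congr_ae ?_
  filter_upwards [hg2.coeFn_toLp] with x hx
  rw [hx]

/-- `g` is the `L₂`-Fourier transform of `f`. -/
def IsFourierL2 (f g : E → ℂ) : Prop :=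
  ∃ (hf : MemLp f 2) (hg : MemLp g 2), 𝓕 (hf.toLp f) = hg.toLp g

lemma IsFourierL2.integral_smul {f g : E → ℂ} (h : IsFourierL2 f g) (χ : 𝓢(E, ℂ)) :
    ∫ x, χ x • g x = ∫ x, (𝓕 χ) x • f x := by
  obtain ⟨hf, hg, h⟩ := h
  have := integral_smul_lp_fourier (hf.toLp f) χ
  rw [h] at this
  convert! this using 1
  · refine integral_congr_ae ?_
    filter_upwards [hg.coeFn_toLp] with x hx
    rw [hx]
  · refine integral_congr_ae ?_
    filter_upwards [hf.coeFn_toLp] with x hx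
    rw [hx]

lemma IsFourierL2.integral_conj_mul {f g f' g' : E → ℂ} (h : IsFourierL2 f g)
    (h' : IsFourierL2 f' g') :
    ∫ x, (starRingEnd ℂ (g x)) * g' x = ∫ x, (starRingEnd ℂ (f x)) * f' x := by
  obtain ⟨hf, hg, h⟩ := h
  obtain ⟨hf', hg', h'⟩ := h'
  have := Lp.inner_fourier_eq (hf.toLp f) (hf'.toLp f')
  rw [h, h', L2.inner_def, L2.inner_def] at this
  convert! this using 1
  · refine integral_congr_ae ?_
    filter_upwards [hg.coeFn_toLp, hg'.coeFn_toLp] with x hx hx'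
    rw [hx, hx', RCLike.inner_apply, mul_comm]
  · refine integral_congr_ae ?_
    filter_upwards [hf.coeFn_toLp, hf'.coeFn_toLp] with x hx hx'
    rw [hx, hx', RCLike.inner_apply, mul_comm]

lemma isFourierL2_of_fourierInv {f : E → ℂ} (hf : Integrable f) (hf2 : MemLp f 2) :
    IsFourierL2 (𝓕⁻ f) f := by
  have h := fourierInv_toLp_ae_eq hf hf2
  have h2 : MemLp (𝓕⁻ f) 2 := (Lp.memLp _).ae_eq h
  refine ⟨h2, hf2, ?_⟩
  have : h2.toLp (𝓕⁻ f) = 𝓕⁻ (hf2.toLp f) := by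
    rw [← Lp.toLp_coeFn (𝓕⁻ (hf2.toLp f)) (Lp.memLp _)]
    exact MemLp.toLp_congr _ _ h.symm
  rw [this, FourierTransform.fourier_fourierInv_eq]

lemma isFourierL2_of_fourier {f : E → ℂ} (hf : Integrable f) (hf2 : MemLp f 2) :
    IsFourierL2 f (𝓕 f) := by
  have h := fourier_toLp_ae_eq hf hf2
  have h2 : MemLp (𝓕 f) 2 := (Lp.memLp _).ae_eq h
  refine ⟨hf2, h2, ?_⟩
  rw [← Lp.toLp_coeFn (𝓕 (hf2.toLp f)) (Lp.memLp _)]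
  exact MemLp.toLp_congr _ _ h

end FourierL2

/-! ### Isometries of `L₂` acting on slices. -/

section PartialTransform

variable {P E : Type*} [MeasurableSpace P] [MeasurableSpace E] {τ : Measure P} {ν : Measure E}

lemma eLpNorm_two_sq {α F : Type*} [MeasurableSpace α] {μ : Measure α} [NormedAddCommGroup F]
    (f : α → F) :
    eLpNorm f 2 μ ^ 2 = ∫⁻ x, ‖f x‖ₑ ^ 2 ∂μ := by
  rw [eLpNorm_eq_lintegral_rpow_enorm_toReal (by norm_num) (by norm_num)]
  simp only [ENNReal.toReal_ofNat, ENNReal.rpow_ofNat]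
  rw [← ENNReal.rpow_natCast, ← ENNReal.rpow_mul]
  norm_num

lemma eLpNorm_two_sq_prod [SFinite ν] {U : P × E → ℂ}
    (hU : AEStronglyMeasurable U (τ.prod ν)) :
    eLpNorm U 2 (τ.prod ν) ^ 2 = ∫⁻ t, eLpNorm (fun e => U (t, e)) 2 ν ^ 2 ∂τ := by
  simp only [eLpNorm_two_sq]
  exact lintegral_prod _ (hU.enorm.pow_const 2)

lemma ae_memLp_slice [SFinite ν] {U : P × E → ℂ} (hU : MemLp U 2 (τ.prod ν)) :
    ∀ᵐ t ∂τ, MemLp (fun e => U (t, e)) 2 ν := by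
  have h1 : ∀ᵐ t ∂τ, eLpNorm (fun e => U (t, e)) 2 ν ^ 2 < ⊤ := by
    apply ae_lt_top'
    · simp only [eLpNorm_two_sq]
      exact (hU.1.enorm.pow_const 2).lintegral_prod_right'
    · rw [← eLpNorm_two_sq_prod hU.1]
      exact (ENNReal.pow_lt_top hU.2).ne
  filter_upwards [h1, hU.1.prodMk_left] with t ht ht'
  exact ⟨ht', by simpa using ht⟩

end PartialTransform

section PartialTransform

variable {P E : Type*} [MeasurableSpace P] [MeasurableSpace E] {τ : Measure P} {ν : Measure E}

lemma tendsto_eLpNorm_indicator_sub {α : Type*} [MeasurableSpace α] {μ : Measure α} {U : α → ℂ}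
    (hU : MemLp U 2 μ) {D : ℕ → Set α} (hD : ∀ n, MeasurableSet (D n)) (hmono : Monotone D)
    (hcov : ⋃ n, D n = univ) :
    Tendsto (fun n => eLpNorm ((D n).indicator U - U) 2 μ) atTop (𝓝 0) := by
  have h : Tendsto (fun n => ∫⁻ x, ‖((D n).indicator U - U) x‖ₑ ^ 2 ∂μ) atTop (𝓝 (∫⁻ _, 0 ∂μ)) := by
    refine tendsto_lintegral_of_dominated_convergence' (fun x => ‖U x‖ₑ ^ 2)
      (fun n => ((hU.1.indicator (hD n)).sub hU.1).enorm.pow_const 2) ?_ ?_ ?_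
    · refine fun n => .of_forall fun x => ?_
      by_cases hx : x ∈ D n <;> simp [hx]
    · rw [← eLpNorm_two_sq]
      exact (ENNReal.pow_lt_top hU.2).ne
    · refine .of_forall fun x => tendsto_const_nhds.congr' ?_
      obtain ⟨n, hn⟩ := mem_iUnion.1 (hcov ▸ mem_univ x)
      filter_upwards [eventually_ge_atTop n] with m hm
      simp [hmono hm hn]
  simp only [← eLpNorm_two_sq, lintegral_zero] at h
  have h2 := h.ennrpow_const (1 / 2)
  simp only [← ENNReal.rpow_natCast, ← ENNReal.rpow_mul] at h2
  norm_num at h2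
  exact h2

/-- An isometry of `L₂` that is given by a measurable formula on integrable functions acts on the
slices of a function of two variables. -/
theorem exists_slicewise_isometry [SFinite τ] [SigmaFinite ν]
    (Φ : Lp (α := E) ℂ 2 ν → Lp (α := E) ℂ 2 ν)
    (hΦ : ∀ f g, ‖Φ f - Φ g‖ = ‖f - g‖) (hΦ0 : Φ 0 = 0) (Fn : (E → ℂ) → E → ℂ)
    (hFn : ∀ g, Integrable g ν → ∀ hg2 : MemLp g 2 ν, Φ (hg2.toLp g) =ᵐ[ν] Fn g)
    (hm : ∀ W : P × E → ℂ, StronglyMeasurable W →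
      StronglyMeasurable fun p : P × E => Fn (fun e => W (p.1, e)) p.2)
    {U : P × E → ℂ} (hU : MemLp U 2 (τ.prod ν)) :
    ∃ V : P × E → ℂ, MemLp V 2 (τ.prod ν) ∧
      ∀ᵐ t ∂τ, ∃ (h1 : MemLp (fun e => U (t, e)) 2 ν) (h2 : MemLp (fun e => V (t, e)) 2 ν),
        Φ (h1.toLp _) = h2.toLp _ := by
  wlog hUm : StronglyMeasurable U generalizing U
  · obtain ⟨V, hV, h⟩ := this (hU.ae_eq hU.1.ae_eq_mk) hU.1.stronglyMeasurable_mk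
    refine ⟨V, hV, ?_⟩
    filter_upwards [h, Measure.ae_ae_of_ae_prod hU.1.ae_eq_mk] with t ⟨h1, h2, h3⟩ ht
    have ht' : (fun e => hU.1.mk U (t, e)) =ᵐ[ν] fun e => U (t, e) := by
      filter_upwards [ht] with e he using he.symm
    refine ⟨h1.ae_eq ht', h2, ?_⟩
    rw [MemLp.toLp_congr (h1.ae_eq ht') h1 ht'.symm, h3]
  -- Truncation to sets of finite measure makes the `L₂` slices integrable, so that `Fn` computes
  -- `Φ` on them and gives a jointly measurable function.
  let D : ℕ → Set (P × E) := fun n => Prod.snd ⁻¹' (spanningSets ν n)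
  have hD : ∀ n, MeasurableSet (D n) := fun n => measurable_snd (measurableSet_spanningSets ν n)
  let Un : ℕ → P × E → ℂ := fun n => (D n).indicator U
  have hUnm : ∀ n, StronglyMeasurable (Un n) := fun n => hUm.indicator (hD n)
  have hUn : ∀ n, MemLp (Un n) 2 (τ.prod ν) := fun n => hU.indicator (hD n)
  have hUn_slice : ∀ n t, (fun e => Un n (t, e)) = (spanningSets ν n).indicator fun e => U (t, e) := by
    intro n t; rfl
  let Vn : ℕ → P × E → ℂ := fun n p => Fn (fun e => Un n (p.1, e)) p.2
  have hVnm : ∀ n, StronglyMeasurable (Vn n) := fun n => hm _ (hUnm n)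
  have hgood : ∀ᵐ t ∂τ, MemLp (fun e => U (t, e)) 2 ν := ae_memLp_slice hU
  have hgoodn : ∀ t, MemLp (fun e => U (t, e)) 2 ν → ∀ n, MemLp (fun e => Un n (t, e)) 2 ν := by
    intro t ht n
    rw [hUn_slice]; exact ht.indicator (measurableSet_spanningSets ν n)
  have hVae : ∀ t (ht : MemLp (fun e => U (t, e)) 2 ν) n,
      Φ ((hgoodn t ht n).toLp _) =ᵐ[ν] fun e => Vn n (t, e) := by
    intro t ht n
    refine hFn _ ?_ (hgoodn t ht n)
    rw [hUn_slice, integrable_indicator_iff (measurableSet_spanningSets ν n)]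
    have : IsFiniteMeasure (ν.restrict (spanningSets ν n)) :=
      ⟨by simpa using measure_spanningSets_lt_top ν n⟩
    exact (ht.mono_measure Measure.restrict_le_self).integrable (by norm_num)
  have hVnt : ∀ t, MemLp (fun e => U (t, e)) 2 ν → ∀ n, MemLp (fun e => Vn n (t, e)) 2 ν :=
    fun t ht n => (Lp.memLp _).ae_eq (hVae t ht n)
  have hVtoLp : ∀ t (ht : MemLp (fun e => U (t, e)) 2 ν) n,
      (hVnt t ht n).toLp _ = Φ ((hgoodn t ht n).toLp _) := by
    intro t ht n
    rw [← Lp.toLp_coeFn (Φ ((hgoodn t ht n).toLp _)) (Lp.memLp _)]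
    exact MemLp.toLp_congr _ _ (hVae t ht n).symm
  -- the slices of the differences
  have hslice : ∀ t, MemLp (fun e => U (t, e)) 2 ν → ∀ n m,
      eLpNorm (fun e => (Vn n - Vn m) (t, e)) 2 ν = eLpNorm (fun e => (Un n - Un m) (t, e)) 2 ν := by
    intro t ht n m
    have h := hΦ ((hgoodn t ht n).toLp _) ((hgoodn t ht m).toLp _)
    rw [← hVtoLp t ht n, ← hVtoLp t ht m, ← MemLp.toLp_sub, ← MemLp.toLp_sub, Lp.norm_toLp,
      Lp.norm_toLp] at h
    exact (ENNReal.toReal_eq_toReal_iff' ((hVnt t ht n).sub (hVnt t ht m)).2.ne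
      ((hgoodn t ht n).sub (hgoodn t ht m)).2.ne).1 h
  have hslice0 : ∀ t, MemLp (fun e => U (t, e)) 2 ν → ∀ n,
      eLpNorm (fun e => Vn n (t, e)) 2 ν = eLpNorm (fun e => Un n (t, e)) 2 ν := by
    intro t ht n
    have h := hΦ ((hgoodn t ht n).toLp _) 0
    rw [hΦ0, sub_zero, sub_zero, ← hVtoLp t ht n, Lp.norm_toLp, Lp.norm_toLp] at h
    exact (ENNReal.toReal_eq_toReal_iff' (hVnt t ht n).2.ne (hgoodn t ht n).2.ne).1 h
  have hdiff : ∀ n m, eLpNorm (Vn n - Vn m) 2 (τ.prod ν) = eLpNorm (Un n - Un m) 2 (τ.prod ν) := by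
    intro n m
    have h : eLpNorm (Vn n - Vn m) 2 (τ.prod ν) ^ 2 = eLpNorm (Un n - Un m) 2 (τ.prod ν) ^ 2 := by
      rw [eLpNorm_two_sq_prod ((hVnm n).sub (hVnm m)).aestronglyMeasurable,
        eLpNorm_two_sq_prod ((hUnm n).sub (hUnm m)).aestronglyMeasurable]
      refine lintegral_congr_ae ?_
      filter_upwards [hgood] with t ht
      rw [hslice t ht]
    exact (ENNReal.pow_right_strictMono two_ne_zero).injective h
  have hVn : ∀ n, MemLp (Vn n) 2 (τ.prod ν) := by
    intro n
    refine ⟨(hVnm n).aestronglyMeasurable, ?_⟩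
    have h : eLpNorm (Vn n) 2 (τ.prod ν) ^ 2 = eLpNorm (Un n) 2 (τ.prod ν) ^ 2 := by
      rw [eLpNorm_two_sq_prod (hVnm n).aestronglyMeasurable,
        eLpNorm_two_sq_prod (hUnm n).aestronglyMeasurable]
      refine lintegral_congr_ae ?_
      filter_upwards [hgood] with t ht
      rw [hslice0 t ht]
    rw [(ENNReal.pow_right_strictMono two_ne_zero).injective h]
    exact (hUn n).2
  have hlimU : Tendsto (fun n => (hUn n).toLp _) atTop (𝓝 (hU.toLp U)) := by
    rw [Lp.tendsto_Lp_iff_tendsto_eLpNorm'']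
    exact tendsto_eLpNorm_indicator_sub hU hD
      (fun n m h => preimage_mono (monotone_spanningSets ν h))
      (by rw [← preimage_iUnion, iUnion_spanningSets, preimage_univ])
  -- `Φ` preserves distances on almost every slice, hence, after integration in `t`, on the product;
  -- the images inherit the Cauchy property of the truncations.
  have hcau : CauchySeq fun n => (hVn n).toLp _ := by
    have h := hlimU.cauchySeq
    rw [Metric.cauchySeq_iff] at h ⊢
    intro ε hε
    obtain ⟨N, hN⟩ := h ε hε
    refine ⟨N, fun m hm n hn => ?_⟩
    have := hN m hm n hn
    rw [dist_eq_norm, ← MemLp.toLp_sub, Lp.norm_toLp] at this ⊢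
    rwa [hdiff]
  obtain ⟨V', hV⟩ := cauchySeq_tendsto_of_complete hcau
  rw [Lp.tendsto_Lp_iff_tendsto_eLpNorm'] at hV
  obtain ⟨V, hVV⟩ : ∃ V : P × E → ℂ, V = V' := ⟨_, rfl⟩
  rw [← hVV] at hV
  have hVL : MemLp V 2 (τ.prod ν) := hVV ▸ Lp.memLp V'
  have hVm : StronglyMeasurable V := hVV ▸ Lp.stronglyMeasurable V'
  refine ⟨V, hVL, ?_⟩
  have hV1 : Tendsto (fun n => eLpNorm (Vn n - V) 2 (τ.prod ν)) atTop (𝓝 0) := by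
    refine hV.congr fun n => eLpNorm_congr_ae ?_
    filter_upwards [(hVn n).coeFn_toLp] with p hp
    simp [hp]
  have hV2 : Tendsto (fun n => ∫⁻ t, eLpNorm (fun e => (Vn n - V) (t, e)) 2 ν ^ 2 ∂τ) atTop (𝓝 0) := by
    have := ENNReal.Tendsto.pow (n := 2) hV1
    simp only [ne_eq, OfNat.ofNat_ne_zero, not_false_eq_true, zero_pow] at this
    refine this.congr fun n => ?_
    rw [eLpNorm_two_sq_prod ((hVnm n).sub hVm).aestronglyMeasurable]
  -- Convergence in `L₂` of the product does not give convergence on each slice, but Fatou's lemma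
  -- gives a zero lower limit for almost every `t`. That is enough, as `Φ` of the truncated slices
  -- converges along the whole sequence.
  have hV3 : ∀ᵐ t ∂τ, liminf (fun n => eLpNorm (fun e => (Vn n - V) (t, e)) 2 ν ^ 2) atTop = 0 := by
    have hmeas : ∀ n, Measurable fun t => eLpNorm (fun e => (Vn n - V) (t, e)) 2 ν ^ 2 := by
      intro n
      simp only [eLpNorm_two_sq]
      exact (((hVnm n).sub hVm).enorm.pow_const 2).lintegral_prod_right'
    have := lintegral_liminf_le (μ := τ) (u := atTop) hmeas
    rw [hV2.liminf_eq, nonpos_iff_eq_zero, lintegral_eq_zero_iff (.liminf hmeas)] at this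
    exact this
  filter_upwards [hgood, ae_memLp_slice hVL, hV3] with t ht hVt h3
  refine ⟨ht, hVt, ?_⟩
  have hc : Tendsto (fun n => Φ ((hgoodn t ht n).toLp _)) atTop (𝓝 (Φ (ht.toLp _))) := by
    have : Tendsto (fun n => (hgoodn t ht n).toLp _) atTop (𝓝 (ht.toLp _)) := by
      rw [Lp.tendsto_Lp_iff_tendsto_eLpNorm'']
      simp only [hUn_slice]
      exact tendsto_eLpNorm_indicator_sub ht (measurableSet_spanningSets ν)
        (monotone_spanningSets ν) (iUnion_spanningSets ν)
    rw [tendsto_iff_norm_sub_tendsto_zero] at this ⊢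
    simpa only [hΦ] using this
  rw [← sub_eq_zero, ← norm_eq_zero]
  by_contra hne
  have hpos : 0 < ‖Φ (ht.toLp _) - hVt.toLp _‖ := lt_of_le_of_ne (norm_nonneg _) (Ne.symm hne)
  set ε := ‖Φ (ht.toLp _) - hVt.toLp _‖ / 2 with hε
  have hε0 : 0 < ε := by positivity
  have hf : ∃ᶠ n in atTop, eLpNorm (fun e => (Vn n - V) (t, e)) 2 ν ^ 2 < ENNReal.ofReal ε ^ 2 := by
    refine frequently_lt_of_liminf_lt ?_ ?_
    · isBoundedDefault
    · rw [h3]; positivity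
  have he : ∀ᶠ n in atTop, ‖Φ ((hgoodn t ht n).toLp _) - Φ (ht.toLp _)‖ < ε := by
    have := tendsto_iff_norm_sub_tendsto_zero.1 hc
    exact this.eventually_lt_const hε0
  obtain ⟨n, h1, h2⟩ := (hf.and_eventually he).exists
  have h1' : ‖Φ ((hgoodn t ht n).toLp _) - hVt.toLp _‖ < ε := by
    rw [← hVtoLp t ht n, ← MemLp.toLp_sub, Lp.norm_toLp]
    have h1 := (ENNReal.pow_right_strictMono two_ne_zero).lt_iff_lt.1 h1
    exact (ENNReal.toReal_lt_toReal ((hVnt t ht n).sub hVt).2.ne (by simp)).2 h1 |>.trans_eq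
      (ENNReal.toReal_ofReal hε0.le)
  have := norm_sub_le_norm_sub_add_norm_sub (Φ (ht.toLp _)) (Φ ((hgoodn t ht n).toLp _)) (hVt.toLp _)
  rw [norm_sub_rev] at h2
  linarith

end PartialTransform

/-! ### The Fourier transform in one of two variables. -/

section PartialFourier

variable {P E : Type*} [MeasurableSpace P] [NormedAddCommGroup E] [InnerProductSpace ℝ E]
  [FiniteDimensional ℝ E] [MeasurableSpace E] [BorelSpace E] {τ : Measure P}

lemma stronglyMeasurable_fourier_slice {W : P × E → ℂ} (hW : StronglyMeasurable W) :
    StronglyMeasurable fun p : P × E => 𝓕 (fun e => W (p.1, e)) p.2 := by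
  simp only [Real.fourier_eq]
  refine StronglyMeasurable.integral_prod_right (f := fun (p : P × E) (v : E) =>
    Real.fourierChar (-inner ℝ v p.2) • W (p.1, v)) ?_
  refine StronglyMeasurable.smul ?_ (hW.comp_measurable (by fun_prop))
  have : Continuous fun q : E × E => ((Real.fourierChar (-inner ℝ q.2 q.1) : Circle) : ℂ) := by
    fun_prop
  exact this.stronglyMeasurable.comp_measurable
    ((measurable_snd.comp measurable_fst).prodMk measurable_snd)

lemma stronglyMeasurable_fourierInv_slice {W : P × E → ℂ} (hW : StronglyMeasurable W) :
    StronglyMeasurable fun p : P × E => 𝓕⁻ (fun e => W (p.1, e)) p.2 := by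
  have h : (fun p : P × E => 𝓕⁻ (fun e => W (p.1, e)) p.2)
      = fun p : P × E => 𝓕 (fun e => W (p.1, e)) (-p.2) :=
    funext fun p => Real.fourierInv_eq_fourier_neg _ _
  rw [h]
  have h2 : Measurable fun p : P × E => (p.1, -p.2) := measurable_fst.prodMk measurable_snd.neg
  have h3 := (stronglyMeasurable_fourier_slice hW).comp_measurable h2
  simpa only [Function.comp_def] using h3

lemma norm_fourier_sub (f g : Lp (α := E) ℂ 2 volume) : ‖𝓕 f - 𝓕 g‖ = ‖f - g‖ := by
  have h1 : (Lp.fourierTransformₗᵢ E ℂ) (f - g)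
    = (Lp.fourierTransformₗᵢ E ℂ) f - (Lp.fourierTransformₗᵢ E ℂ) g := map_sub _ f g
  have h2 : ‖(Lp.fourierTransformₗᵢ E ℂ) (f - g)‖ = ‖f - g‖ :=
    LinearIsometryEquiv.norm_map _ _
  rw [h1] at h2
  exact h2

lemma norm_fourierInv_sub (f g : Lp (α := E) ℂ 2 volume) : ‖𝓕⁻ f - 𝓕⁻ g‖ = ‖f - g‖ := by
  have h := norm_fourier_sub (𝓕⁻ f) (𝓕⁻ g)
  rw [FourierTransform.fourier_fourierInv_eq, FourierTransform.fourier_fourierInv_eq] at h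
  exact h.symm

/-- `V` is the `L₂`-Fourier transform of `U` in the second variable. -/
def IsPartialFourier (τ : Measure P) (U V : P × E → ℂ) : Prop :=
  MemLp U 2 (τ.prod volume) ∧ MemLp V 2 (τ.prod volume) ∧
    ∀ᵐ t ∂τ, IsFourierL2 (fun e => U (t, e)) (fun e => V (t, e))

theorem exists_partialFourier [SFinite τ] {U : P × E → ℂ} (hU : MemLp U 2 (τ.prod volume)) :
    ∃ V, IsPartialFourier τ U V := by
  obtain ⟨V, hV, h⟩ := exists_slicewise_isometry (fun f : Lp (α := E) ℂ 2 volume => 𝓕 f)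
    norm_fourier_sub (map_zero (Lp.fourierTransformₗᵢ E ℂ)) (fun f : E → ℂ => 𝓕 f)
    (fun g hg hg2 => fourier_toLp_ae_eq hg hg2)
    (fun W hW => stronglyMeasurable_fourier_slice hW) hU
  exact ⟨V, hU, hV, h⟩

theorem exists_partialFourierInv [SFinite τ] {V : P × E → ℂ} (hV : MemLp V 2 (τ.prod volume)) :
    ∃ U, IsPartialFourier τ U V := by
  obtain ⟨U, hU, h⟩ := exists_slicewise_isometry (fun f : Lp (α := E) ℂ 2 volume => 𝓕⁻ f)
    norm_fourierInv_sub
    (map_zero (Lp.fourierTransformₗᵢ E ℂ).symm) (fun f : E → ℂ => 𝓕⁻ f)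
    (fun g hg hg2 => fourierInv_toLp_ae_eq hg hg2)
    (fun W hW => stronglyMeasurable_fourierInv_slice hW) hV
  refine ⟨U, hU, hV, ?_⟩
  filter_upwards [h] with t ⟨h1, h2, h3⟩
  refine ⟨h2, h1, ?_⟩
  rw [← h3, FourierTransform.fourier_fourierInv_eq]

lemma integrable_conj_mul {α : Type*} [MeasurableSpace α] {μ : Measure α} {f g : α → ℂ}
    (hf : MemLp f 2 μ) (hg : MemLp g 2 μ) :
    Integrable (fun x => (starRingEnd ℂ (f x)) * g x) μ :=
  MemLp.integrable_mul (p := 2) (q := 2) hf.star hg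

lemma IsPartialFourier.integral_conj_mul [SFinite τ] {U V U' V' : P × E → ℂ}
    (h : IsPartialFourier τ U V) (h' : IsPartialFourier τ U' V') :
    ∫ p, (starRingEnd ℂ (V p)) * V' p ∂(τ.prod volume)
      = ∫ p, (starRingEnd ℂ (U p)) * U' p ∂(τ.prod volume) := by
  rw [integral_prod _ (integrable_conj_mul h.2.1 h'.2.1),
    integral_prod _ (integrable_conj_mul h.1 h'.1)]
  refine integral_congr_ae ?_
  filter_upwards [h.2.2, h'.2.2] with t ht ht'
  exact ht.integral_conj_mul ht'

end PartialFourier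

/-! ### Weak derivatives on an open half-line. -/

section OneDim

/-- Only the right end must be placed inside `I`; when `I` is a lower set this already puts the
whole interval into `I`. -/
lemma exists_Ioo_superset {I : Set ℝ} (hI : IsOpen I) {K : Set ℝ}
    (hK : IsCompact K) (hne : K.Nonempty) (hKI : K ⊆ I) :
    ∃ a b : ℝ, a < b ∧ b ∈ I ∧ K ⊆ Ioo a b := by
  obtain ⟨a, ha⟩ := hK.bddBelow
  have hs := hK.sSup_mem hne
  obtain ⟨b, hb, hbI⟩ : ∃ b, sSup K < b ∧ b ∈ I := by
    have h1 : ∀ᶠ b in 𝓝[>] (sSup K), b ∈ I :=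
      nhdsWithin_le_nhds (hI.mem_nhds (hKI hs))
    obtain ⟨b, h1, h2⟩ := (h1.and self_mem_nhdsWithin).exists
    exact ⟨b, h2, h1⟩
  have h3 : ∀ x ∈ K, a - 1 < x ∧ x < b := fun x hx =>
    ⟨by linarith [ha hx], (le_csSup hK.bddAbove hx).trans_lt hb⟩
  exact ⟨a - 1, b, (h3 _ hs).1.trans (h3 _ hs).2, hbI, h3⟩

lemma icc_subset_of_isLowerSet {I : Set ℝ} (hl : IsLowerSet I) {a b : ℝ} (hb : b ∈ I) :
    Icc a b ⊆ I := fun _ hx => hl hx.2 hb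

lemma intervalIntegrable_of_locallyIntegrable {F : Type*} [NormedAddCommGroup F] {I : Set ℝ}
    (hl : IsLowerSet I) {B : ℝ → F}
    (hB : LocallyIntegrable B (volume.restrict I)) {a b : ℝ} (ha : a ∈ I) (hb : b ∈ I) :
    IntervalIntegrable B volume a b := by
  rw [intervalIntegrable_iff]
  have h := hB.integrableOn_isCompact (isCompact_uIcc (a := a) (b := b))
  rw [IntegrableOn, Measure.restrict_restrict measurableSet_uIcc] at h
  have hs : uIcc a b ⊆ I := by
    rw [uIcc]; exact icc_subset_of_isLowerSet hl (by rcases max_cases a b with h | h <;> rw [h.1] <;> assumption)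
  rw [inter_eq_left.2 hs] at h
  exact IntegrableOn.mono_set h uIoc_subset_uIcc

lemma setIntegral_eq_intervalIntegral {F : Type*} [NormedAddCommGroup F] [NormedSpace ℝ F]
    {I : Set ℝ} (hl : IsLowerSet I) {a b : ℝ} (hab : a < b) (hb : b ∈ I) {f : ℝ → F}
    (hf : ∀ t, t ∉ Ioo a b → f t = 0) : ∫ t in I, f t = ∫ t in a..b, f t := by
  have h : Ioc a b ⊆ I := Ioc_subset_Icc_self.trans (icc_subset_of_isLowerSet hl hb)
  rw [intervalIntegral.integral_of_le hab.le,
    setIntegral_eq_integral_of_forall_compl_eq_zero (fun t ht => hf t fun h' =>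
      ht (h (Ioo_subset_Ioc_self h'))),
    setIntegral_eq_integral_of_forall_compl_eq_zero (fun t ht => hf t fun h' =>
      ht (Ioo_subset_Ioc_self h'))]

/-- Integration by parts for absolutely continuous functions on an interval containing `t₀` and the
support of `θ`, at whose ends `θ` vanishes. -/
lemma setIntegral_deriv_mul_primitive {I : Set ℝ} (hI : IsOpen I) (hl : IsLowerSet I) {B : ℝ → ℝ}
    (hB : LocallyIntegrable B (volume.restrict I)) {t₀ : ℝ} (ht₀ : t₀ ∈ I) {θ : ℝ → ℝ}
    (hθ : ContDiff ℝ ∞ θ) (hc : HasCompactSupport θ) (hs : tsupport θ ⊆ I) :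
    ∫ t in I, deriv θ t * ∫ s in t₀..t, B s = - ∫ t in I, θ t * B t := by
  obtain ⟨a, b, hab, hbI, hK⟩ := exists_Ioo_superset hI
    (hc.isCompact.union (isCompact_singleton (x := t₀))) ⟨t₀, by simp⟩
    (union_subset hs (by simpa using ht₀))
  have h1 : ∀ t, t ∉ Ioo a b → θ t = 0 := fun t ht => image_eq_zero_of_notMem_tsupport
    fun h => ht (hK (Or.inl h))
  have h2 : ∀ t, t ∉ Ioo a b → deriv θ t = 0 := fun t ht => by
    by_contra h
    exact ht (hK (Or.inl (support_deriv_subset h)))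
  have haI : a ∈ I := hl hab.le hbI
  have ht : t₀ ∈ uIcc a b := by
    rw [uIcc_of_le hab.le]; exact Ioo_subset_Icc_self (hK (Or.inr rfl))
  rw [setIntegral_eq_intervalIntegral hl hab hbI fun t ht => by rw [h2 t ht, zero_mul],
    setIntegral_eq_intervalIntegral hl hab hbI fun t ht => by rw [h1 t ht, zero_mul]]
  have hBi := intervalIntegrable_of_locallyIntegrable hl hB haI hbI
  have hac := hBi.absolutelyContinuousOnInterval_intervalIntegral ht
  have hac2 : AbsolutelyContinuousOnInterval θ a b :=
    (hθ.of_le (by exact_mod_cast le_top) : ContDiff ℝ 1 θ).contDiffOn.absolutelyContinuousOnInterval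
  have key := hac2.integral_mul_deriv_eq_deriv_mul hac
  rw [h1 a (by simp), h1 b (by simp)] at key
  have h3 : ∫ x in a..b, θ x * deriv (fun x => ∫ v in t₀..x, B v) x = ∫ x in a..b, θ x * B x := by
    refine intervalIntegral.integral_congr_ae ?_
    filter_upwards [hBi.ae_hasDerivAt_integral] with x hx hx'
    rw [(hx (uIoc_subset_uIcc hx') t₀ ht).deriv]
  rw [h3] at key
  linarith

/-- The primitive that starts to the left of the support vanishes again to its right, because the
total integral is zero. -/
lemma exists_contDiff_primitive {I : Set ℝ} (hI : IsOpen I) (hl : IsLowerSet I) {ρ : ℝ → ℝ}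
    (hρ : ContDiff ℝ ∞ ρ) (hc : HasCompactSupport ρ) (hs : tsupport ρ ⊆ I) (h0 : ∫ t, ρ t = 0)
    (hne : I.Nonempty) :
    ∃ R : ℝ → ℝ, ContDiff ℝ ∞ R ∧ HasCompactSupport R ∧ tsupport R ⊆ I ∧ deriv R = ρ := by
  obtain ⟨t₀, ht₀⟩ := hne
  obtain ⟨a, b, hab, hbI, hK⟩ := exists_Ioo_superset hI
    (hc.isCompact.union (isCompact_singleton (x := t₀))) ⟨t₀, by simp⟩
    (union_subset hs (by simpa using ht₀))
  have h1 : ∀ t, t ∉ Ioo a b → ρ t = 0 := fun t ht => image_eq_zero_of_notMem_tsupport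
    fun h => ht (hK (Or.inl h))
  have hd : ∀ x, HasDerivAt (fun t => ∫ s in a..t, ρ s) (ρ x) x := fun x =>
    intervalIntegral.integral_hasDerivAt_right (hρ.continuous.intervalIntegrable _ _)
      hρ.continuous.aestronglyMeasurable.stronglyMeasurableAtFilter hρ.continuous.continuousAt
  have hsupp : Function.support (fun t => ∫ s in a..t, ρ s) ⊆ Icc a b := by
    intro t ht
    by_contra hcon
    apply ht
    rw [mem_Icc, not_and_or, not_le, not_le] at hcon
    rcases hcon with h | h
    · refine (intervalIntegral.integral_congr (g := 0) fun s hs => h1 s ?_).trans (by simp)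
      rw [uIcc_of_ge h.le] at hs
      exact fun h' => absurd hs.2 (not_le.2 h'.1)
    · simp only
      rw [intervalIntegral.integral_of_le (hab.le.trans h.le),
        setIntegral_eq_integral_of_forall_compl_eq_zero, h0]
      exact fun s hs => h1 s fun h' => hs ⟨h'.1, h'.2.le.trans h.le⟩
  have hderiv : deriv (fun t => ∫ s in a..t, ρ s) = ρ := funext fun x => (hd x).deriv
  refine ⟨_, ?_, ?_, ?_, hderiv⟩
  · rw [contDiff_infty_iff_deriv, hderiv]
    exact ⟨fun x => (hd x).differentiableAt, hρ⟩
  · exact HasCompactSupport.of_support_subset_isCompact isCompact_Icc hsupp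
  · exact (closure_minimal hsupp isClosed_Icc).trans (icc_subset_of_isLowerSet hl hbI)

lemma locallyIntegrableOn_of_restrict {F : Type*} [NormedAddCommGroup F] {I : Set ℝ}
    (hI : IsOpen I) {B : ℝ → F} (hB : LocallyIntegrable B (volume.restrict I)) :
    LocallyIntegrableOn B I := by
  rw [locallyIntegrableOn_iff hI.isLocallyClosed]
  intro k hk hkc
  have := hB.integrableOn_isCompact hkc
  rwa [IntegrableOn, Measure.restrict_restrict hkc.measurableSet, inter_eq_left.2 hk] at this

lemma integrable_mul_of_tsupport_subset {I : Set ℝ} {Z θ : ℝ → ℝ}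
    (hZ : LocallyIntegrableOn Z I) (hθ : Continuous θ) (hc : HasCompactSupport θ)
    (hs : tsupport θ ⊆ I) : Integrable (fun t => θ t * Z t) := by
  have h1 : IntegrableOn (fun t => θ t * Z t) (tsupport θ) :=
    (hZ.integrableOn_compact_subset hs hc.isCompact).continuousOn_mul hθ.continuousOn hc.isCompact
  rwa [integrableOn_iff_integrable_of_support_subset] at h1
  exact fun t ht => subset_tsupport _ (left_ne_zero_of_mul ht)

lemma integrable_contDiff_mul {I : Set ℝ} {B θ : ℝ → ℝ}
    (hB : LocallyIntegrable B (volume.restrict I))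
    (hθ : Continuous θ) (hc : HasCompactSupport θ) :
    Integrable (fun t => θ t * B t) (volume.restrict I) :=
  hB.integrable_smul_left_of_hasCompactSupport hθ hc

/-- A function with weak derivative `B` is a primitive of `B`. -/
theorem ae_eq_const_add_primitive {I : Set ℝ} (hI : IsOpen I) (hl : IsLowerSet I) {A B : ℝ → ℝ}
    (hA : LocallyIntegrable A (volume.restrict I)) (hB : LocallyIntegrable B (volume.restrict I))
    (h : ∀ θ : ℝ → ℝ, ContDiff ℝ ∞ θ → HasCompactSupport θ → tsupport θ ⊆ I →
      ∫ t in I, (deriv θ t * A t + θ t * B t) = 0) {t₀ : ℝ} (ht₀ : t₀ ∈ I) :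
    ∃ c : ℝ, ∀ᵐ t ∂(volume.restrict I), A t = c + ∫ s in t₀..t, B s := by
  set J : ℝ → ℝ := fun t => ∫ s in t₀..t, B s with hJ
  have hJc : ContinuousOn J I := by
    intro t ht
    obtain ⟨a, b, hab, hbI, hK⟩ := exists_Ioo_superset hI
      (isCompact_singleton.union (isCompact_singleton (x := t₀)) : IsCompact ({t} ∪ {t₀})) ⟨t₀, by simp⟩
      (union_subset (by simpa using ht) (by simpa using ht₀))
    have hBi := intervalIntegrable_of_locallyIntegrable hl hB (hl hab.le hbI) hbI
    have := (hBi.absolutelyContinuousOnInterval_intervalIntegral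
      (Icc_subset_uIcc (Ioo_subset_Icc_self (hK (Or.inr rfl))))).continuousOn
    rw [uIcc_of_le hab.le] at this
    exact (this.continuousAt (Icc_mem_nhds (hK (Or.inl rfl)).1 (hK (Or.inl rfl)).2)).continuousWithinAt
  have hJl : LocallyIntegrableOn J I := hJc.locallyIntegrableOn hI.measurableSet
  have hAl := locallyIntegrableOn_of_restrict hI hA
  have hZ : LocallyIntegrableOn (fun t => A t - J t) I := hAl.sub hJl
  have hZi : ∀ θ : ℝ → ℝ, Continuous θ → HasCompactSupport θ → tsupport θ ⊆ I →
      Integrable (fun t => θ t * (A t - J t)) := fun θ hθ hc hs =>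
    integrable_mul_of_tsupport_subset hZ hθ hc hs
  have hset : ∀ θ Z : ℝ → ℝ, tsupport θ ⊆ I → ∫ t in I, θ t * Z t = ∫ t, θ t * Z t :=
    fun θ Z hs => setIntegral_eq_integral_of_forall_compl_eq_zero fun t ht => by
      rw [image_eq_zero_of_notMem_tsupport fun h => ht (hs h), zero_mul]
  have hZ0 : ∀ θ : ℝ → ℝ, ContDiff ℝ ∞ θ → HasCompactSupport θ → tsupport θ ⊆ I →
      ∫ t, deriv θ t * (A t - J t) = 0 := by
    intro θ hθ hc hs
    have hs' : tsupport (deriv θ) ⊆ I := (tsupport_deriv_subset).trans hs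
    have hcd : Continuous (deriv θ) := hθ.continuous_deriv (by simp)
    have h1 := h θ hθ hc hs
    have h2 := setIntegral_deriv_mul_primitive hI hl hB ht₀ hθ hc hs
    have i1 := integrable_contDiff_mul hA hcd hc.deriv
    have i2 := integrable_contDiff_mul hB hθ.continuous hc
    have i3 : Integrable (fun t => deriv θ t * J t) (volume.restrict I) :=
      (integrable_mul_of_tsupport_subset hJl hcd hc.deriv hs').restrict
    rw [integral_add i1 i2] at h1
    rw [← hset _ _ hs']
    simp only [mul_sub]
    rw [integral_sub i1 i3]
    linarith
  -- The argument of du Bois-Reymond: `A - J` annihilates derivatives of test functions, that is,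
  -- test functions of integral zero. A fixed bump `θ₀` of integral one reduces every test function
  -- to this case and determines the constant `c`.
  obtain ⟨r, hr, hrI⟩ := Metric.isOpen_iff.1 hI t₀ ht₀
  let β : ContDiffBump t₀ := ⟨r / 4, r / 2, by positivity, by linarith⟩
  let θ₀ : ℝ → ℝ := β.normed volume
  have hθ₀ : ContDiff ℝ ∞ θ₀ := β.contDiff_normed
  have hθ₀c : HasCompactSupport θ₀ := β.hasCompactSupport_normed
  have hθ₀s : tsupport θ₀ ⊆ I := by
    rw [β.tsupport_normed_eq]
    exact (Metric.closedBall_subset_ball (by change r / 2 < r; linarith)).trans hrI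
  have hθ₀1 : ∫ t, θ₀ t = 1 := β.integral_normed
  set c := ∫ t, θ₀ t * (A t - J t) with hcdef
  refine ⟨c, ?_⟩
  have hfin : ∀ᵐ t, t ∈ I → (A t - J t) - c = 0 := by
    refine hI.ae_eq_zero_of_integral_contDiff_smul_eq_zero
      (hZ.sub (continuousOn_const.locallyIntegrableOn hI.measurableSet)) fun θ hθ hc hs => ?_
    set m := ∫ t, θ t with hm
    have hθi : Integrable θ := hθ.continuous.integrable_of_hasCompactSupport hc
    have hθ₀i : Integrable θ₀ := hθ₀.continuous.integrable_of_hasCompactSupport hθ₀c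
    have hρs : tsupport (fun t => θ t - m * θ₀ t) ⊆ I := by
      refine (tsupport_sub _ _).trans (union_subset hs ?_)
      exact (tsupport_mul_subset_right).trans hθ₀s
    obtain ⟨R, hR, hRc, hRs, hRd⟩ := exists_contDiff_primitive hI hl
      (hθ.sub (contDiff_const.mul hθ₀) : ContDiff ℝ ∞ fun t => θ t - m * θ₀ t)
      (hc.sub hθ₀c.mul_left) hρs
      (by rw [integral_sub hθi (hθ₀i.const_mul m), integral_const_mul, hθ₀1, ← hm]; ring) ⟨t₀, ht₀⟩
    have h1 := hZ0 R hR hRc hRs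
    rw [hRd] at h1
    have i1 := hZi θ hθ.continuous hc hs
    have i2 := hZi θ₀ hθ₀.continuous hθ₀c hθ₀s
    have e1 : ∫ t, (θ t - m * θ₀ t) * (A t - J t) = (∫ t, θ t * (A t - J t)) - m * c := by
      rw [hcdef, ← integral_const_mul, ← integral_sub i1 (i2.const_mul m)]
      exact integral_congr_ae (.of_forall fun t => by ring)
    have e2 : ∫ t, θ t • (A t - J t - c) = (∫ t, θ t * (A t - J t)) - m * c := by
      rw [hm, ← integral_mul_const, ← integral_sub i1 (hθi.mul_const c)]
      exact integral_congr_ae (.of_forall fun t => by simp only [smul_eq_mul]; ring)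
    rw [e2, ← e1, h1]
  rw [ae_restrict_iff' hI.measurableSet]
  filter_upwards [hfin] with t ht htI
  linarith [ht htI]

end OneDim

/-! ### From product test functions to almost every slice. -/

section Slices

variable {E : Type*} [NormedAddCommGroup E] [InnerProductSpace ℝ E] [FiniteDimensional ℝ E]
  [MeasurableSpace E] [BorelSpace E]

/-- Fubini on the countably many boxes `[-n, n] × B(0, n)`, which exhaust all compact sets. -/
lemma ae_slice_locallyIntegrable {τ : Measure ℝ} [SFinite τ] {A : ℝ × E → ℂ}
    (hA : LocallyIntegrable A (τ.prod (volume : Measure E))) :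
    ∀ᵐ e : E, LocallyIntegrable (fun t => A (t, e)) τ := by
  have h1 : ∀ n : ℕ, ∀ᵐ e : E, e ∈ Metric.closedBall (0 : E) n →
      IntegrableOn (fun t => A (t, e)) (Icc (-n : ℝ) n) τ := by
    intro n
    have h := hA.integrableOn_isCompact
      ((isCompact_Icc (a := (-n : ℝ)) (b := n)).prod (isCompact_closedBall (0 : E) n))
    rw [IntegrableOn, ← Measure.prod_restrict] at h
    have := h.prod_left_ae
    rwa [ae_restrict_iff' Metric.isClosed_closedBall.measurableSet] at this
  filter_upwards [ae_all_iff.2 h1] with e he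
  rw [locallyIntegrable_iff]
  intro K hK
  obtain ⟨r, hr⟩ := hK.isBounded.subset_closedBall 0
  obtain ⟨n, hn⟩ := exists_nat_ge (max r ‖e‖)
  refine (he n (by simpa using (le_max_right r _).trans hn)).mono_set (hr.trans ?_)
  intro t ht
  rw [mem_closedBall_zero_iff, Real.norm_eq_abs, abs_le] at ht
  have := (le_max_left r ‖e‖).trans hn
  exact ⟨by linarith [ht.1], by linarith [ht.2]⟩

lemma locallyIntegrable_slice_smul {τ : Measure ℝ} [SFinite τ] {A : ℝ × E → ℂ}
    (hA : LocallyIntegrable A (τ.prod (volume : Measure E))) {θ : ℝ → ℝ} (hθ : Continuous θ)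
    (hc : HasCompactSupport θ) {K : Set E} (hK : IsCompact K) :
    Integrable (fun p => θ p.1 • A p) (τ.prod (volume.restrict K)) := by
  have h : IntegrableOn A ((tsupport θ) ×ˢ K) (τ.prod volume) :=
    hA.integrableOn_isCompact (hc.isCompact.prod hK)
  have h2 : IntegrableOn (fun p : ℝ × E => θ p.1 • A p) ((tsupport θ) ×ˢ K) (τ.prod volume) :=
    h.continuousOn_smul (hθ.comp continuous_fst).continuousOn (hc.isCompact.prod hK)
  have h3 : IntegrableOn (fun p : ℝ × E => θ p.1 • A p) ((tsupport θ) ×ˢ univ)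
      (τ.prod (volume.restrict K)) := by
    rwa [IntegrableOn, ← Measure.prod_restrict, Measure.restrict_univ, Measure.prod_restrict]
  rwa [integrableOn_iff_integrable_of_support_subset] at h3
  exact fun p hp => ⟨subset_tsupport _ (left_ne_zero_of_smul hp), mem_univ _⟩

/-- By Fubini the slice integral is a locally integrable function of `e`, and it is orthogonal to
all test functions. -/
lemma integral_slice_ae_eq_zero {τ : Measure ℝ} [SFinite τ] {Φ : ℝ × E → ℂ}
    (hΦ : ∀ K : Set E, IsCompact K → Integrable Φ (τ.prod (volume.restrict K)))
    (h : ∀ ψ : E → ℝ, ContDiff ℝ ∞ ψ → HasCompactSupport ψ →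
      ∫ p, ψ p.2 • Φ p ∂(τ.prod volume) = 0) :
    ∀ᵐ e : E, ∫ t, Φ (t, e) ∂τ = 0 := by
  refine ae_eq_zero_of_integral_contDiff_smul_eq_zero ?_ fun ψ hψ hc => ?_
  · rw [locallyIntegrable_iff]
    exact fun K hK => (hΦ K hK).integral_prod_right
  · have hi : Integrable (fun p : ℝ × E => ψ p.2 • Φ p) (τ.prod volume) := by
      have h1 := hΦ _ hc.isCompact
      obtain ⟨C, hC⟩ := hψ.continuous.bounded_above_of_compact_support hc
      have h2 : Integrable (fun p : ℝ × E => ψ p.2 • Φ p) (τ.prod (volume.restrict (tsupport ψ))) :=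
        h1.bdd_smul C ((hψ.continuous.comp continuous_snd).aestronglyMeasurable)
          (.of_forall fun p => hC _)
      have h3 : IntegrableOn (fun p : ℝ × E => ψ p.2 • Φ p) (univ ×ˢ tsupport ψ)
          (τ.prod volume) := by
        rwa [IntegrableOn, ← Measure.prod_restrict, Measure.restrict_univ]
      rwa [integrableOn_iff_integrable_of_support_subset] at h3
      exact fun p hp => ⟨mem_univ _, subset_tsupport _ (left_ne_zero_of_smul hp)⟩
    have := h ψ hψ hc
    rw [integral_prod_symm _ hi] at this
    rw [← this]
    refine integral_congr_ae (.of_forall fun e => ?_)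
    simp only
    rw [integral_smul]

/-- Smooth functions with compact support in `I ∩ [-n, n]`. -/
def TestOn (I : Set ℝ) (n : ℕ) : Type :=
  {θ : ℝ → ℝ // ContDiff ℝ ∞ θ ∧ HasCompactSupport θ ∧ tsupport θ ⊆ I ∧ tsupport θ ⊆ Icc (-n : ℝ) n}

/-- A test function and its derivative, restricted to `[-n, n]`. -/
def TestOn.toC1 {I : Set ℝ} {n : ℕ} (θ : TestOn I n) :
    C(Icc (-n : ℝ) n, ℝ) × C(Icc (-n : ℝ) n, ℝ) :=
  (⟨fun t => θ.1 t, θ.2.1.continuous.comp continuous_subtype_val⟩,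
    ⟨fun t => deriv θ.1 t, (θ.2.1.continuous_deriv (by simp)).comp continuous_subtype_val⟩)

/-- Lipschitz in the sup norm, with constant `∫ ‖A‖`. It allows the slice identity to pass from a
dense set of test functions to all of them. -/
lemma continuous_integral_Icc {τ : Measure ℝ} {n : ℕ} (hn : (-n : ℝ) ≤ n) {A : ℝ → ℂ}
    (hA : IntegrableOn A (Icc (-n : ℝ) n) τ) :
    Continuous fun f : C(Icc (-n : ℝ) n, ℝ) => ∫ t in Icc (-n : ℝ) n, (IccExtend hn f t) • A t ∂τ := by
  have hint : ∀ f : C(Icc (-n : ℝ) n, ℝ),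
      Integrable (fun t => (IccExtend hn f t) • A t) (τ.restrict (Icc (-n : ℝ) n)) := by
    intro f
    refine hA.bdd_smul ‖f‖ ((f.continuous.Icc_extend' (h := hn)).aestronglyMeasurable)
      (.of_forall fun t => f.norm_coe_le_norm _)
  refine LipschitzWith.continuous (K := ⟨∫ t in Icc (-n : ℝ) n, ‖A t‖ ∂τ, by positivity⟩)
    (LipschitzWith.of_dist_le_mul fun f g => ?_)
  rw [dist_eq_norm, ← integral_sub (hint f) (hint g), dist_eq_norm]
  change _ ≤ (∫ t in Icc (-n : ℝ) n, ‖A t‖ ∂τ) * ‖f - g‖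
  rw [← integral_mul_const]
  refine norm_integral_le_of_norm_le (hA.norm.mul_const _) (.of_forall fun t => ?_)
  rw [← sub_smul, norm_smul, mul_comm]
  gcongr
  exact (f - g).norm_coe_le_norm (projIcc _ _ hn t)

/-- Passing from test functions of product form to almost every slice. -/
theorem ae_slice_weak_eq {I : Set ℝ} {A B : ℝ × E → ℂ} {τ : Measure ℝ} [SFinite τ]
    (hA : LocallyIntegrable A (τ.prod (volume : Measure E)))
    (hB : LocallyIntegrable B (τ.prod (volume : Measure E)))
    (h : ∀ θ : ℝ → ℝ, ContDiff ℝ ∞ θ → HasCompactSupport θ → tsupport θ ⊆ I →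
      ∀ ψ : E → ℝ, ContDiff ℝ ∞ ψ → HasCompactSupport ψ →
      ∫ p, ψ p.2 • (deriv θ p.1 • A p + θ p.1 • B p) ∂(τ.prod volume) = 0) :
    ∀ᵐ e : E, ∀ θ : ℝ → ℝ, ContDiff ℝ ∞ θ → HasCompactSupport θ → tsupport θ ⊆ I →
      ∫ t, (deriv θ t • A (t, e) + θ t • B (t, e)) ∂τ = 0 := by
  have h1 : ∀ θ : ℝ → ℝ, ContDiff ℝ ∞ θ → HasCompactSupport θ → tsupport θ ⊆ I →
      ∀ᵐ e : E, ∫ t, (deriv θ t • A (t, e) + θ t • B (t, e)) ∂τ = 0 := fun θ hθ hc hs =>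
    integral_slice_ae_eq_zero (Φ := fun p => deriv θ p.1 • A p + θ p.1 • B p)
      (fun K hK => (locallyIntegrable_slice_smul hA (hθ.continuous_deriv (by simp)) hc.deriv hK).add
        (locallyIntegrable_slice_smul hB hθ.continuous hc hK)) (h θ hθ hc hs)
  have h2 : ∀ n : ℕ, ∀ᵐ e : E, ∀ θ : TestOn I n,
      ∫ t, (deriv θ.1 t • A (t, e) + θ.1 t • B (t, e)) ∂τ = 0 := by
    intro n
    -- For one `θ` the exceptional null set of `e` may depend on `θ`. The `C¹` topology is second
    -- countable, so a countable dense family yields a common null set, and continuity in `C¹`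
    -- covers the remaining test functions.
    let _ : TopologicalSpace (TestOn I n) := TopologicalSpace.induced TestOn.toC1 inferInstance
    have : SecondCountableTopology (TestOn I n) :=
      TopologicalSpace.secondCountableTopology_induced _ _ _
    obtain ⟨s, hs, hd⟩ := TopologicalSpace.exists_countable_dense (TestOn I n)
    have h3 : ∀ᵐ e : E, ∀ θ ∈ s, ∫ t, (deriv θ.1 t • A (t, e) + θ.1 t • B (t, e)) ∂τ = 0 :=
      (ae_ball_iff hs).2 fun θ _ => h1 θ.1 θ.2.1 θ.2.2.1 θ.2.2.2.1
    filter_upwards [h3, ae_slice_locallyIntegrable hA, ae_slice_locallyIntegrable hB]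
      with e he hAe hBe
    have hn : (-n : ℝ) ≤ n := by linarith [n.cast_nonneg (α := ℝ)]
    have iA : IntegrableOn (fun t => A (t, e)) (Icc (-n : ℝ) n) τ :=
      hAe.integrableOn_isCompact isCompact_Icc
    have iB : IntegrableOn (fun t => B (t, e)) (Icc (-n : ℝ) n) τ :=
      hBe.integrableOn_isCompact isCompact_Icc
    have hcont : Continuous fun θ : TestOn I n =>
        (∫ t in Icc (-n : ℝ) n, (IccExtend hn θ.toC1.2 t) • A (t, e) ∂τ)
        + ∫ t in Icc (-n : ℝ) n, (IccExtend hn θ.toC1.1 t) • B (t, e) ∂τ := by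
      have hF : Continuous (TestOn.toC1 : TestOn I n → _) := continuous_induced_dom
      exact ((continuous_integral_Icc hn iA).comp (continuous_snd.comp hF)).add
        ((continuous_integral_Icc hn iB).comp (continuous_fst.comp hF))
    have heq : ∀ θ : TestOn I n, ∫ t, (deriv θ.1 t • A (t, e) + θ.1 t • B (t, e)) ∂τ
        = (∫ t in Icc (-n : ℝ) n, (IccExtend hn θ.toC1.2 t) • A (t, e) ∂τ)
        + ∫ t in Icc (-n : ℝ) n, (IccExtend hn θ.toC1.1 t) • B (t, e) ∂τ := by
      intro θ
      have e1 : ∫ t in Icc (-n : ℝ) n, (IccExtend hn θ.toC1.2 t) • A (t, e) ∂τ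
          = ∫ t, deriv θ.1 t • A (t, e) ∂τ := by
        rw [← setIntegral_eq_integral_of_forall_compl_eq_zero (f := fun t => deriv θ.1 t • A (t, e))
          (s := Icc (-n : ℝ) n)]
        · refine setIntegral_congr_fun measurableSet_Icc fun t ht => ?_
          simp only [IccExtend_of_mem hn _ ht]; rfl
        · intro t ht
          rw [image_eq_zero_of_notMem_tsupport fun h =>
            ht (θ.2.2.2.2 (tsupport_deriv_subset h)), zero_smul]
      have e2 : ∫ t in Icc (-n : ℝ) n, (IccExtend hn θ.toC1.1 t) • B (t, e) ∂τ
          = ∫ t, θ.1 t • B (t, e) ∂τ := by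
        rw [← setIntegral_eq_integral_of_forall_compl_eq_zero (f := fun t => θ.1 t • B (t, e))
          (s := Icc (-n : ℝ) n)]
        · refine setIntegral_congr_fun measurableSet_Icc fun t ht => ?_
          simp only [IccExtend_of_mem hn _ ht]; rfl
        · intro t ht
          rw [image_eq_zero_of_notMem_tsupport fun h => ht (θ.2.2.2.2 h), zero_smul]
      rw [e1, e2, integral_add]
      · exact hAe.integrable_smul_left_of_hasCompactSupport (θ.2.1.continuous_deriv (by simp))
          θ.2.2.1.deriv
      · exact hBe.integrable_smul_left_of_hasCompactSupport θ.2.1.continuous θ.2.2.1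
    have hclosed := isClosed_eq hcont (continuous_const (y := (0 : ℂ)))
    intro θ
    rw [heq]
    exact (hclosed.closure_subset_iff.2 fun θ hθ => (heq θ).symm.trans (he θ hθ)) (hd θ)
  filter_upwards [ae_all_iff.2 h2] with e he θ hθ hc hs
  obtain ⟨r, hr⟩ := hc.isCompact.isBounded.subset_closedBall 0
  obtain ⟨n, hn⟩ := exists_nat_ge r
  refine he n ⟨θ, hθ, hc, hs, hr.trans fun t ht => ?_⟩
  rw [mem_closedBall_zero_iff, Real.norm_eq_abs, abs_le] at ht
  exact ⟨by linarith [ht.1], by linarith [ht.2]⟩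

end Slices

/-! ### The energy inequality in one dimension. -/

section Characteristics

/-- Lets the right end of an interval approach the end of `I`, whether that end is finite, and then
not attained, or infinite. -/
lemma exists_seq_exhausting {I : Set ℝ} (hI : IsOpen I) (hl : IsLowerSet I) (hne : I.Nonempty) :
    ∃ b : ℕ → ℝ, (∀ n, b n ∈ I) ∧ ∀ t ∈ I, ∀ᶠ n in atTop, t ≤ b n := by
  by_cases hb : BddAbove I
  · have hs : ∀ t ∈ I, t < sSup I := by
      intro t ht
      have hn : ∀ᶠ b in 𝓝[>] t, b ∈ I := nhdsWithin_le_nhds (hI.mem_nhds ht)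
      obtain ⟨b, hb1, hb2⟩ := (hn.and self_mem_nhdsWithin).exists
      exact lt_of_lt_of_le hb2 (le_csSup hb hb1)
    obtain ⟨u, hu1, hu2, hu3⟩ := exists_seq_strictMono_tendsto (sSup I)
    refine ⟨u, fun n => ?_, fun t ht => (hu3.eventually_const_lt (hs t ht)).mono fun n hn => hn.le⟩
    obtain ⟨x, hx, hx2⟩ := exists_lt_of_lt_csSup hne (hu2 n)
    exact hl hx2.le hx
  · refine ⟨fun n => n, fun n => ?_, fun t _ => eventually_ge_atTop ⌈t⌉₊ |>.mono fun n hn =>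
      (Nat.le_ceil t).trans (Nat.cast_le.2 hn)⟩
    rw [not_bddAbove_iff] at hb
    obtain ⟨x, hx, hx2⟩ := hb n
    exact hl hx2.le hx

lemma primitive_sub_primitive {F : Type*} [NormedAddCommGroup F] [NormedSpace ℝ F] {I : Set ℝ}
    (hl : IsLowerSet I) {S : ℝ → F}
    (hS : LocallyIntegrable S (volume.restrict I)) {t₀ a b : ℝ} (ht₀ : t₀ ∈ I) (ha : a ∈ I)
    (hb : b ∈ I) : (∫ s in t₀..b, S s) - ∫ s in t₀..a, S s = ∫ s in a..b, S s :=
  intervalIntegral.integral_interval_sub_left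
    (intervalIntegrable_of_locallyIntegrable hl hS ht₀ hb)
    (intervalIntegrable_of_locallyIntegrable hl hS ht₀ ha)

/-- The energy inequality on a half-line: `∫ y y' = (lim y²) / 2 ≥ 0`. -/
theorem integral_mul_deriv_nonneg {I : Set ℝ} (hI : IsOpen I) (hl : IsLowerSet I) {y S : ℝ → ℝ}
    (hS : LocallyIntegrable S (volume.restrict I)) {t₀ c : ℝ} (ht₀ : t₀ ∈ I)
    (hy : ∀ᵐ t ∂(volume.restrict I), y t = c + ∫ s in t₀..t, S s)
    (hy2 : Integrable (fun t => y t ^ 2) (volume.restrict I))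
    (hyS : Integrable (fun t => y t * S t) (volume.restrict I)) :
    0 ≤ ∫ t in I, y t * S t := by
  set Y : ℝ → ℝ := fun t => c + ∫ s in t₀..t, S s with hY
  -- `Y²` is absolutely continuous with derivative `2 y S`; the endpoint value `Y b ^ 2` is
  -- nonnegative and is dropped.
  have h1 : ∀ a ∈ I, ∀ b ∈ I, a ≤ b → -(Y a ^ 2) ≤ 2 * ∫ t in Ioc a b, y t * S t := by
    intro a ha b hb hab
    have hSi := intervalIntegrable_of_locallyIntegrable hl hS ha hb
    have hac : AbsolutelyContinuousOnInterval (fun t => Y a + ∫ s in a..t, S s) a b :=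
      (LipschitzWith.const (Y a) (α := ℝ) |>.lipschitzOnWith.absolutelyContinuousOnInterval).add
        (hSi.absolutelyContinuousOnInterval_intervalIntegral left_mem_uIcc)
    have hYe : ∀ t ∈ I, Y a + ∫ s in a..t, S s = Y t := fun t ht => by
      rw [← primitive_sub_primitive hl hS ht₀ ha ht]; simp only [hY]; ring
    have key := hac.integral_deriv_mul_eq_sub hac
    rw [hYe a ha, hYe b hb] at key
    have h2 : ∫ x in a..b, deriv (fun t => Y a + ∫ s in a..t, S s) x * (Y a + ∫ s in a..x, S s)
        + (Y a + ∫ s in a..x, S s) * deriv (fun t => Y a + ∫ s in a..t, S s) x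
        = ∫ x in a..b, 2 * (y x * S x) := by
      refine intervalIntegral.integral_congr_ae ?_
      rw [ae_restrict_iff' hI.measurableSet] at hy
      filter_upwards [hSi.ae_hasDerivAt_integral, hy] with x hx hx2 hx'
      have hxI : x ∈ I := icc_subset_of_isLowerSet hl hb
        (by rw [uIoc_of_le hab] at hx'; exact Ioc_subset_Icc_self hx')
      have hd : HasDerivAt (fun t => Y a + ∫ s in a..t, S s) (S x) x :=
        (hx (uIoc_subset_uIcc hx') a left_mem_uIcc).const_add _
      rw [hd.deriv, hYe x hxI, hx2 hxI]; ring
    rw [h2, intervalIntegral.integral_const_mul, intervalIntegral.integral_of_le hab] at key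
    nlinarith [sq_nonneg (Y b)]
  obtain ⟨b, hbI, hb⟩ := exists_seq_exhausting hI hl ⟨t₀, ht₀⟩
  have h2 : ∀ a ∈ I, -(Y a ^ 2) ≤ 2 * ∫ t in Ioi a, y t * S t ∂(volume.restrict I) := by
    intro a ha
    have hcov : AECover ((volume.restrict I).restrict (Ioi a)) atTop (fun n => Iic (b n)) :=
      { ae_eventually_mem := by
          refine ae_restrict_of_ae ((ae_restrict_iff' hI.measurableSet).2 (.of_forall fun t ht => ?_))
          exact hb t ht
        measurableSet := fun n => measurableSet_Iic }
    have ht := (hcov.integral_tendsto_of_countably_generated hyS.restrict).const_mul 2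
    refine ge_of_tendsto ht ?_
    filter_upwards [hb a ha] with n hn
    have := h1 a ha (b n) (hbI n) hn
    rwa [Measure.restrict_restrict measurableSet_Iic, Measure.restrict_restrict
      (measurableSet_Iic.inter measurableSet_Ioi), Iic_inter_Ioi, inter_eq_left.2
      (Ioc_subset_Icc_self.trans (icc_subset_of_isLowerSet hl (hbI n)))]
  have h3 : Tendsto (fun a => ∫ t in Ioi a, y t * S t ∂(volume.restrict I)) atBot
      (𝓝 (∫ t in I, y t * S t)) :=
    (aecover_Ioi tendsto_id).integral_tendsto_of_countably_generated hyS
  by_contra! hneg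
  set m := ∫ t in I, y t * S t with hm
  -- If the integral `m` were negative, `Y²` would stay above `-m > 0` near `-∞`, and a positive
  -- constant is not integrable on a half-line.
  have h4 : ∀ᶠ a in atBot, a ≤ t₀ ∧ -m ≤ Y a ^ 2 := by
    filter_upwards [h3.eventually_lt_const (show m < m / 2 by linarith), eventually_le_atBot t₀]
      with a ha ha2
    exact ⟨ha2, by linarith [h2 a (hl ha2 ht₀)]⟩
  obtain ⟨A, hA⟩ := eventually_atBot.1 h4
  have hAI : Iic A ⊆ I := fun x hx => hl (hA x hx).1 ht₀
  have h5 : IntegrableOn (fun _ => -m) (Iic A) := by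
    have h6 : IntegrableOn (fun t => y t ^ 2) (Iic A) := IntegrableOn.mono_set hy2 hAI
    refine Integrable.mono' h6 aestronglyMeasurable_const ?_
    filter_upwards [ae_restrict_of_ae_restrict_of_subset hAI hy, ae_restrict_mem measurableSet_Iic]
      with t ht htA
    rw [ht, Real.norm_of_nonneg (by linarith)]
    exact (hA t htA).2
  rw [integrableOn_const_iff] at h5
  rcases h5 with h5 | h5
  · rw [enorm_eq_zero] at h5; linarith
  · simp at h5

/-- Cauchy–Schwarz, obtained by integrating `(wφ - A)² / w ≥ 0` with `A` the integral of `φ`. -/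
lemma sq_setIntegral_le {W : Set ℝ} {φ : ℝ → ℝ} {w : ℝ} (hw : 0 < w)
    (hW : volume W = ENNReal.ofReal w)
    (h1 : IntegrableOn φ W) (h2 : IntegrableOn (fun t => φ t ^ 2) W) :
    (∫ t in W, φ t) ^ 2 ≤ w * ∫ t in W, φ t ^ 2 := by
  set A := ∫ t in W, φ t with hA
  have hc : IntegrableOn (fun _ : ℝ => A ^ 2 / w) W := by
    rw [integrableOn_const_iff]; right; rw [hW]; exact ENNReal.ofReal_lt_top
  have h : ∫ t in W, 2 * A * φ t ≤ ∫ t in W, (w * φ t ^ 2 + A ^ 2 / w) := by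
    refine setIntegral_mono (h1.const_mul _) ((h2.const_mul w).add hc) fun t => ?_
    have : 0 ≤ (w * φ t - A) ^ 2 / w := by positivity
    have e : (w * φ t - A) ^ 2 / w = w * φ t ^ 2 + A ^ 2 / w - 2 * A * φ t := by
      field_simp; ring
    simp only
    linarith
  rw [integral_const_mul, integral_add (h2.const_mul w) hc, integral_const_mul, setIntegral_const,
    Measure.real, hW, ENNReal.toReal_ofReal hw.le, ← hA, smul_eq_mul, mul_div_cancel₀ _ hw.ne'] at h
  linarith

end Characteristics

/-! ### The gain of regularity along one characteristic. -/

section Window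

/-- Tonelli: a point `s` lies in the window of `t` only for `t` in an interval of length `w`. -/
lemma lintegral_window_le {I : Set ℝ} {g : ℝ → ℝ≥0∞} (hg : AEMeasurable g (volume.restrict I))
    (w : ℝ) :
    ∫⁻ t in I, ∫⁻ s in Ioo (t - w) t, g s ∂(volume.restrict I)
      ≤ ENNReal.ofReal w * ∫⁻ s in I, g s := by
  have h1 : ∀ t, ∫⁻ s in Ioo (t - w) t, g s ∂(volume.restrict I)
      = ∫⁻ s in I, (Ioo (t - w) t).indicator g s := fun t =>
    (lintegral_indicator measurableSet_Ioo g).symm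
  simp only [h1]
  have hset : MeasurableSet {p : ℝ × ℝ | p.2 ∈ Ioo (p.1 - w) p.1} :=
    (measurableSet_lt (f := fun p : ℝ × ℝ => p.1 - w) (g := fun p => p.2)
      (by fun_prop) (by fun_prop)).inter (measurableSet_lt measurable_snd measurable_fst)
  have hm : AEMeasurable (fun p : ℝ × ℝ => (Ioo (p.1 - w) p.1).indicator g p.2)
      ((volume.restrict I).prod (volume.restrict I)) :=
    (hg.comp_snd (μ := volume.restrict I)).indicator hset
  rw [lintegral_lintegral_swap hm, ← lintegral_const_mul'' _ hg]
  refine lintegral_mono fun s => ?_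
  have h2 : ∀ t, (Ioo (t - w) t).indicator g s = (Ioo s (s + w)).indicator (fun _ => g s) t := by
    intro t
    simp only [indicator, mem_Ioo]
    congr 1
    exact propext ⟨fun h => ⟨h.2, by linarith [h.1]⟩, fun h => ⟨by linarith [h.2], h.1⟩⟩
  simp only [h2]
  rw [lintegral_indicator measurableSet_Ioo, lintegral_const, mul_comm,
    Measure.restrict_apply_univ]
  gcongr
  refine (Measure.restrict_apply_le _ _).trans ?_
  simp

/-- Where the symbol `q` is small it has been comparable to `r` for a time `≈ r⁻²`, so that the
values of `y` there are controlled by earlier ones. -/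
lemma sq_le_window_integral {y S : ℝ → ℂ} {q F h : ℝ → ℝ} {r t : ℝ} (hr : 0 < r)
    (hF0 : ∀ s, 0 ≤ F s) (hh0 : ∀ s, 0 ≤ h s)
    (hq1 : ∀ s, q s ≤ r ^ 3 * |t - s| + q t) (hq2 : ∀ s, r ^ 3 * |t - s| ≤ q s + q t)
    (hqt : q t < r) (hSb : ∀ s, ‖S s‖ ≤ q s * F s + h s)
    (hy : ∀ᵐ s ∂(volume.restrict (Ioo (t - 4 / r ^ 2) t)), y t - y s = ∫ x in s..t, S x)
    (i1 : IntegrableOn (fun s => q s ^ 2 * ‖y s‖ ^ 2) (Ioo (t - 4 / r ^ 2) t))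
    (i2 : IntegrableOn (fun s => F s ^ 2) (Ioo (t - 4 / r ^ 2) t))
    (i3 : IntegrableOn (fun s => h s ^ 2) (Ioo (t - 4 / r ^ 2) t))
    (i4 : IntegrableOn (fun s => F s) (Ioo (t - 4 / r ^ 2) t))
    (i5 : IntegrableOn (fun s => h s) (Ioo (t - 4 / r ^ 2) t)) :
    ‖y t‖ ^ 2 ≤ ∫ s in Ioo (t - 4 / r ^ 2) t,
      (q s ^ 2 * ‖y s‖ ^ 2 + 400 * F s ^ 2 + 16 / r ^ 2 * h s ^ 2) := by
  set W := Ioo (t - 4 / r ^ 2) t with hWdef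
  have hr2 : 0 < r ^ 2 := by positivity
  have hw : 0 < 4 / r ^ 2 := by positivity
  have hW : volume W = ENNReal.ofReal (4 / r ^ 2) := by
    rw [hWdef, Real.volume_Ioo]; congr 1; ring
  -- On the window `q ≤ r³ · 4/r² + r = 5r`, which is the origin of the factor 5.
  set φ : ℝ → ℝ := fun s => 5 * r * F s + h s with hφ
  have iφ : IntegrableOn φ W := (i4.const_mul _).add i5
  have hφ2 : ∀ s, φ s ^ 2 ≤ 50 * r ^ 2 * F s ^ 2 + 2 * h s ^ 2 := fun s => by
    simp only [hφ]; nlinarith [sq_nonneg (5 * r * F s - h s)]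
  have hφ0 : ∀ s, 0 ≤ φ s := fun s => by
    have := hF0 s; have := hh0 s; simp only [hφ]; positivity
  have ib : IntegrableOn (fun s => 50 * r ^ 2 * F s ^ 2 + 2 * h s ^ 2) W :=
    (i2.const_mul _).add (i3.const_mul _)
  have iφ2 : IntegrableOn (fun s => φ s ^ 2) W :=
    Integrable.mono' ib (iφ.aestronglyMeasurable.pow 2) (.of_forall fun s => by
      rw [Real.norm_of_nonneg (sq_nonneg _)]; exact hφ2 s)
  have hCS := sq_setIntegral_le hw hW iφ iφ2
  have hSφ : ∀ s ∈ W, ‖S s‖ ≤ φ s := by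
    intro s hs
    have h1 : |t - s| ≤ 4 / r ^ 2 := by
      rw [abs_of_nonneg (by linarith [hs.2])]; linarith [hs.1]
    have h2 : q s ≤ 5 * r := by
      have : r ^ 3 * |t - s| ≤ r ^ 3 * (4 / r ^ 2) := by gcongr
      have e : r ^ 3 * (4 / r ^ 2) = 4 * r := by field_simp
      linarith [hq1 s]
    refine (hSb s).trans ?_
    simp only [hφ]
    gcongr
    exact hF0 s
  set Φ := ∫ s in W, φ s with hΦ
  have hyb : ∀ᵐ s ∂(volume.restrict W), ‖y t‖ ^ 2 ≤ 2 * ‖y s‖ ^ 2 + 2 * Φ ^ 2 := by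
    filter_upwards [hy, ae_restrict_mem measurableSet_Ioo] with s hs hsW
    have h1 : ‖∫ x in s..t, S x‖ ≤ Φ := by
      rw [intervalIntegral.integral_of_le hsW.2.le, integral_Ioc_eq_integral_Ioo]
      have hsub : Ioo s t ⊆ W := Ioo_subset_Ioo_left hsW.1.le
      refine (norm_integral_le_of_norm_le (iφ.mono_set hsub) ?_).trans
        (setIntegral_mono_set iφ (.of_forall hφ0) hsub.eventuallyLE)
      filter_upwards [ae_restrict_mem measurableSet_Ioo] with x hx using hSφ x (hsub hx)
    have h2 : ‖y t‖ ≤ ‖y s‖ + Φ := by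
      calc ‖y t‖ = ‖y s + (y t - y s)‖ := by congr 1; ring
        _ ≤ ‖y s‖ + ‖y t - y s‖ := norm_add_le _ _
        _ ≤ _ := by rw [hs]; gcongr
    have h3 : ‖y t‖ ^ 2 ≤ (‖y s‖ + Φ) ^ 2 := by gcongr
    nlinarith [sq_nonneg (‖y s‖ - Φ)]
  -- The earlier half of the window: there `t - s ≥ 2/r²`, so `q s ≥ 2r - r = r`, and `‖y s‖` is
  -- bounded by `q s * ‖y s‖ / r`.
  set J := Ioo (t - 4 / r ^ 2) (t - 2 / r ^ 2) with hJ
  have hJW : J ⊆ W := Ioo_subset_Ioo_right (by have : 0 < 2 / r ^ 2 := by positivity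
                                               linarith)
  have hJv : volume.real J = 2 / r ^ 2 := by
    rw [Measure.real, hJ, Real.volume_Ioo, ENNReal.toReal_ofReal]
    · ring
    · have : 0 < 2 / r ^ 2 := by positivity
      have e : 4 / r ^ 2 = 2 * (2 / r ^ 2) := by ring
      linarith
  have hJb : ∀ᵐ s ∂(volume.restrict J),
      r ^ 2 * ‖y t‖ ^ 2 ≤ 2 * (q s ^ 2 * ‖y s‖ ^ 2) + 2 * r ^ 2 * Φ ^ 2 := by
    filter_upwards [ae_restrict_of_ae_restrict_of_subset hJW hyb,
      ae_restrict_mem measurableSet_Ioo] with s hs hsJ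
    have h1 : 2 / r ^ 2 ≤ |t - s| := by
      rw [abs_of_nonneg (by linarith [(hJW hsJ).2])]; linarith [hsJ.2]
    have h2 : r ≤ q s := by
      have : r ^ 3 * (2 / r ^ 2) ≤ r ^ 3 * |t - s| := by gcongr
      have e : r ^ 3 * (2 / r ^ 2) = 2 * r := by field_simp
      linarith [hq2 s]
    have h3 : r ^ 2 * ‖y s‖ ^ 2 ≤ q s ^ 2 * ‖y s‖ ^ 2 := by gcongr
    nlinarith
  have hcJ : ∀ k : ℝ, IntegrableOn (fun _ : ℝ => k) J := fun k => by
    rw [integrableOn_const_iff]; right; rw [hJ]; simp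
  have key : ∫ s in J, r ^ 2 * ‖y t‖ ^ 2
      ≤ ∫ s in J, (2 * (q s ^ 2 * ‖y s‖ ^ 2) + 2 * r ^ 2 * Φ ^ 2) :=
    integral_mono_ae (hcJ _) (((i1.mono_set hJW).const_mul 2).add (hcJ _)) hJb
  rw [setIntegral_const, integral_add ((i1.mono_set hJW).const_mul 2) (hcJ _), setIntegral_const,
    hJv, integral_const_mul, smul_eq_mul, smul_eq_mul] at key
  have h4 : ∫ s in J, q s ^ 2 * ‖y s‖ ^ 2 ≤ ∫ s in W, q s ^ 2 * ‖y s‖ ^ 2 :=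
    setIntegral_mono_set i1 (.of_forall fun s => by positivity) hJW.eventuallyLE
  have h5 : ∫ s in W, φ s ^ 2 ≤ 50 * r ^ 2 * (∫ s in W, F s ^ 2) + 2 * ∫ s in W, h s ^ 2 := by
    rw [← integral_const_mul, ← integral_const_mul, ← integral_add (i2.const_mul _)
      (i3.const_mul _)]
    exact integral_mono iφ2 ib hφ2
  have i12 : IntegrableOn (fun s => q s ^ 2 * ‖y s‖ ^ 2 + 400 * F s ^ 2) W :=
    i1.add (i2.const_mul _)
  rw [integral_add i12 (i3.const_mul _), integral_add i1 (i2.const_mul _), integral_const_mul,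
    integral_const_mul]
  have e1 : 2 / r ^ 2 * (r ^ 2 * ‖y t‖ ^ 2) = 2 * ‖y t‖ ^ 2 := by field_simp
  have e2 : 2 / r ^ 2 * (2 * r ^ 2 * Φ ^ 2) = 4 * Φ ^ 2 := by field_simp; ring
  rw [e1, e2] at key
  -- Integration over `J`, of length `2/r²`, has given `‖y t‖² ≤ ∫ q²‖y‖² + 2Φ²`. Cauchy–Schwarz
  -- bounds `Φ²` by `200 ∫ F² + (8/r²) ∫ h²`; doubling gives the constants 400 and 16.
  have h6 : Φ ^ 2 ≤ 4 / r ^ 2 * (50 * r ^ 2 * (∫ s in W, F s ^ 2) + 2 * ∫ s in W, h s ^ 2) :=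
    hCS.trans (by gcongr)
  have e3 : 4 / r ^ 2 * (50 * r ^ 2 * (∫ s in W, F s ^ 2) + 2 * ∫ s in W, h s ^ 2)
    = 200 * (∫ s in W, F s ^ 2) + 8 / r ^ 2 * ∫ s in W, h s ^ 2 := by field_simp; ring
  have e4 : 16 / r ^ 2 * ∫ s in W, h s ^ 2 = 2 * (8 / r ^ 2 * ∫ s in W, h s ^ 2) := by ring
  rw [e3] at h6
  rw [e4]
  linarith

/-- The gain of `1/3` of a derivative along a single characteristic. -/
theorem lintegral_gain_le {I : Set ℝ} (hI : IsOpen I) (hl : IsLowerSet I) {y S : ℝ → ℂ}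
    (hS : LocallyIntegrable S (volume.restrict I)) {t₀ : ℝ} {c : ℂ} (ht₀ : t₀ ∈ I)
    (hy : ∀ᵐ t ∂(volume.restrict I), y t = c + ∫ s in t₀..t, S s)
    {q F h : ℝ → ℝ} {r : ℝ} (hr : 0 < r)
    (hF0 : ∀ s, 0 ≤ F s) (hh0 : ∀ s, 0 ≤ h s)
    (hq1 : ∀ t s, q s ≤ r ^ 3 * |t - s| + q t) (hq2 : ∀ t s, r ^ 3 * |t - s| ≤ q s + q t)
    (hSb : ∀ s, ‖S s‖ ≤ q s * F s + h s)
    (i1 : Integrable (fun s => q s ^ 2 * ‖y s‖ ^ 2) (volume.restrict I))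
    (i2 : MemLp F 2 (volume.restrict I)) (i3 : MemLp h 2 (volume.restrict I)) :
    ∫⁻ t in I, ENNReal.ofReal (r ^ 2 * ‖y t‖ ^ 2) ≤
      5 * ∫⁻ t in I, ENNReal.ofReal (q t ^ 2 * ‖y t‖ ^ 2 + 400 * F t ^ 2 + 16 / r ^ 2 * h t ^ 2) := by
  set g : ℝ → ℝ := fun t => q t ^ 2 * ‖y t‖ ^ 2 + 400 * F t ^ 2 + 16 / r ^ 2 * h t ^ 2 with hg
  have hgi : Integrable g (volume.restrict I) :=
    (i1.add (i2.integrable_sq.const_mul _)).add (i3.integrable_sq.const_mul _)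
  have hg0 : ∀ t, 0 ≤ g t := fun t => by simp only [hg]; positivity
  -- Either `q t ≥ r` and `g t` alone suffices, or `q t < r` and the window does. Lower integrals
  -- are used because the left-hand side is not known to be finite beforehand.
  have hpt : ∀ᵐ t ∂(volume.restrict I), ENNReal.ofReal (r ^ 2 * ‖y t‖ ^ 2) ≤
      ENNReal.ofReal (g t) + ENNReal.ofReal (r ^ 2) *
        ∫⁻ s in Ioo (t - 4 / r ^ 2) t, ENNReal.ofReal (g s) ∂(volume.restrict I) := by
    filter_upwards [hy, ae_restrict_mem hI.measurableSet] with t ht htI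
    by_cases hqt : q t < r
    · refine le_add_left ?_
      have hsub : Ioo (t - 4 / r ^ 2) t ⊆ I :=
        Ioo_subset_Icc_self.trans (icc_subset_of_isLowerSet hl htI)
      rw [Measure.restrict_restrict measurableSet_Ioo, inter_eq_left.2 hsub,
        ← ofReal_integral_eq_lintegral_ofReal (IntegrableOn.mono_set hgi hsub) (.of_forall hg0),
        ← ENNReal.ofReal_mul (by positivity)]
      refine ENNReal.ofReal_le_ofReal ?_
      gcongr
      have hm : volume.restrict (Ioo (t - 4 / r ^ 2) t) ≤ volume.restrict I :=
        Measure.restrict_mono hsub le_rfl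
      have : IsFiniteMeasure (volume.restrict (Ioo (t - 4 / r ^ 2) t)) := ⟨by simp⟩
      refine sq_le_window_integral hr hF0 hh0 (hq1 t) (hq2 t) hqt hSb ?_ (i1.mono_measure hm)
        (i2.integrable_sq.mono_measure hm) (i3.integrable_sq.mono_measure hm)
        ((i2.mono_measure hm).integrable (by norm_num))
        ((i3.mono_measure hm).integrable (by norm_num))
      filter_upwards [ae_restrict_of_ae_restrict_of_subset hsub hy,
        ae_restrict_mem measurableSet_Ioo] with s hs hs2
      rw [ht, hs, ← primitive_sub_primitive hl hS ht₀ (hsub hs2) htI]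
      ring
    · refine le_add_right (ENNReal.ofReal_le_ofReal ?_)
      have : r ^ 2 * ‖y t‖ ^ 2 ≤ q t ^ 2 * ‖y t‖ ^ 2 := by gcongr; exact not_lt.1 hqt
      have : 0 ≤ 400 * F t ^ 2 + 16 / r ^ 2 * h t ^ 2 := by positivity
      simp only [hg]
      linarith
  have hgm : AEMeasurable (fun t => ENNReal.ofReal (g t)) (volume.restrict I) :=
    hgi.aestronglyMeasurable.aemeasurable.ennreal_ofReal
  calc ∫⁻ t in I, ENNReal.ofReal (r ^ 2 * ‖y t‖ ^ 2)
      ≤ ∫⁻ t in I, (ENNReal.ofReal (g t) + ENNReal.ofReal (r ^ 2) *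
        ∫⁻ s in Ioo (t - 4 / r ^ 2) t, ENNReal.ofReal (g s) ∂(volume.restrict I)) :=
        lintegral_mono_ae hpt
    _ = (∫⁻ t in I, ENNReal.ofReal (g t)) + ENNReal.ofReal (r ^ 2) * ∫⁻ t in I,
        ∫⁻ s in Ioo (t - 4 / r ^ 2) t, ENNReal.ofReal (g s) ∂(volume.restrict I) := by
        rw [lintegral_add_left' hgm, lintegral_const_mul' _ _ ENNReal.ofReal_ne_top]
    _ ≤ (∫⁻ t in I, ENNReal.ofReal (g t)) + ENNReal.ofReal (r ^ 2) *
        (ENNReal.ofReal (4 / r ^ 2) * ∫⁻ t in I, ENNReal.ofReal (g t)) := by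
        gcongr
        exact lintegral_window_le hgm _
    -- `5 = 1 + r² · 4/r²`: the pointwise term and the window term.
    _ = _ := by
        rw [← mul_assoc, ← ENNReal.ofReal_mul (by positivity), mul_div_cancel₀ _ (by positivity)]
        have : ENNReal.ofReal 4 = 4 := by simp
        rw [this]
        ring

end Window

/-! ### The equation on the Fourier side, frequency by frequency. -/

/-- The phase space `(x, v)` as an inner product space. -/
abbrev XV (d : ℕ) := WithLp 2 (Euc d × Euc d)

/-- The symbol of `D_v` along the characteristics, up to the factor `i`. -/
def symb {d : ℕ} (p : ℝ × XV d) : Euc d := (2 * Real.pi) • (p.1 • p.2.fst + p.2.snd)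

section FourierSide

variable {d : ℕ}

lemma continuous_symb : Continuous (symb : ℝ × XV d → Euc d) := by
  unfold symb
  have h1 : Continuous fun p : ℝ × XV d => p.2.fst :=
    (WithLp.continuous_fst 2 _ _).comp continuous_snd
  have h2 : Continuous fun p : ℝ × XV d => p.2.snd := (WithLp.continuous_snd 2 _ _).comp continuous_snd
  fun_prop

lemma continuous_symb_apply (j : Fin d) : Continuous fun p : ℝ × XV d => symb p j :=
  (PiLp.continuous_apply 2 _ j).comp continuous_symb

lemma symb_sub (t s : ℝ) (e : XV d) :
    symb (s, e) - symb (t, e) = ((2 * Real.pi) * (s - t)) • e.fst := by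
  simp only [symb]
  module

lemma norm_symb_sub (t s : ℝ) (e : XV d) :
    ‖symb (s, e) - symb (t, e)‖ = (2 * Real.pi * ‖e.fst‖) * |t - s| := by
  rw [symb_sub, norm_smul, Real.norm_eq_abs, abs_mul, abs_of_pos Real.two_pi_pos, abs_sub_comm]
  ring

/-- The source term on the Fourier side. -/
def fourierSource (F : Fin d → ℝ × XV d → ℂ) (h : ℝ × XV d → ℂ) (p : ℝ × XV d) : ℂ :=
  ∑ j, (Complex.I * (symb p j : ℂ)) * F j p + h p

lemma locallyIntegrable_mul_left {X : Type*} [TopologicalSpace X] [MeasurableSpace X]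
    [BorelSpace X] [LocallyCompactSpace X] [T2Space X] [SecondCountableTopology X]
    {μ : Measure X} {g f : X → ℂ} (hg : Continuous g)
    (hf : LocallyIntegrable f μ) : LocallyIntegrable (fun x => g x * f x) μ := by
  rw [locallyIntegrable_iff] at hf ⊢
  exact fun K hK => (hf K hK).continuousOn_mul hg.continuousOn hK

lemma locallyIntegrable_fourierSource {μ : Measure (ℝ × XV d)} [IsLocallyFiniteMeasure μ]
    {F : Fin d → ℝ × XV d → ℂ} {h : ℝ × XV d → ℂ}
    (hF : ∀ j, MemLp (F j) 2 μ) (hh : MemLp h 2 μ) : LocallyIntegrable (fourierSource F h) μ := by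
  have h1 : LocallyIntegrable (fun p => ∑ j, (Complex.I * (symb p j : ℂ)) * F j p) μ :=
    locallyIntegrable_finsetSum _ fun j _ => locallyIntegrable_mul_left
      (continuous_const.mul (Complex.continuous_ofReal.comp (continuous_symb_apply j)))
      ((hF j).locallyIntegrable (by norm_num))
  exact h1.add (hh.locallyIntegrable (by norm_num))

/-- Cauchy–Schwarz in `j`; this is the shape `q F + h` of the right-hand side required by
`lintegral_gain_le`. -/
lemma norm_fourierSource_le (F : Fin d → ℝ × XV d → ℂ) (h : ℝ × XV d → ℂ) (p : ℝ × XV d) :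
    ‖fourierSource F h p‖ ≤ ‖symb p‖ * √(∑ j, ‖F j p‖ ^ 2) + ‖h p‖ := by
  refine (norm_add_le _ _).trans ?_
  gcongr
  refine (norm_sum_le _ _).trans ?_
  rw [EuclideanSpace.norm_eq]
  refine le_trans (le_of_eq ?_) (Real.sum_mul_le_sqrt_mul_sqrt _ _ _)
  refine Finset.sum_congr rfl fun j _ => ?_
  simp

/-- Passing to the characteristics: almost every slice is absolutely continuous. -/
theorem ae_slice_primitive {I : Set ℝ} (hI : IsOpen I) (hl : IsLowerSet I) {t₀ : ℝ} (ht₀ : t₀ ∈ I)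
    {y S : ℝ × XV d → ℂ}
    (hy : LocallyIntegrable y ((volume.restrict I).prod volume))
    (hS : LocallyIntegrable S ((volume.restrict I).prod volume))
    (heq : ∀ θ : ℝ → ℝ, ContDiff ℝ ∞ θ → HasCompactSupport θ → tsupport θ ⊆ I →
      ∀ ψ : XV d → ℝ, ContDiff ℝ ∞ ψ → HasCompactSupport ψ →
      ∫ p, ψ p.2 • (deriv θ p.1 • y p + θ p.1 • S p) ∂((volume.restrict I).prod volume) = 0) :
    ∀ᵐ e : XV d, ∃ c : ℂ, ∀ᵐ t ∂(volume.restrict I), y (t, e) = c + ∫ s in t₀..t, S (s, e) := by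
  filter_upwards [ae_slice_weak_eq hy hS heq, ae_slice_locallyIntegrable hy,
    ae_slice_locallyIntegrable hS] with e he hye hSe
  have hre : ∀ {f : ℝ → ℂ}, LocallyIntegrable f (volume.restrict I) →
      LocallyIntegrable (fun t => (f t).re) (volume.restrict I) := fun hf x => by
    obtain ⟨u, hu, hu2⟩ := hf x
    exact ⟨u, hu, hu2.re⟩
  have him : ∀ {f : ℝ → ℂ}, LocallyIntegrable f (volume.restrict I) →
      LocallyIntegrable (fun t => (f t).im) (volume.restrict I) := fun hf x => by
    obtain ⟨u, hu, hu2⟩ := hf x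
    exact ⟨u, hu, hu2.im⟩
  have hint : ∀ θ : ℝ → ℝ, ContDiff ℝ ∞ θ → HasCompactSupport θ →
      Integrable (fun t => deriv θ t • y (t, e) + θ t • S (t, e)) (volume.restrict I) :=
    fun θ hθ hc =>
      (hye.integrable_smul_left_of_hasCompactSupport (hθ.continuous_deriv (by simp)) hc.deriv).add
      (hSe.integrable_smul_left_of_hasCompactSupport hθ.continuous hc)
  -- The one-dimensional statement is for real functions, so real and imaginary parts are treated
  -- separately.
  obtain ⟨c₁, h₁⟩ := ae_eq_const_add_primitive hI hl (hre hye) (hre hSe) (fun θ hθ hc hs => by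
    have h := congrArg Complex.re (he θ hθ hc hs)
    rw [← RCLike.re_eq_complex_re, ← integral_re (hint θ hθ hc)] at h
    simpa using h) ht₀
  obtain ⟨c₂, h₂⟩ := ae_eq_const_add_primitive hI hl (him hye) (him hSe) (fun θ hθ hc hs => by
    have h := congrArg Complex.im (he θ hθ hc hs)
    rw [← RCLike.im_eq_complex_im, ← integral_im (hint θ hθ hc)] at h
    simpa using h) ht₀
  refine ⟨⟨c₁, c₂⟩, ?_⟩
  filter_upwards [h₁, h₂, ae_restrict_mem hI.measurableSet] with t h1 h2 htI
  have hSi := intervalIntegrable_of_locallyIntegrable hl hSe ht₀ htI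
  have e1 := Complex.reCLM.intervalIntegral_comp_comm hSi
  have e2 := Complex.imCLM.intervalIntegral_comp_comm hSi
  simp only [Complex.reCLM_apply, Complex.imCLM_apply] at e1 e2
  apply Complex.ext
  · rw [h1, Complex.add_re, e1]
  · rw [h2, Complex.add_im, e2]

lemma integrable_re_mul_im_mul {μ : Measure ℝ} {y S : ℝ → ℂ} (hy : AEStronglyMeasurable y μ)
    (hS : AEStronglyMeasurable S μ)
    (h : Integrable (fun t => (starRingEnd ℂ (y t)) * S t) μ) :
    Integrable (fun t => (y t).re * (S t).re) μ ∧ Integrable (fun t => (y t).im * (S t).im) μ := by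
  constructor
  · refine h.norm.mono' (hy.re.mul hS.re) (.of_forall fun t => ?_)
    rw [norm_mul, norm_mul, RCLike.norm_conj]
    exact mul_le_mul (Complex.abs_re_le_norm _) (Complex.abs_re_le_norm _) (norm_nonneg _)
      (norm_nonneg _)
  · refine h.norm.mono' (hy.im.mul hS.im) (.of_forall fun t => ?_)
    rw [norm_mul, norm_mul, RCLike.norm_conj]
    exact mul_le_mul (Complex.abs_im_le_norm _) (Complex.abs_im_le_norm _) (norm_nonneg _)
      (norm_nonneg _)

/-- The energy inequality along a single characteristic. -/
lemma re_integral_conj_mul_nonneg {I : Set ℝ} (hI : IsOpen I) (hl : IsLowerSet I) {y S : ℝ → ℂ}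
    (hS : LocallyIntegrable S (volume.restrict I)) {t₀ : ℝ} {c : ℂ} (ht₀ : t₀ ∈ I)
    (hy : ∀ᵐ t ∂(volume.restrict I), y t = c + ∫ s in t₀..t, S s)
    (hy2 : MemLp y 2 (volume.restrict I))
    (hyS : Integrable (fun t => (starRingEnd ℂ (y t)) * S t) (volume.restrict I)) :
    0 ≤ ∫ t in I, ((starRingEnd ℂ (y t)) * S t).re := by
  have hre : LocallyIntegrable (fun t => (S t).re) (volume.restrict I) := fun x => by
    obtain ⟨u, hu, hu2⟩ := hS x
    exact ⟨u, hu, hu2.re⟩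
  have him : LocallyIntegrable (fun t => (S t).im) (volume.restrict I) := fun x => by
    obtain ⟨u, hu, hu2⟩ := hS x
    exact ⟨u, hu, hu2.im⟩
  obtain ⟨i1, i2⟩ := integrable_re_mul_im_mul hy2.1 hS.aestronglyMeasurable hyS
  have h1 := integral_mul_deriv_nonneg hI hl (y := fun t => (y t).re) hre (c := c.re) ht₀ (by
    filter_upwards [hy, ae_restrict_mem hI.measurableSet] with t ht htI
    have e1 := Complex.reCLM.intervalIntegral_comp_comm
      (intervalIntegrable_of_locallyIntegrable hl hS ht₀ htI)
    simp only [Complex.reCLM_apply] at e1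
    rw [ht, Complex.add_re, e1]) hy2.re.integrable_sq i1
  have h2 := integral_mul_deriv_nonneg hI hl (y := fun t => (y t).im) him (c := c.im) ht₀ (by
    filter_upwards [hy, ae_restrict_mem hI.measurableSet] with t ht htI
    have e1 := Complex.imCLM.intervalIntegral_comp_comm
      (intervalIntegrable_of_locallyIntegrable hl hS ht₀ htI)
    simp only [Complex.imCLM_apply] at e1
    rw [ht, Complex.add_im, e1]) hy2.im.integrable_sq i2
  have h3 : ∫ t in I, ((starRingEnd ℂ (y t)) * S t).re
      = (∫ t in I, (y t).re * (S t).re) + ∫ t in I, (y t).im * (S t).im := by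
    rw [← integral_add i1 i2]
    refine integral_congr_ae (.of_forall fun t => ?_)
    simp [Complex.mul_re]
  rw [h3]
  exact add_nonneg h1 h2

end FourierSide

section FourierSide

variable {d : ℕ}

lemma ae_memLp_slice_left {ν : Measure ℝ} [SFinite ν] {E : Type*} [MeasurableSpace E]
    {μ : Measure E} [SFinite μ] {U : ℝ × E → ℂ}
    (hU : MemLp U 2 (ν.prod μ)) : ∀ᵐ e ∂μ, MemLp (fun t => U (t, e)) 2 ν := by
  have h : MemLp (fun p : E × ℝ => U p.swap) 2 (μ.prod ν) :=
    hU.comp_measurePreserving Measure.measurePreserving_swap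
  exact ae_memLp_slice h

lemma ae_slice_left {ν : Measure ℝ} [SFinite ν] {E : Type*} [MeasurableSpace E]
    {μ : Measure E} [SFinite μ] {p : ℝ × E → Prop} (h : ∀ᵐ z ∂(ν.prod μ), p z) :
    ∀ᵐ e ∂μ, ∀ᵐ t ∂ν, p (t, e) :=
  Measure.ae_ae_of_ae_prod (μ := μ) (ν := ν) (p := fun z => p z.swap)
    (Measure.measurePreserving_swap.quasiMeasurePreserving.ae h)

/-- The kinetic equation after the Fourier transform: transport has become `∂_t`. -/
structure FourierEquation (I : Set ℝ) (y h : ℝ × XV d → ℂ) (Q F : Fin d → ℝ × XV d → ℂ) :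
    Prop where
  memLp_y : MemLp y 2 ((volume.restrict I).prod volume)
  memLp_h : MemLp h 2 ((volume.restrict I).prod volume)
  memLp_Q : ∀ j, MemLp (Q j) 2 ((volume.restrict I).prod volume)
  memLp_F : ∀ j, MemLp (F j) 2 ((volume.restrict I).prod volume)
  grad : ∀ j, Q j =ᵐ[(volume.restrict I).prod volume] fun p => Complex.I * (symb p j : ℂ) * y p
  eq : ∀ θ : ℝ → ℝ, ContDiff ℝ ∞ θ → HasCompactSupport θ → tsupport θ ⊆ I →
      ∀ ψ : XV d → ℝ, ContDiff ℝ ∞ ψ → HasCompactSupport ψ →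
      ∫ p, ψ p.2 • (deriv θ p.1 • y p + θ p.1 • fourierSource F h p)
        ∂((volume.restrict I).prod volume) = 0

/-- The factor `i symb` moves from `F` to `y`, where it forms `Q`; conjugation of `i` produces the
minus sign. The form with `Q` is integrable over all frequencies, although `symb` is unbounded. -/
lemma conj_mul_fourierSource {y h : ℝ × XV d → ℂ} {Q F : Fin d → ℝ × XV d → ℂ} {p : ℝ × XV d}
    (hQ : ∀ j, Q j p = Complex.I * (symb p j : ℂ) * y p) :
    (starRingEnd ℂ (y p)) * fourierSource F h p
      = (starRingEnd ℂ (y p)) * h p - ∑ j, (starRingEnd ℂ (Q j p)) * F j p := by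
  simp only [fourierSource, hQ, mul_add, Finset.mul_sum, map_mul, Complex.conj_I,
    Complex.conj_ofReal]
  rw [add_comm, sub_eq_add_neg, ← Finset.sum_neg_distrib]
  congr 1
  refine Finset.sum_congr rfl fun j _ => ?_
  ring

lemma FourierEquation.integrable {I : Set ℝ} {y h : ℝ × XV d → ℂ} {Q F : Fin d → ℝ × XV d → ℂ}
    (H : FourierEquation I y h Q F) :
    Integrable (fun p => (starRingEnd ℂ (y p)) * h p - ∑ j, (starRingEnd ℂ (Q j p)) * F j p)
      ((volume.restrict I).prod volume) :=
  (integrable_conj_mul H.memLp_y H.memLp_h).sub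
    (integrable_finsetSum _ fun j _ => integrable_conj_mul (H.memLp_Q j) (H.memLp_F j))

/-- On almost every characteristic `y` is absolutely continuous with derivative `fourierSource F h`,
so the half-line inequality applies there; Fubini sums over the frequencies. -/
theorem FourierEquation.energy {I : Set ℝ} (hI : IsOpen I) (hl : IsLowerSet I) (hne : I.Nonempty)
    {y h : ℝ × XV d → ℂ} {Q F : Fin d → ℝ × XV d → ℂ}
    (H : FourierEquation I y h Q F) :
    0 ≤ (∫ p, ((starRingEnd ℂ (y p)) * h p - ∑ j, (starRingEnd ℂ (Q j p)) * F j p)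
      ∂((volume.restrict I).prod volume)).re := by
  obtain ⟨t₀, ht₀⟩ := hne
  have hS := locallyIntegrable_fourierSource H.memLp_F H.memLp_h
  have hy := H.memLp_y.locallyIntegrable (by norm_num)
  have hi := H.integrable
  rw [integral_prod_symm _ hi]
  rw [← RCLike.re_eq_complex_re, ← integral_re hi.integral_prod_right]
  refine integral_nonneg_of_ae ?_
  have hg : ∀ᵐ p ∂((volume.restrict I).prod (volume : Measure (XV d))), ∀ j,
      Q j p = Complex.I * (symb p j : ℂ) * y p := ae_all_iff.2 H.grad
  filter_upwards [ae_slice_primitive hI hl ht₀ hy hS H.eq, ae_slice_locallyIntegrable hS,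
    ae_memLp_slice_left H.memLp_y, ae_slice_left hg, hi.prod_left_ae] with e ⟨c, hc⟩ hSe hye hge hie
  have hcongr : (fun t => (starRingEnd ℂ (y (t, e))) * fourierSource F h (t, e))
      =ᵐ[volume.restrict I] fun t => (starRingEnd ℂ (y (t, e))) * h (t, e)
        - ∑ j, (starRingEnd ℂ (Q j (t, e))) * F j (t, e) := by
    filter_upwards [hge] with t ht using conj_mul_fourierSource ht
  have h1 := re_integral_conj_mul_nonneg hI hl hSe ht₀ hc hye (hie.congr hcongr.symm)
  simp only [Pi.zero_apply]
  rw [← integral_re hie]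
  refine h1.trans_eq (integral_congr_ae ?_)
  filter_upwards [hcongr] with t ht
  exact congrArg Complex.re ht

/-- The bound holds on each characteristic and is integrated over the frequencies. The constant is
`5 · 400`: the factor from `lintegral_gain_le` times a number dominating 1, 400 and 16. -/
theorem FourierEquation.gain {I : Set ℝ} (hI : IsOpen I) (hl : IsLowerSet I) (hne : I.Nonempty)
    {y h : ℝ × XV d → ℂ} {Q F : Fin d → ℝ × XV d → ℂ}
    (H : FourierEquation I y h Q F) {lam : ℝ} (hlam : 0 < lam) :
    ∫⁻ p, ENNReal.ofReal (((2 * Real.pi * ‖p.2.fst‖) ^ (1 / 3 : ℝ)) ^ 2 * ‖y p‖ ^ 2)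
        ∂((volume.restrict I).prod volume)
      ≤ 2000 * ∫⁻ p, ENNReal.ofReal (∑ j, ‖Q j p‖ ^ 2 + ∑ j, ‖F j p‖ ^ 2 + lam * ‖y p‖ ^ 2
        + lam⁻¹ * ‖h p‖ ^ 2) ∂((volume.restrict I).prod volume) := by
  obtain ⟨t₀, ht₀⟩ := hne
  have hS := locallyIntegrable_fourierSource H.memLp_F H.memLp_h
  have hy := H.memLp_y.locallyIntegrable (by norm_num)
  have hg : ∀ᵐ p ∂((volume.restrict I).prod (volume : Measure (XV d))), ∀ j,
      Q j p = Complex.I * (symb p j : ℂ) * y p := ae_all_iff.2 H.grad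
  have hm1 : Measurable fun p : ℝ × XV d => ‖p.2.fst‖ :=
    ((WithLp.continuous_fst 2 _ _).comp continuous_snd).norm.measurable
  have hfm : AEMeasurable (fun p => ENNReal.ofReal
      (((2 * Real.pi * ‖p.2.fst‖) ^ (1 / 3 : ℝ)) ^ 2 * ‖y p‖ ^ 2))
      ((volume.restrict I).prod volume) := by
    refine AEMeasurable.ennreal_ofReal (AEMeasurable.mul ?_ (H.memLp_y.1.norm.aemeasurable.pow_const 2))
    exact (((hm1.const_mul _).pow_const _).pow_const 2).aemeasurable
  have hgm : AEMeasurable (fun p => ENNReal.ofReal (∑ j, ‖Q j p‖ ^ 2 + ∑ j, ‖F j p‖ ^ 2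
      + lam * ‖y p‖ ^ 2 + lam⁻¹ * ‖h p‖ ^ 2)) ((volume.restrict I).prod volume) := by
    refine AEMeasurable.ennreal_ofReal (AEMeasurable.add (AEMeasurable.add (AEMeasurable.add ?_ ?_) ?_) ?_)
    · exact Finset.aemeasurable_fun_sum _ fun j _ => (H.memLp_Q j).1.norm.aemeasurable.pow_const 2
    · exact Finset.aemeasurable_fun_sum _ fun j _ => (H.memLp_F j).1.norm.aemeasurable.pow_const 2
    · exact (H.memLp_y.1.norm.aemeasurable.pow_const 2).const_mul _
    · exact (H.memLp_h.1.norm.aemeasurable.pow_const 2).const_mul _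
  rw [lintegral_prod_symm _ hfm, lintegral_prod_symm _ hgm, ← lintegral_const_mul'' _ hgm.lintegral_prod_left]
  refine lintegral_mono_ae ?_
  filter_upwards [ae_slice_primitive hI hl ht₀ hy hS H.eq, ae_slice_locallyIntegrable hS,
    ae_memLp_slice_left H.memLp_y, ae_memLp_slice_left H.memLp_h,
    ae_all_iff.2 fun j => ae_memLp_slice_left (H.memLp_Q j),
    ae_all_iff.2 fun j => ae_memLp_slice_left (H.memLp_F j), ae_slice_left hg]
    with e ⟨c, hc⟩ hSe hye hhe hQe hFe hge
  set M := 2 * Real.pi * ‖e.fst‖ with hM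
  have hM0 : 0 ≤ M := by positivity
  -- `M` is the speed of `symb` along the characteristic. The scale `r` with `r³ = M` is chosen so
  -- that crossing the region `‖symb‖ < r` takes a time of order `r⁻²`.
  set r := M ^ (1 / 3 : ℝ) with hr
  have hr0 : 0 ≤ r := Real.rpow_nonneg hM0 _
  have hr3 : r ^ 3 = M := by
    rw [hr, ← Real.rpow_natCast, ← Real.rpow_mul hM0]; norm_num
  -- Low frequencies need only the term `lam * ‖y‖²`. For high ones `r⁻² < lam⁻¹` turns the weight
  -- `16 / r²` of the source into `16 lam⁻¹`.
  rcases le_or_gt (r ^ 2) lam with hle | hgt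
  · refine (lintegral_mono (g := fun t => ENNReal.ofReal (∑ j, ‖Q j (t, e)‖ ^ 2
      + ∑ j, ‖F j (t, e)‖ ^ 2 + lam * ‖y (t, e)‖ ^ 2 + lam⁻¹ * ‖h (t, e)‖ ^ 2)) fun t => ?_).trans ?_
    · refine ENNReal.ofReal_le_ofReal ?_
      have h1 : r ^ 2 * ‖y (t, e)‖ ^ 2 ≤ lam * ‖y (t, e)‖ ^ 2 := by gcongr
      have h2 : 0 ≤ ∑ j, ‖Q j (t, e)‖ ^ 2 := Finset.sum_nonneg fun j _ => by positivity
      have h3 : 0 ≤ ∑ j, ‖F j (t, e)‖ ^ 2 := Finset.sum_nonneg fun j _ => by positivity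
      have h4 : 0 ≤ lam⁻¹ * ‖h (t, e)‖ ^ 2 := by positivity
      linarith
    · exact le_mul_of_one_le_left' (by norm_num)
  · have hrpos : 0 < r := by
      rcases hr0.lt_or_eq with h | h
      · exact h
      · rw [← h] at hgt; norm_num at hgt; linarith
    have hQsum : (fun t => ∑ j, ‖Q j (t, e)‖ ^ 2) =ᵐ[volume.restrict I]
        fun t => ‖symb (t, e)‖ ^ 2 * ‖y (t, e)‖ ^ 2 := by
      filter_upwards [hge] with t ht
      rw [EuclideanSpace.norm_sq_eq, Finset.sum_mul]
      refine Finset.sum_congr rfl fun j _ => ?_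
      rw [ht j]
      simp [mul_pow]
    have hFm : MemLp (fun t => √(∑ j, ‖F j (t, e)‖ ^ 2)) 2 (volume.restrict I) := by
      have hm : AEStronglyMeasurable (fun t => √(∑ j, ‖F j (t, e)‖ ^ 2)) (volume.restrict I) := by
        refine AEMeasurable.aestronglyMeasurable (AEMeasurable.sqrt ?_)
        exact Finset.aemeasurable_fun_sum _ fun j _ => (hFe j).1.norm.aemeasurable.pow_const 2
      rw [memLp_two_iff_integrable_sq hm]
      have : Integrable (fun t => ∑ j, ‖F j (t, e)‖ ^ 2) (volume.restrict I) :=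
        integrable_finsetSum _ fun j _ => (hFe j).norm.integrable_sq
      refine this.congr (.of_forall fun t => ?_)
      exact (Real.sq_sqrt (Finset.sum_nonneg fun j _ => by positivity)).symm
    have hQi : Integrable (fun t => ∑ j, ‖Q j (t, e)‖ ^ 2) (volume.restrict I) :=
      integrable_finsetSum _ fun j _ => (hQe j).norm.integrable_sq
    have key := lintegral_gain_le hI hl hSe ht₀ hc (q := fun t => ‖symb (t, e)‖)
      (F := fun t => √(∑ j, ‖F j (t, e)‖ ^ 2)) (h := fun t => ‖h (t, e)‖) hrpos
      (fun s => Real.sqrt_nonneg _) (fun s => norm_nonneg _)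
      (fun t s => by
        rw [hr3, hM, ← norm_symb_sub]
        calc ‖symb (s, e)‖ = ‖(symb (s, e) - symb (t, e)) + symb (t, e)‖ := by rw [sub_add_cancel]
          _ ≤ _ := norm_add_le _ _)
      (fun t s => by
        rw [hr3, hM, ← norm_symb_sub]
        exact norm_sub_le _ _)
      (fun s => norm_fourierSource_le F h (s, e)) (hQi.congr hQsum) hFm hhe.norm
    refine key.trans ?_
    calc 5 * ∫⁻ t in I, ENNReal.ofReal (‖symb (t, e)‖ ^ 2 * ‖y (t, e)‖ ^ 2
          + 400 * √(∑ j, ‖F j (t, e)‖ ^ 2) ^ 2 + 16 / r ^ 2 * ‖h (t, e)‖ ^ 2)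
        ≤ 5 * ∫⁻ t in I, 400 * ENNReal.ofReal (∑ j, ‖Q j (t, e)‖ ^ 2
      + ∑ j, ‖F j (t, e)‖ ^ 2 + lam * ‖y (t, e)‖ ^ 2 + lam⁻¹ * ‖h (t, e)‖ ^ 2) := by
          gcongr 5 * ?_
          refine lintegral_mono_ae ?_
          filter_upwards [hQsum] with t ht
          have e400 : (400 : ℝ≥0∞) = ENNReal.ofReal 400 := by simp
          rw [e400, ← ENNReal.ofReal_mul (by norm_num), ← ht,
            Real.sq_sqrt (Finset.sum_nonneg fun j _ => by positivity)]
          refine ENNReal.ofReal_le_ofReal ?_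
          have h2 : 0 ≤ ∑ j, ‖Q j (t, e)‖ ^ 2 := Finset.sum_nonneg fun j _ => by positivity
          have h4 : 16 / r ^ 2 * ‖h (t, e)‖ ^ 2 ≤ 16 * (lam⁻¹ * ‖h (t, e)‖ ^ 2) := by
            rw [div_eq_mul_inv, mul_assoc]
            gcongr
          have h5 : 0 ≤ lam * ‖y (t, e)‖ ^ 2 := by positivity
          have h6 : 0 ≤ lam⁻¹ * ‖h (t, e)‖ ^ 2 := by positivity
          linarith
      _ = _ := by
          rw [lintegral_const_mul' _ _ (by norm_num), ← mul_assoc]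
          norm_num

end FourierSide

/-- Smooth cutoff functions exhausting `E`, with uniformly bounded gradients. -/
lemma exists_cutoff (E : Type*) [NormedAddCommGroup E] [InnerProductSpace ℝ E]
    [FiniteDimensional ℝ E] : ∃ (η : ℕ → E → ℝ) (K : ℝ), (∀ n, ContDiff ℝ ∞ (η n)) ∧
    (∀ n, HasCompactSupport (η n)) ∧ (∀ n e, |η n e| ≤ 1) ∧ (∀ n e, ‖fderiv ℝ (η n) e‖ ≤ K) ∧
    ∀ e, ∀ᶠ n in atTop, ∀ᶠ e' in 𝓝 e, η n e' = 1 := by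
  let β : ContDiffBump (0 : E) := ⟨1, 2, one_pos, one_lt_two⟩
  have hβ : ContDiff ℝ ∞ β := β.contDiff
  obtain ⟨K, hK⟩ := (hβ.continuous_fderiv (by simp)).bounded_above_of_compact_support
    (β.hasCompactSupport.fderiv (𝕜 := ℝ))
  have hK0 : 0 ≤ K := (norm_nonneg _).trans (hK 0)
  have hpos : ∀ n : ℕ, (0 : ℝ) < ((n : ℝ) + 1)⁻¹ := fun n => by positivity
  refine ⟨fun n e => β (((n : ℝ) + 1)⁻¹ • e), K, fun n => ?_, fun n => ?_, fun n e => ?_,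
    fun n e => ?_, fun e => ?_⟩
  · exact hβ.comp (contDiff_const_smul _)
  · exact β.hasCompactSupport.comp_homeomorph (Homeomorph.smulOfNeZero _ (hpos n).ne')
  · rw [abs_of_nonneg β.nonneg]; exact β.le_one
  · rw [fderiv_comp_smul, norm_smul, Real.norm_of_nonneg (hpos n).le]
    calc _ ≤ 1 * K := by
          gcongr
          · exact inv_le_one_of_one_le₀ (by linarith [n.cast_nonneg (α := ℝ)])
          · exact hK _
      _ = K := one_mul K
  · obtain ⟨N, hN⟩ := exists_nat_gt ‖e‖
    filter_upwards [eventually_ge_atTop N] with n hn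
    have hlt : ‖e‖ < n + 1 := hN.trans_le (by exact_mod_cast hn.trans (Nat.le_succ n))
    have : ∀ᶠ e' in 𝓝 e, ‖e'‖ < n + 1 := continuous_norm.continuousAt.eventually_lt_const hlt
    filter_upwards [this] with e' he'
    apply β.one_of_mem_closedBall
    rw [mem_closedBall_zero_iff, norm_smul, Real.norm_of_nonneg (hpos n).le]
    change _ ≤ (1 : ℝ)
    rw [inv_mul_le_iff₀ (by positivity)]
    linarith

/-! ### Pairings with products of a time weight and a test function. -/

section Pairing

variable {E : Type*} [NormedAddCommGroup E] [InnerProductSpace ℝ E] [FiniteDimensional ℝ E]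
  [MeasurableSpace E] [BorelSpace E] {τ : Measure ℝ}

lemma memLp_mul_prod {α β : Type*} [MeasurableSpace α] [MeasurableSpace β] {μ : Measure α}
    {ν : Measure β} [SFinite μ] [SFinite ν] {f : α → ℂ} {g : β → ℂ} (hf : MemLp f 2 μ)
    (hg : MemLp g 2 ν) : MemLp (fun p : α × β => f p.1 * g p.2) 2 (μ.prod ν) := by
  refine ⟨hf.1.comp_fst.mul hg.1.comp_snd, ?_⟩
  have h : eLpNorm (fun p : α × β => f p.1 * g p.2) 2 (μ.prod ν) ^ 2
      = eLpNorm f 2 μ ^ 2 * eLpNorm g 2 ν ^ 2 := by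
    simp only [eLpNorm_two_sq, enorm_mul, mul_pow]
    exact lintegral_prod_mul (hf.1.enorm.pow_const 2) (hg.1.enorm.pow_const 2)
  have h2 : eLpNorm (fun p : α × β => f p.1 * g p.2) 2 (μ.prod ν) ^ 2 < ⊤ := by
    rw [h]; exact ENNReal.mul_lt_top (ENNReal.pow_lt_top hf.2) (ENNReal.pow_lt_top hg.2)
  simpa using h2

/-- `∫ w(t) g(e) A(t, e)`. -/
def pair (τ : Measure ℝ) (w : ℝ → ℝ) (g : E → ℂ) (A : ℝ × E → ℂ) : ℂ :=
  ∫ p, ((w p.1 : ℂ) * g p.2) * A p ∂(τ.prod volume)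

/-- Time weights. -/
def IsWeight (τ : Measure ℝ) (w : ℝ → ℝ) : Prop := MemLp (fun t => (w t : ℂ)) 2 τ

lemma isWeight_of_continuous [IsLocallyFiniteMeasure τ] {w : ℝ → ℝ} (hw : Continuous w)
    (hc : HasCompactSupport w) : IsWeight τ w :=
  (Complex.continuous_ofReal.comp hw).memLp_of_hasCompactSupport (hc.comp_left Complex.ofReal_zero)

lemma integrable_pair [SFinite τ] {w : ℝ → ℝ} (hw : IsWeight τ w) {g : E → ℂ} (hg : MemLp g 2)
    {A : ℝ × E → ℂ} (hA : MemLp A 2 (τ.prod volume)) :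
    Integrable (fun p : ℝ × E => ((w p.1 : ℂ) * g p.2) * A p) (τ.prod volume) :=
  MemLp.integrable_mul (p := 2) (q := 2) (memLp_mul_prod hw hg) hA

lemma pair_add_left [SFinite τ] {w : ℝ → ℝ} (hw : IsWeight τ w) {g g' : E → ℂ} (hg : MemLp g 2)
    (hg' : MemLp g' 2) {A : ℝ × E → ℂ} (hA : MemLp A 2 (τ.prod volume)) :
    pair τ w (fun e => g e + g' e) A = pair τ w g A + pair τ w g' A := by
  rw [pair, pair, pair, ← integral_add (integrable_pair hw hg hA) (integrable_pair hw hg' hA)]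
  exact integral_congr_ae (.of_forall fun p => by simp only; ring)

lemma pair_const_mul (c : ℂ) (w : ℝ → ℝ) (g : E → ℂ) (A : ℝ × E → ℂ) :
    pair τ w (fun e => c * g e) A = c * pair τ w g A := by
  rw [pair, pair, ← integral_const_mul]
  exact integral_congr_ae (.of_forall fun p => by simp only; ring)

lemma tendsto_pair [SFinite τ] {w : ℝ → ℝ} (hw : IsWeight τ w) {g : E → ℂ} {gn : ℕ → E → ℂ} {b : E → ℝ}
    (hgn : ∀ n, AEStronglyMeasurable (gn n)) (hb : MemLp b 2)
    (hbd : ∀ n e, ‖gn n e‖ ≤ b e) (hlim : ∀ e, ∀ᶠ n in atTop, gn n e = g e)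
    {A : ℝ × E → ℂ} (hA : MemLp A 2 (τ.prod volume)) :
    Tendsto (fun n => pair τ w (gn n) A) atTop (𝓝 (pair τ w g A)) := by
  have hb' : MemLp (fun e => (b e : ℂ)) 2 := hb.ofReal
  refine tendsto_integral_of_dominated_convergence
    (fun p => ‖((w p.1 : ℂ) * (b p.2 : ℂ)) * A p‖) (fun n => ?_)
    (integrable_pair hw hb' hA).norm (fun n => .of_forall fun p => ?_) (.of_forall fun p => ?_)
  · exact (hw.1.comp_fst.mul (hgn n).comp_snd).mul hA.1
  · have h0 : 0 ≤ b p.2 := (norm_nonneg _).trans (hbd n p.2)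
    rw [norm_mul, norm_mul, norm_mul, norm_mul, Complex.norm_real (b p.2), Real.norm_of_nonneg h0]
    gcongr
    exact hbd n p.2
  · refine tendsto_const_nhds.congr' ?_
    filter_upwards [hlim p.2] with n hn
    rw [hn]

/-- The multiplication formula on almost every time slice; the weight depends only on `t` and is a
constant there. -/
lemma pair_fourier [SFinite τ] {w : ℝ → ℝ} (hw : IsWeight τ w) {A Ahat : ℝ × E → ℂ}
    (h : IsPartialFourier τ A Ahat) (χ : 𝓢(E, ℂ)) :
    pair τ w (𝓕 χ : 𝓢(E, ℂ)) A = pair τ w χ Ahat := by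
  rw [pair, pair, integral_prod _ (integrable_pair hw ((𝓕 χ).memLp 2 volume) h.1),
    integral_prod _ (integrable_pair hw (χ.memLp 2 volume) h.2.1)]
  refine integral_congr_ae ?_
  filter_upwards [h.2.2] with t ht
  have := ht.integral_smul χ
  simp only [mul_assoc, smul_eq_mul] at this ⊢
  rw [integral_const_mul, integral_const_mul, this]

lemma IsFourierL2.const_mul {f g : E → ℂ} (h : IsFourierL2 f g) (c : ℂ) :
    IsFourierL2 (fun e => c * f e) (fun e => c * g e) := by
  obtain ⟨hf, hg, h⟩ := h
  refine ⟨hf.const_mul c, hg.const_mul c, ?_⟩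
  have h1 : (hf.const_mul c).toLp (fun e => c * f e) = c • hf.toLp f := MemLp.toLp_const_smul c hf
  have h2 : (hg.const_mul c).toLp (fun e => c * g e) = c • hg.toLp g := MemLp.toLp_const_smul c hg
  rw [h1, h2, ← h]
  exact map_smul (Lp.fourierTransformₗᵢ E ℂ) c (hf.toLp f)

lemma IsPartialFourier.const_mul {A Ahat : ℝ × E → ℂ} (h : IsPartialFourier τ A Ahat) (c : ℂ) :
    IsPartialFourier τ (fun p => c * A p) (fun p => c * Ahat p) := by
  refine ⟨h.1.const_mul c, h.2.1.const_mul c, ?_⟩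
  filter_upwards [h.2.2] with t ht using ht.const_mul c

end Pairing

/-! ### The Fourier transform of a weak identity. -/

section WeakForm

variable {E : Type*} [NormedAddCommGroup E] [InnerProductSpace ℝ E] [FiniteDimensional ℝ E]
  [MeasurableSpace E] [BorelSpace E] {τ : Measure ℝ} [SFinite τ] {κ : Type*} [Fintype κ]
  {α β : ℝ → ℝ} {γ : κ → ℝ → ℝ} {m : κ → E} {A B : ℝ × E → ℂ} {C : κ → ℝ × E → ℂ}

lemma memLp_fderiv_apply {F : Type*} [NormedAddCommGroup F] [NormedSpace ℝ F] {ψ : E → F}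
    (hψ : ContDiff ℝ ∞ ψ) (hc : HasCompactSupport ψ) (v : E) :
    MemLp (fun e => fderiv ℝ ψ e v) 2 :=
  (((hψ.continuous_fderiv (by simp)).clm_apply continuous_const)).memLp_of_hasCompactSupport
    (hc.fderiv_apply (𝕜 := ℝ) v)

/-- A weak identity tested against real functions extends to complex test functions. -/
lemma weak_complex (hα : IsWeight τ α) (hβ : IsWeight τ β) (hγ : ∀ k, IsWeight τ (γ k))
    (hA : MemLp A 2 (τ.prod volume)) (hB : MemLp B 2 (τ.prod volume))
    (hC : ∀ k, MemLp (C k) 2 (τ.prod volume))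
    (h : ∀ ψ : E → ℝ, ContDiff ℝ ∞ ψ → HasCompactSupport ψ →
      pair τ α (fun e => (ψ e : ℂ)) A + pair τ β (fun e => (ψ e : ℂ)) B
        = ∑ k, pair τ (γ k) (fun e => ((fderiv ℝ ψ e (m k) : ℝ) : ℂ)) (C k))
    {ψ : E → ℂ} (hψ : ContDiff ℝ ∞ ψ) (hc : HasCompactSupport ψ) :
    pair τ α ψ A + pair τ β ψ B = ∑ k, pair τ (γ k) (fun e => fderiv ℝ ψ e (m k)) (C k) := by
  have r1 : ContDiff ℝ ∞ fun e => (ψ e).re := Complex.reCLM.contDiff.comp hψ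
  have i1 : ContDiff ℝ ∞ fun e => (ψ e).im := Complex.imCLM.contDiff.comp hψ
  have r2 : HasCompactSupport fun e => (ψ e).re := hc.comp_left Complex.zero_re
  have i2 : HasCompactSupport fun e => (ψ e).im := hc.comp_left Complex.zero_im
  have hd : ∀ e v, fderiv ℝ ψ e v = ((fderiv ℝ (fun e => (ψ e).re) e v : ℝ) : ℂ)
      + Complex.I * ((fderiv ℝ (fun e => (ψ e).im) e v : ℝ) : ℂ) := fun e v => by
    have hd0 := (hψ.differentiable (by simp) e).hasFDerivAt
    have e1 : fderiv ℝ (fun e => (ψ e).re) e = Complex.reCLM.comp (fderiv ℝ ψ e) :=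
      (Complex.reCLM.hasFDerivAt.comp e hd0).fderiv
    have e2 : fderiv ℝ (fun e => (ψ e).im) e = Complex.imCLM.comp (fderiv ℝ ψ e) :=
      (Complex.imCLM.hasFDerivAt.comp e hd0).fderiv
    rw [e1, e2, mul_comm]
    exact (Complex.re_add_im _).symm
  have key : ∀ {w : ℝ → ℝ}, IsWeight τ w → ∀ {g : E → ℂ} {g1 g2 : E → ℝ}, MemLp g1 2 → MemLp g2 2 →
      (∀ e, g e = (g1 e : ℂ) + Complex.I * (g2 e : ℂ)) → ∀ {D : ℝ × E → ℂ},
      MemLp D 2 (τ.prod volume) → pair τ w g D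
        = pair τ w (fun e => (g1 e : ℂ)) D + Complex.I * pair τ w (fun e => (g2 e : ℂ)) D := by
    intro w hw g g1 g2 h1 h2 he D hD
    have h1' : MemLp (fun e => (g1 e : ℂ)) 2 := h1.ofReal
    have h2' : MemLp (fun e => (g2 e : ℂ)) 2 := h2.ofReal
    rw [← pair_const_mul, ← pair_add_left hw h1' (h2'.const_mul Complex.I) hD]
    congr 1
    exact funext he
  have hψ' : ∀ e, ψ e = ((ψ e).re : ℂ) + Complex.I * ((ψ e).im : ℂ) := fun e => by
    rw [mul_comm]; exact (Complex.re_add_im _).symm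
  have m1 := r1.continuous.memLp_of_hasCompactSupport (μ := volume) (p := 2) r2
  have m2 := i1.continuous.memLp_of_hasCompactSupport (μ := volume) (p := 2) i2
  rw [key hα m1 m2 hψ' hA, key hβ m1 m2 hψ' hB]
  have hk : ∀ k, _ := fun k => key (hγ k) (memLp_fderiv_apply r1 r2 (m k))
    (memLp_fderiv_apply i1 i2 (m k)) (fun e => hd e (m k)) (hC k)
  simp only [hk, Finset.sum_add_distrib, ← Finset.mul_sum]
  rw [← h _ r1 r2, ← h _ i1 i2]
  ring

/-- The test functions to be used are Fourier transforms, which are not compactly supported. Cutoffs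
with uniformly bounded gradients, equal to one near any given point from some index on, allow
dominated convergence also in the derivative terms. -/
lemma weak_schwartz (hα : IsWeight τ α) (hβ : IsWeight τ β) (hγ : ∀ k, IsWeight τ (γ k))
    (hA : MemLp A 2 (τ.prod volume)) (hB : MemLp B 2 (τ.prod volume))
    (hC : ∀ k, MemLp (C k) 2 (τ.prod volume))
    (h : ∀ ψ : E → ℝ, ContDiff ℝ ∞ ψ → HasCompactSupport ψ →
      pair τ α (fun e => (ψ e : ℂ)) A + pair τ β (fun e => (ψ e : ℂ)) B
        = ∑ k, pair τ (γ k) (fun e => ((fderiv ℝ ψ e (m k) : ℝ) : ℂ)) (C k)) (ψ : 𝓢(E, ℂ)) :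
    pair τ α ψ A + pair τ β ψ B = ∑ k, pair τ (γ k) (fun e => fderiv ℝ ψ e (m k)) (C k) := by
  obtain ⟨η, K, h1, h2, h3, h4, h5⟩ := exists_cutoff E
  have hη : ∀ n, ContDiff ℝ ∞ fun e => η n e • ψ e := fun n => (h1 n).smul (ψ.smooth _)
  have hηc : ∀ n, HasCompactSupport fun e => η n e • ψ e := fun n => (h2 n).smul_right
  have hm0 : MemLp (fun e => ‖ψ e‖) 2 := (ψ.memLp 2 volume).norm
  have hbd : ∀ n e, ‖η n e • ψ e‖ ≤ ‖ψ e‖ := fun n e => by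
    rw [norm_smul]
    exact mul_le_of_le_one_left (norm_nonneg _) (h3 n e)
  have hlim : ∀ e, ∀ᶠ n in atTop, η n e • ψ e = ψ e := fun e => by
    filter_upwards [h5 e] with n hn
    rw [hn.self_of_nhds, one_smul]
  have hd : ∀ n e v, fderiv ℝ (fun e => η n e • ψ e) e v
      = η n e • fderiv ℝ ψ e v + (fderiv ℝ (η n) e v) • ψ e := fun n e v => by
    rw [fderiv_fun_smul ((h1 n).differentiable (by simp) e) ((ψ.smooth ⊤).differentiable (by simp) e)]
    simp
  refine tendsto_nhds_unique (f := fun n => pair τ α (fun e => η n e • ψ e) A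
    + pair τ β (fun e => η n e • ψ e) B) (l := atTop) ?_ ?_
  · exact (tendsto_pair hα (fun n => (hη n).continuous.aestronglyMeasurable) hm0 hbd hlim hA).add
      (tendsto_pair hβ (fun n => (hη n).continuous.aestronglyMeasurable) hm0 hbd hlim hB)
  · simp only [weak_complex hα hβ hγ hA hB hC h (hη _) (hηc _)]
    refine tendsto_finsetSum _ fun k _ => ?_
    refine tendsto_pair (b := fun e => ‖fderiv ℝ ψ e (m k)‖ + (K * ‖m k‖) * ‖ψ e‖) (hγ k)
      (fun n => (memLp_fderiv_apply (hη n) (hηc n) (m k)).1) ?_ (fun n e => ?_) (fun e => ?_) (hC k)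
    · exact ((LineDeriv.lineDerivOp (m k) ψ).memLp 2 volume).norm.add (hm0.const_mul _)
    · rw [hd]
      refine (norm_add_le _ _).trans (add_le_add ?_ ?_)
      · rw [norm_smul]
        exact mul_le_of_le_one_left (norm_nonneg _) (h3 n e)
      · rw [norm_smul]
        gcongr
        exact ((fderiv ℝ (η n) e).le_opNorm _).trans (by gcongr; exact h4 n e)
    · filter_upwards [h5 e] with n hn
      have hev : (fun e => η n e • ψ e) =ᶠ[𝓝 e] ψ := by
        filter_upwards [hn] with e' he'
        rw [he', one_smul]
      rw [hev.fderiv_eq]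

/-- The Fourier transform of a weak identity. -/
theorem weak_fourier (hα : IsWeight τ α) (hβ : IsWeight τ β) (hγ : ∀ k, IsWeight τ (γ k))
    {Ahat Bhat : ℝ × E → ℂ} {Chat : κ → ℝ × E → ℂ}
    (hA : IsPartialFourier τ A Ahat) (hB : IsPartialFourier τ B Bhat)
    (hC : ∀ k, IsPartialFourier τ (C k) (Chat k))
    (h : ∀ ψ : E → ℝ, ContDiff ℝ ∞ ψ → HasCompactSupport ψ →
      pair τ α (fun e => (ψ e : ℂ)) A + pair τ β (fun e => (ψ e : ℂ)) B
        = ∑ k, pair τ (γ k) (fun e => ((fderiv ℝ ψ e (m k) : ℝ) : ℂ)) (C k)) (χ : 𝓢(E, ℂ)) :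
    pair τ α χ Ahat + pair τ β χ Bhat
      = ∑ k, pair τ (γ k) (fun e => -(2 * Real.pi * Complex.I) * ((inner ℝ e (m k) : ℝ) * χ e))
          (Chat k) := by
  rw [← pair_fourier hα hA, ← pair_fourier hβ hB,
    weak_schwartz hα hβ hγ hA.1 hB.1 (fun k => (hC k).1) h]
  refine Finset.sum_congr rfl fun k _ => ?_
  -- A derivative of `𝓕 χ` is again a Fourier transform, of `-2πi ⟨·, m k⟩ χ`, and so it can be
  -- moved back to the other side.
  have h1 := pair_fourier (hγ k) (hC k)
    (-(2 * Real.pi * Complex.I) • SchwartzMap.smulLeftCLM ℂ (inner ℝ · (m k)) χ)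
  rw [← SchwartzMap.lineDerivOp_fourier_eq] at h1
  refine h1.trans ?_
  congr 1
  funext e
  have : (inner ℝ · (m k)).HasTemperateGrowth := ((innerSL ℝ).flip (m k)).hasTemperateGrowth
  simp [SchwartzMap.smulLeftCLM_apply_apply this]

lemma integrable_weak_fourier {w : ℝ → ℝ} (hw : IsWeight τ w) (v : E) {D : ℝ × E → ℂ}
    (hD : MemLp D 2 (τ.prod volume)) (χ : 𝓢(E, ℂ)) :
    Integrable (fun p : ℝ × E =>
      ((w p.1 : ℂ) * (-(2 * Real.pi * Complex.I) * ((inner ℝ p.2 v : ℝ) * χ p.2))) * D p)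
      (τ.prod volume) := by
  refine integrable_pair hw (g := fun e => -(2 * Real.pi * Complex.I) * ((inner ℝ e v : ℝ) * χ e)) ?_ hD
  have : (inner ℝ · v : E → ℝ).HasTemperateGrowth := ((innerSL ℝ).flip v).hasTemperateGrowth
  convert! (-(2 * Real.pi * Complex.I) • SchwartzMap.smulLeftCLM ℂ (inner ℝ · v) χ).memLp 2 volume using 2
  simp [SchwartzMap.smulLeftCLM_apply_apply this]

end WeakForm

/-! ### The weak kinetic equation and weak gradient after the Fourier transform. -/

section FourierOfWeak

variable {d : ℕ} {I : Set ℝ}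

/-- The unit vector of `x_j`. -/
def dirX (j : Fin d) : XV d := WithLp.toLp 2 (EuclideanSpace.single j 1, 0)

/-- The unit vector of `v_j`. -/
def dirV (j : Fin d) : XV d := WithLp.toLp 2 (0, EuclideanSpace.single j 1)

lemma inner_dirX (e : XV d) (j : Fin d) : inner ℝ e (dirX j) = e.fst j := by
  simp [dirX, WithLp.prod_inner_apply, EuclideanSpace.inner_single_right]

lemma inner_dirV (e : XV d) (j : Fin d) : inner ℝ e (dirV j) = e.snd j := by
  simp [dirV, WithLp.prod_inner_apply, EuclideanSpace.inner_single_right]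

lemma symb_apply (p : ℝ × XV d) (j : Fin d) :
    symb p j = 2 * Real.pi * (p.1 * inner ℝ p.2 (dirX j) + inner ℝ p.2 (dirV j)) := by
  rw [inner_dirX, inner_dirV]
  simp [symb]
  ring

/-- The smooth time weights supported in `I`. -/
lemma isWeight_of_smooth {θ : ℝ → ℝ} (hθ : ContDiff ℝ ∞ θ) (hc : HasCompactSupport θ) :
    IsWeight (volume.restrict I) θ ∧ IsWeight (volume.restrict I) (deriv θ) ∧
      IsWeight (volume.restrict I) (fun t => t * θ t) :=
  ⟨isWeight_of_continuous hθ.continuous hc,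
    isWeight_of_continuous (hθ.continuous_deriv (by simp)) hc.deriv,
    isWeight_of_continuous (continuous_id.mul hθ.continuous) hc.mul_left⟩

/-- The weight `t` on the `x`-direction and the weight 1 on the `v`-direction combine into `tξ_j +
η_j`. -/
lemma symb_term (θ : ℝ → ℝ) (χ : XV d → ℂ) (D : ℝ × XV d → ℂ) (j : Fin d) (p : ℝ × XV d) :
    (((p.1 * θ p.1 : ℝ) : ℂ) * (-(2 * Real.pi * Complex.I) * ((inner ℝ p.2 (dirX j) : ℝ) * χ p.2))) * D p
      + (((θ p.1 : ℝ) : ℂ) * (-(2 * Real.pi * Complex.I) * ((inner ℝ p.2 (dirV j) : ℝ) * χ p.2))) * D p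
      = -(χ p.2 * (θ p.1 * (Complex.I * (symb p j : ℂ) * D p))) := by
  rw [symb_apply]
  push_cast
  ring

/-- The weak kinetic equation along the characteristics, after the Fourier transform. -/
theorem fourier_kinetic {U H Uhat Hhat : ℝ × XV d → ℂ} {F Fhat : Fin d → ℝ × XV d → ℂ}
    (hU : IsPartialFourier (volume.restrict I) U Uhat)
    (hH : IsPartialFourier (volume.restrict I) H Hhat)
    (hF : ∀ j, IsPartialFourier (volume.restrict I) (F j) (Fhat j)) {θ : ℝ → ℝ}
    (hθ : ContDiff ℝ ∞ θ) (hc : HasCompactSupport θ)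
    (h : ∀ ψ : XV d → ℝ, ContDiff ℝ ∞ ψ → HasCompactSupport ψ →
      pair (volume.restrict I) (deriv θ) (fun e => (ψ e : ℂ)) U
        + pair (volume.restrict I) θ (fun e => (ψ e : ℂ)) H
      = ∑ j, pair (volume.restrict I) (fun t => t * θ t)
            (fun e => ((fderiv ℝ ψ e (dirX j) : ℝ) : ℂ)) (F j)
        + ∑ j, pair (volume.restrict I) θ (fun e => ((fderiv ℝ ψ e (dirV j) : ℝ) : ℂ)) (F j))
    {ψ : XV d → ℝ} (hψ : ContDiff ℝ ∞ ψ) (hψc : HasCompactSupport ψ) :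
    ∫ p, ψ p.2 • (deriv θ p.1 • Uhat p + θ p.1 • fourierSource Fhat Hhat p)
        ∂((volume.restrict I).prod volume) = 0 := by
  obtain ⟨w1, w2, w3⟩ := isWeight_of_smooth (I := I) hθ hc
  have hψ1 : ContDiff ℝ ∞ (fun x => (ψ x : ℂ)) := Complex.ofRealCLM.contDiff.comp hψ
  have hψ2 : HasCompactSupport (fun x => (ψ x : ℂ)) := hψc.comp_left Complex.ofReal_zero
  let χ : 𝓢(XV d, ℂ) := hψ2.toSchwartzMap hψ1
  have hχ : ∀ e, χ e = (ψ e : ℂ) := fun e => rfl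
  -- Each component of the flux occurs twice, since `D_v` is `t D_x + D_v` in the straightened
  -- coordinates.
  have key := weak_fourier (κ := Fin d ⊕ Fin d) (α := deriv θ) (β := θ)
    (γ := Sum.elim (fun _ t => t * θ t) (fun _ => θ)) (m := Sum.elim dirX dirV)
    (C := Sum.elim F F) (Chat := Sum.elim Fhat Fhat) w2 w1 (by rintro (k | k) <;> assumption)
    hU hH (by rintro (k | k) <;> exact hF k) (by simpa [Fintype.sum_sum_type] using h) χ
  simp only [Fintype.sum_sum_type, Sum.elim_inl, Sum.elim_inr] at key
  rw [← Finset.sum_add_distrib] at key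
  have hj : ∀ j, pair (volume.restrict I) (fun t => t * θ t)
        (fun e => -(2 * Real.pi * Complex.I) * ((inner ℝ e (dirX j) : ℝ) * χ e)) (Fhat j)
      + pair (volume.restrict I) θ
        (fun e => -(2 * Real.pi * Complex.I) * ((inner ℝ e (dirV j) : ℝ) * χ e)) (Fhat j)
      = -∫ p, χ p.2 * (θ p.1 * (Complex.I * (symb p j : ℂ) * Fhat j p))
          ∂((volume.restrict I).prod volume) := fun j => by
    rw [pair, pair, ← integral_add (integrable_weak_fourier w3 _ (hF j).2.1 χ)
      (integrable_weak_fourier w1 _ (hF j).2.1 χ), ← integral_neg]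
    exact integral_congr_ae (.of_forall fun p => symb_term θ χ (Fhat j) j p)
  have hi : ∀ j, Integrable (fun p => χ p.2 * (θ p.1 * (Complex.I * (symb p j : ℂ) * Fhat j p)))
      ((volume.restrict I).prod volume) := fun j => by
    have := ((integrable_weak_fourier w3 (dirX j) (hF j).2.1 χ).add
      (integrable_weak_fourier w1 (dirV j) (hF j).2.1 χ)).neg
    refine this.congr (.of_forall fun p => ?_)
    have h1 := symb_term θ χ (Fhat j) j p
    simp only [Pi.neg_apply, Pi.add_apply]
    rw [h1, neg_neg]
  simp only [hj] at key
  rw [Finset.sum_neg_distrib, ← integral_finsetSum _ (fun j _ => hi j)] at key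
  have hsum := integrable_finsetSum Finset.univ (fun j _ => hi j)
  have iU := integrable_pair w2 (χ.memLp 2 volume) hU.2.1
  have iH := integrable_pair w1 (χ.memLp 2 volume) hH.2.1
  have hadd := integral_add (iU.add iH) hsum
  simp only [Pi.add_apply] at hadd
  rw [pair, pair, ← integral_add iU iH, ← add_eq_zero_iff_eq_neg, ← hadd] at key
  rw [← key]
  refine integral_congr_ae (.of_forall fun p => ?_)
  simp only [fourierSource, hχ, Complex.real_smul, Finset.mul_sum, mul_add]
  ring_nf

/-- The case `A = 0` of `ae_slice_weak_eq` makes almost every slice vanish almost everywhere;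
Tonelli gives the statement on the product. -/
lemma ae_eq_zero_of_weak (hI : IsOpen I) {W : ℝ × XV d → ℂ}
    (hW : LocallyIntegrable W ((volume.restrict I).prod volume))
    (h : ∀ θ : ℝ → ℝ, ContDiff ℝ ∞ θ → HasCompactSupport θ → tsupport θ ⊆ I →
      ∀ ψ : XV d → ℝ, ContDiff ℝ ∞ ψ → HasCompactSupport ψ →
      ∫ p, ψ p.2 • (θ p.1 • W p) ∂((volume.restrict I).prod volume) = 0) :
    W =ᵐ[(volume.restrict I).prod volume] 0 := by
  have h0 : LocallyIntegrable (fun _ => 0 : ℝ × XV d → ℂ) ((volume.restrict I).prod volume) :=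
    locallyIntegrable_zero
  have h1 := ae_slice_weak_eq (I := I) h0 hW (by simpa using h)
  have h2 : ∀ᵐ e : XV d, ∀ᵐ t ∂(volume.restrict I), W (t, e) = 0 := by
    filter_upwards [h1, ae_slice_locallyIntegrable hW] with e he hWe
    have := hI.ae_eq_zero_of_integral_contDiff_smul_eq_zero (hWe.locallyIntegrableOn I)
      fun g hg hgc hgs => by simpa using he g hg hgc hgs
    filter_upwards [this, ae_restrict_mem hI.measurableSet] with t ht hm using ht hm
  have hm : AEMeasurable (fun p => ‖W p‖ₑ) ((volume.restrict I).prod volume) :=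
    hW.aestronglyMeasurable.enorm
  have h3 : ∫⁻ p, ‖W p‖ₑ ∂((volume.restrict I).prod volume) = 0 := by
    rw [lintegral_prod_symm _ hm]
    refine (lintegral_congr_ae ?_).trans lintegral_zero
    filter_upwards [h2] with e he
    refine (lintegral_congr_ae ?_).trans lintegral_zero
    filter_upwards [he] with t ht
    rw [ht, enorm_zero]
  filter_upwards [(lintegral_eq_zero_iff' hm).1 h3] with p hp
  simpa using hp

/-- The weak `v`-gradient along the characteristics, after the Fourier transform. -/
theorem fourier_gradient (hI : IsOpen I) {U P Uhat Phat : ℝ × XV d → ℂ}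
    (hU : IsPartialFourier (volume.restrict I) U Uhat)
    (hP : IsPartialFourier (volume.restrict I) P Phat) (j : Fin d)
    (h : ∀ θ : ℝ → ℝ, ContDiff ℝ ∞ θ → HasCompactSupport θ → tsupport θ ⊆ I →
      ∀ ψ : XV d → ℝ, ContDiff ℝ ∞ ψ → HasCompactSupport ψ →
      pair (volume.restrict I) θ (fun e => (ψ e : ℂ)) P
      = -(pair (volume.restrict I) (fun t => t * θ t)
            (fun e => ((fderiv ℝ ψ e (dirX j) : ℝ) : ℂ)) U
        + pair (volume.restrict I) θ (fun e => ((fderiv ℝ ψ e (dirV j) : ℝ) : ℂ)) U)) :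
    Phat =ᵐ[(volume.restrict I).prod volume] fun p => Complex.I * (symb p j : ℂ) * Uhat p := by
  have hsymb : Continuous fun p : ℝ × XV d => Complex.I * (symb p j : ℂ) :=
    continuous_const.mul (Complex.continuous_ofReal.comp (continuous_symb_apply j))
  have l1 := hP.2.1.locallyIntegrable (by norm_num)
  have l2 := locallyIntegrable_mul_left hsymb (hU.2.1.locallyIntegrable (by norm_num))
  have hz := ae_eq_zero_of_weak hI (l1.sub l2) fun θ hθ hc hs ψ hψ hψc => by
    obtain ⟨w1, w2, w3⟩ := isWeight_of_smooth (I := I) hθ hc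
    have w0 : IsWeight (volume.restrict I) (fun _ => 0) :=
      isWeight_of_continuous continuous_const HasCompactSupport.zero
    have hψ1 : ContDiff ℝ ∞ (fun x => (ψ x : ℂ)) := Complex.ofRealCLM.contDiff.comp hψ
    have hψ2 : HasCompactSupport (fun x => (ψ x : ℂ)) := hψc.comp_left Complex.ofReal_zero
    let χ : 𝓢(XV d, ℂ) := hψ2.toSchwartzMap hψ1
    have hχ : ∀ e, χ e = (ψ e : ℂ) := fun e => rfl
    have key := weak_fourier (κ := Unit ⊕ Unit) (α := θ) (β := fun _ => 0)
      (γ := Sum.elim (fun _ t => t * θ t) (fun _ => θ))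
      (m := Sum.elim (fun _ => dirX j) (fun _ => dirV j))
      (C := Sum.elim (fun _ p => (-1) * U p) (fun _ p => (-1) * U p))
      (Chat := Sum.elim (fun _ p => (-1) * Uhat p) (fun _ p => (-1) * Uhat p)) w1 w0
      (by rintro (k | k) <;> assumption) hP hP
      (by rintro (k | k) <;> exact hU.const_mul (-1)) (fun ψ hψ hψc => by
        have := h θ hθ hc hs ψ hψ hψc
        simp only [Fintype.sum_sum_type, Finset.univ_unique, Finset.sum_singleton, Sum.elim_inl,
          Sum.elim_inr]
        rw [this, neg_add, pair, pair, pair, pair, pair, ← integral_neg, ← integral_neg]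
        simp) χ
    simp only [Fintype.sum_sum_type, Finset.univ_unique, Finset.sum_singleton, Sum.elim_inl,
          Sum.elim_inr] at key
    have hU' := (hU.const_mul (-1)).2.1
    have i1 := integrable_weak_fourier w3 (dirX j) hU' χ
    have i2 := integrable_weak_fourier w1 (dirV j) hU' χ
    have iP := integrable_pair w1 (χ.memLp 2 volume) hP.2.1
    have e0 : pair (volume.restrict I) (fun _ => 0) χ Phat = 0 := by simp [pair]
    have hsub := integral_sub iP (i1.add i2)
    simp only [Pi.add_apply] at hsub
    rw [e0, add_zero, pair, pair, pair, ← integral_add i1 i2, ← sub_eq_zero, ← hsub] at key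
    rw [← key]
    refine integral_congr_ae (.of_forall fun p => ?_)
    simp only [Pi.sub_apply]
    rw [symb_term θ χ (fun p => -1 * Uhat p) j p]
    simp only [hχ, Complex.real_smul]
    ring
  filter_upwards [hz] with p hp
  exact sub_eq_zero.1 hp

end FourierOfWeak

/-! ### Straightening the characteristics. -/

section Shear

variable {d : ℕ}

/-- The time interval of `before d d T`. -/
def timeBefore (T : WithTop ℝ) : Set ℝ := {t | (t : WithTop ℝ) < T}

lemma isOpen_timeBefore (T : WithTop ℝ) : IsOpen (timeBefore T) := by
  induction T with
  | top => simp [timeBefore]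
  | coe T =>
    simp only [timeBefore, WithTop.coe_lt_coe]
    exact isOpen_Iio

lemma isLowerSet_timeBefore (T : WithTop ℝ) : IsLowerSet (timeBefore T) := fun _ _ hab ha =>
  (WithTop.coe_le_coe.2 hab).trans_lt ha

lemma timeBefore_nonempty (T : WithTop ℝ) : (timeBefore T).Nonempty := by
  induction T with
  | top => exact ⟨0, WithTop.coe_lt_top 0⟩
  | coe T => exact ⟨T - 1, WithTop.coe_lt_coe.2 (by linarith)⟩

lemma coe_before (T : WithTop ℝ) :
    (before d d T : Set (Phase d d)) = timeBefore T ×ˢ univ := by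
  ext z
  simp [before, timeBefore]

/-- Straightening of the characteristics of `∂_t - v · D_x`. -/
def shear : ℝ × XV d ≃ₜ Phase d d where
  toFun p := (p.1, p.2.fst - p.1 • p.2.snd, p.2.snd)
  invFun z := (z.1, WithLp.toLp 2 (z.2.1 + z.1 • z.2.2, z.2.2))
  left_inv p := by
    simp only [sub_add_cancel]
    rfl
  right_inv z := by simp
  continuous_toFun := by
    have h1 : Continuous fun p : ℝ × XV d => p.2.fst :=
      (WithLp.continuous_fst 2 _ _).comp continuous_snd
    have h2 : Continuous fun p : ℝ × XV d => p.2.snd :=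
      (WithLp.continuous_snd 2 _ _).comp continuous_snd
    fun_prop
  continuous_invFun := by
    refine continuous_fst.prodMk ((WithLp.prod_continuous_toLp 2 _ _).comp ?_)
    fun_prop

lemma shear_apply (p : ℝ × XV d) : shear p = (p.1, p.2.fst - p.1 • p.2.snd, p.2.snd) := rfl

/-- For fixed `v` it is a translation in `x`. The skew product wants the base variable `v` first,
hence the two swaps. -/
lemma measurePreserving_shift (t : ℝ) :
    MeasurePreserving (fun e : XV d => (e.fst - t • e.snd, e.snd)) volume
      ((volume : Measure (Euc d)).prod volume) := by
  have h1 : MeasurePreserving (fun q : Euc d × Euc d => (q.1, q.2 - t • q.1))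
      ((volume : Measure (Euc d)).prod volume) ((volume : Measure (Euc d)).prod volume) :=
    (MeasurePreserving.id volume).skew_product (g := fun v x => x - t • v) (by fun_prop)
      (.of_forall fun v => (measurePreserving_sub_right volume (t • v)).map_eq)
  have h2 : MeasurePreserving (Prod.swap : Euc d × Euc d → _)
      ((volume : Measure (Euc d)).prod volume) ((volume : Measure (Euc d)).prod volume) :=
    Measure.measurePreserving_swap
  have h3 : MeasurePreserving (WithLp.ofLp : XV d → Euc d × Euc d) volume
      ((volume : Measure (Euc d)).prod volume) := WithLp.volume_preserving_ofLp _ _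
  exact h2.comp (h1.comp (h2.comp h3))

lemma measurePreserving_shear (T : WithTop ℝ) :
    MeasurePreserving (shear : ℝ × XV d → Phase d d)
      ((volume.restrict (timeBefore T)).prod volume)
      (volume.restrict (before d d T : Set (Phase d d))) := by
  rw [coe_before]
  have h : (volume : Measure (Phase d d)) = volume.prod (volume.prod volume) := rfl
  rw [h, ← Measure.prod_restrict, Measure.restrict_univ]
  exact (MeasurePreserving.id _).skew_product
    (g := fun t (e : XV d) => (e.fst - t • e.snd, e.snd))
    (continuous_snd.comp (shear (d := d)).continuous).measurable
    (.of_forall fun t => (measurePreserving_shift t).map_eq)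

lemma integral_shear (T : WithTop ℝ) (f : Phase d d → ℝ) :
    ∫ p, f (shear p) ∂((volume.restrict (timeBefore T)).prod volume)
      = ∫ z in (before d d T : Set (Phase d d)), f z :=
  (measurePreserving_shear T).integral_comp shear.measurableEmbedding f

/-- The function `θ(t) ψ(x + t v, v)`. -/
def charTest (θ : ℝ → ℝ) (ψ : XV d → ℝ) (z : Phase d d) : ℝ := θ z.1 * ψ (shear.symm z).2

lemma charTest_shear (θ : ℝ → ℝ) (ψ : XV d → ℝ) (p : ℝ × XV d) :
    charTest θ ψ (shear p) = θ p.1 * ψ p.2 := by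
  rw [charTest, Homeomorph.symm_apply_apply]
  rfl

lemma hasFDerivAt_shear_symm_snd (z : Phase d d) :
    HasFDerivAt (fun z : Phase d d => (shear.symm z).2)
      ((WithLp.prodContinuousLinearEquiv 2 ℝ (Euc d) (Euc d)).symm.toContinuousLinearMap.comp
        (((ContinuousLinearMap.fst ℝ (Euc d) (Euc d)).comp (ContinuousLinearMap.snd ℝ ℝ _)
          + (z.1 • (ContinuousLinearMap.snd ℝ (Euc d) (Euc d)).comp (ContinuousLinearMap.snd ℝ ℝ _)
            + (ContinuousLinearMap.fst ℝ ℝ (Euc d × Euc d)).smulRight z.2.2)).prod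
          ((ContinuousLinearMap.snd ℝ (Euc d) (Euc d)).comp (ContinuousLinearMap.snd ℝ ℝ _)))) z := by
  have hx : HasFDerivAt (fun z : Phase d d => z.2.1)
    ((ContinuousLinearMap.fst ℝ (Euc d) (Euc d)).comp (ContinuousLinearMap.snd ℝ ℝ _)) z :=
      ContinuousLinearMap.hasFDerivAt
        ((ContinuousLinearMap.fst ℝ (Euc d) (Euc d)).comp (ContinuousLinearMap.snd ℝ ℝ _))
  have hv : HasFDerivAt (fun z : Phase d d => z.2.2)
    ((ContinuousLinearMap.snd ℝ (Euc d) (Euc d)).comp (ContinuousLinearMap.snd ℝ ℝ _)) z :=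
      ContinuousLinearMap.hasFDerivAt
        ((ContinuousLinearMap.snd ℝ (Euc d) (Euc d)).comp (ContinuousLinearMap.snd ℝ ℝ _))
  have ht : HasFDerivAt (fun z : Phase d d => z.1) (ContinuousLinearMap.fst ℝ ℝ (Euc d × Euc d)) z :=
      hasFDerivAt_fst
  exact (WithLp.prodContinuousLinearEquiv 2 ℝ (Euc d) (Euc d)).symm.hasFDerivAt.comp z
    ((hx.add (ht.smul hv)).prodMk hv)

lemma contDiff_charTest {θ : ℝ → ℝ} (hθ : ContDiff ℝ ∞ θ) {ψ : XV d → ℝ} (hψ : ContDiff ℝ ∞ ψ) :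
    ContDiff ℝ ∞ (charTest θ ψ) := by
  refine (hθ.comp contDiff_fst).mul (hψ.comp ?_)
  refine (WithLp.prodContinuousLinearEquiv 2 ℝ (Euc d) (Euc d)).symm.contDiff.comp
    (f := fun z : Phase d d => (z.2.1 + z.1 • z.2.2, z.2.2)) ?_
  fun_prop

lemma fderiv_charTest {θ : ℝ → ℝ} (hθ : ContDiff ℝ ∞ θ) {ψ : XV d → ℝ} (hψ : ContDiff ℝ ∞ ψ)
    (z : Phase d d) (w : Phase d d) :
    fderiv ℝ (charTest θ ψ) z w = deriv θ z.1 * w.1 * ψ (shear.symm z).2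
      + θ z.1 * fderiv ℝ ψ (shear.symm z).2
        (WithLp.toLp 2 (w.2.1 + (z.1 • w.2.2 + w.1 • z.2.2), w.2.2)) := by
  have h1 : HasFDerivAt (fun z : Phase d d => θ z.1) _ z :=
    (hθ.differentiable (by simp) z.1).hasFDerivAt.comp z hasFDerivAt_fst
  have h2 : HasFDerivAt (fun z : Phase d d => ψ (shear.symm z).2) _ z :=
    (hψ.differentiable (by simp) _).hasFDerivAt.comp z (hasFDerivAt_shear_symm_snd z)
  have h0 : fderiv ℝ (charTest θ ψ) z = _ := (h1.mul h2).fderiv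
  rw [h0]
  simp only [add_apply, smul_apply,
    ContinuousLinearMap.comp_apply, ContinuousLinearMap.coe_fst', smul_eq_mul]
  have h3 : fderiv ℝ θ z.1 w.1 = deriv θ z.1 * w.1 := by
    rw [← fderiv_apply_one_eq_deriv, mul_comm, ← smul_eq_mul, ← map_smul, smul_eq_mul, mul_one]
  rw [h3, add_comm]
  congr 1
  ring

/-- `θ(t) ψ(x + t v, v)` as a test function. -/
def charTestFunction (T : WithTop ℝ) {θ : ℝ → ℝ} (hθ : ContDiff ℝ ∞ θ) (hc : HasCompactSupport θ)
    (hs : tsupport θ ⊆ timeBefore T) {ψ : XV d → ℝ} (hψ : ContDiff ℝ ∞ ψ)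
    (hψc : HasCompactSupport ψ) : 𝓓(before d d T, ℝ) where
  toFun := charTest θ ψ
  contDiff' := contDiff_charTest hθ hψ
  hasCompactSupport' := by
    have h : HasCompactSupport fun p : ℝ × XV d => θ p.1 * ψ p.2 := by
      refine HasCompactSupport.intro (hc.isCompact.prod hψc.isCompact) fun p hp => ?_
      by_contra hne
      exact hp ⟨subset_tsupport _ (left_ne_zero_of_mul hne),
        subset_tsupport _ (right_ne_zero_of_mul hne)⟩
    exact h.comp_homeomorph shear.symm
  tsupport_subset' := by
    have h1 : IsClosed {z : Phase d d | z.1 ∈ tsupport θ} :=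
      (isClosed_tsupport θ).preimage continuous_fst
    have h2 : tsupport (charTest θ ψ) ⊆ {z : Phase d d | z.1 ∈ tsupport θ} :=
      closure_minimal (fun z hz => subset_tsupport _ (left_ne_zero_of_mul hz)) h1
    exact fun z hz => hs (h2 hz)

lemma charTestFunction_coe (T : WithTop ℝ) {θ : ℝ → ℝ} (hθ : ContDiff ℝ ∞ θ)
    (hc : HasCompactSupport θ) (hs : tsupport θ ⊆ timeBefore T) {ψ : XV d → ℝ}
    (hψ : ContDiff ℝ ∞ ψ) (hψc : HasCompactSupport ψ) :
    (charTestFunction T hθ hc hs hψ hψc : Phase d d → ℝ) = charTest θ ψ := rfl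

/-- `x + t v` and `v` are constant along `∂_t - v · D_x`, so only `θ` is differentiated. -/
lemma fderiv_charTest_shear_transport {θ : ℝ → ℝ} (hθ : ContDiff ℝ ∞ θ) {ψ : XV d → ℝ}
    (hψ : ContDiff ℝ ∞ ψ) (p : ℝ × XV d) :
    fderiv ℝ (charTest θ ψ) (shear p) (1, 0, 0)
      + fderiv ℝ (charTest θ ψ) (shear p) (0, -(shear p).2.2, 0) = deriv θ p.1 * ψ p.2 := by
  rw [fderiv_charTest hθ hψ, fderiv_charTest hθ hψ, Homeomorph.symm_apply_apply]
  simp only [shear_apply, one_smul, smul_zero, zero_smul, zero_add, add_zero, mul_one, mul_zero,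
    zero_mul]
  have : WithLp.toLp 2 (-p.2.snd, (0 : Euc d)) = -WithLp.toLp 2 (p.2.snd, (0 : Euc d)) := by
    have h0 : ((-p.2.snd, 0) : Euc d × Euc d) = -(p.2.snd, 0) := Prod.ext rfl neg_zero.symm
    rw [h0, WithLp.toLp_neg]
  rw [this, map_neg]
  ring

/-- A `v`-derivative reaches `ψ` directly and, with the factor `t`, through `x + t v`. This is the
origin of `symb`. -/
lemma fderiv_charTest_shear_v {θ : ℝ → ℝ} (hθ : ContDiff ℝ ∞ θ) {ψ : XV d → ℝ}
    (hψ : ContDiff ℝ ∞ ψ) (p : ℝ × XV d) (w : Euc d) :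
    fderiv ℝ (charTest θ ψ) (shear p) (0, 0, w)
      = ∑ j, ((p.1 * θ p.1) * fderiv ℝ ψ p.2 (dirX j) * w j
          + θ p.1 * fderiv ℝ ψ p.2 (dirV j) * w j) := by
  rw [fderiv_charTest hθ hψ, Homeomorph.symm_apply_apply]
  simp only [shear_apply, zero_smul, zero_add, add_zero, mul_zero, zero_mul]
  have hw : WithLp.toLp 2 (p.1 • w, w) = ∑ j, ((p.1 * w j) • dirX j + w j • dirV (d := d) j) := by
    have h1 : w = ∑ j, w j • EuclideanSpace.single j (1 : ℝ) := by
      conv_lhs => rw [← (EuclideanSpace.basisFun (Fin d) ℝ).sum_repr w]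
      simp
    apply (WithLp.prodContinuousLinearEquiv 2 ℝ (Euc d) (Euc d)).injective
    simp only [map_sum, map_add, map_smul]
    have e1 : ∀ j, (WithLp.prodContinuousLinearEquiv 2 ℝ (Euc d) (Euc d)) (dirX j)
      = (EuclideanSpace.single j 1, 0) := fun j => rfl
    have e2 : ∀ j, (WithLp.prodContinuousLinearEquiv 2 ℝ (Euc d) (Euc d)) (dirV j)
      = (0, EuclideanSpace.single j 1) := fun j => rfl
    have e3 : (WithLp.prodContinuousLinearEquiv 2 ℝ (Euc d) (Euc d)) (WithLp.toLp 2 (p.1 • w, w))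
      = (p.1 • w, w) := rfl
    simp only [e1, e2, e3, Prod.smul_mk, Prod.mk_add_mk, smul_zero, add_zero, zero_add]
    refine Prod.ext ?_ ?_
    · rw [Prod.fst_sum]
      conv_lhs => rw [h1, Finset.smul_sum]
      simp only [smul_smul]
    · rw [Prod.snd_sum]
      exact h1
  rw [hw, map_sum, Finset.mul_sum]
  refine Finset.sum_congr rfl fun j _ => ?_
  simp only [map_add, map_smul, smul_eq_mul]
  ring

end Shear

/-! ### Flux and source of the equation. -/

section Coefficients

variable {d : ℕ}

/-- Cauchy–Schwarz in each row costs `√d`, and summing the squares over `d` rows costs another `√d`.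
-/
lemma norm_toEuclideanLin_le {A : Matrix (Fin d) (Fin d) ℝ} {M : ℝ} (hM : 0 ≤ M)
    (hA : ∀ i j, |A i j| ≤ M) (q : Euc d) :
    ‖Matrix.toEuclideanLin A q‖ ≤ (M * d) * ‖q‖ := by
  have h1 : ∀ i, |Matrix.toEuclideanLin A q i| ≤ M * (√d * ‖q‖) := fun i => by
    have e1 : Matrix.toEuclideanLin A q i = ∑ j, A i j * q j := by
      simp [Matrix.toLpLin_apply, Matrix.mulVec, dotProduct]
    have h2 : ∑ j, |q j| ≤ √d * ‖q‖ := by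
      have := Real.sum_mul_le_sqrt_mul_sqrt Finset.univ (fun _ : Fin d => (1 : ℝ)) (fun j => |q j|)
      rw [EuclideanSpace.norm_eq]
      simpa using this
    calc |Matrix.toEuclideanLin A q i| ≤ ∑ j, |A i j * q j| := by
          rw [e1]; exact Finset.abs_sum_le_sum_abs _ _
      _ ≤ ∑ j, M * |q j| := Finset.sum_le_sum fun j _ => by
          rw [abs_mul]; exact mul_le_mul_of_nonneg_right (hA i j) (abs_nonneg _)
      _ ≤ M * (√d * ‖q‖) := by rw [← Finset.mul_sum]; gcongr
  rw [EuclideanSpace.norm_eq]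
  refine Real.sqrt_le_iff.2 ⟨by positivity, ?_⟩
  calc ∑ i, ‖Matrix.toEuclideanLin A q i‖ ^ 2 ≤ ∑ _i : Fin d, (M * (√d * ‖q‖)) ^ 2 :=
        Finset.sum_le_sum fun i _ => by
          rw [Real.norm_eq_abs]
          exact pow_le_pow_left₀ (abs_nonneg _) (h1 i) 2
    _ = (M * d * ‖q‖) ^ 2 := by
        simp only [Finset.sum_const, Finset.card_univ, Fintype.card_fin, nsmul_eq_mul]
        rw [mul_pow, mul_pow, Real.sq_sqrt (Nat.cast_nonneg d)]
        ring

lemma inner_toEuclideanLin (A : Matrix (Fin d) (Fin d) ℝ) (q : Euc d) :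
    inner ℝ (Matrix.toEuclideanLin A q) q = ∑ i, ∑ j, A i j * q i * q j := by
  rw [PiLp.inner_apply]
  refine Finset.sum_congr rfl fun i _ => ?_
  have e1 : Matrix.toEuclideanLin A q i = ∑ j, A i j * q j := by
    simp [Matrix.toLpLin_apply, Matrix.mulVec, dotProduct]
  rw [e1, real_inner_comm]
  simp only [RCLike.inner_apply, conj_trivial, Finset.sum_mul]
  exact Finset.sum_congr rfl fun j _ => by ring

variable {G : TopologicalSpace.Opens (Phase d d)} {δ L lam : ℝ}
  {a : Phase d d → Matrix (Fin d) (Fin d) ℝ} {b bbar : Phase d d → Euc d} {c : Phase d d → ℝ}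
  {u g : Phase d d → ℝ} {p f : Phase d d → Euc d}

/-- The flux of the equation: the right-hand side is `div_v` of it plus the source. -/
def flux (a : Phase d d → Matrix (Fin d) (Fin d) ℝ) (bbar : Phase d d → Euc d)
    (u : Phase d d → ℝ) (p f : Phase d d → Euc d) (z : Phase d d) : Euc d :=
  Matrix.toEuclideanLin (a z) (p z) - u z • bbar z + f z

/-- The source of the equation. -/
def source (b : Phase d d → Euc d) (c : Phase d d → ℝ) (lam : ℝ) (u : Phase d d → ℝ)
    (p : Phase d d → Euc d) (g : Phase d d → ℝ) (z : Phase d d) : ℝ :=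
  -inner ℝ (b z) (p z) - (c z + lam) * u z + g z

lemma MemL2.toEuclideanLin (hδ : 0 < δ) (ha : Elliptic δ a) (hp : MemL2 G p) :
    MemL2 G (fun z => Matrix.toEuclideanLin (a z) (p z)) := by
  refine MemLp.of_le_mul (c := δ⁻¹ * d) hp ?_ (.of_forall fun z =>
    norm_toEuclideanLin_le (inv_nonneg.2 hδ.le) (ha.upper z) (p z))
  have h1 : ∀ j, AEStronglyMeasurable (fun z => p z j) (volume.restrict (G : Set (Phase d d))) :=
    fun j => (PiLp.continuous_apply 2 _ j).comp_aestronglyMeasurable hp.1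
  have h2 : AEMeasurable (fun z i => ∑ j, a z i j * p z j) (volume.restrict (G : Set (Phase d d))) :=
    aemeasurable_pi_lambda _ fun i => Finset.aemeasurable_fun_sum _ fun j _ =>
      (ha.measurable i j).restrict.mul (h1 j).aemeasurable
  have h3 := (PiLp.continuous_toLp 2 (fun _ : Fin d => ℝ)).comp_aestronglyMeasurable
    h2.aestronglyMeasurable
  refine h3.congr (.of_forall fun z => ?_)
  ext i
  simp [Matrix.toLpLin_apply, Matrix.mulVec, dotProduct]

lemma LowerOrder.norm_b (hl : LowerOrder L b bbar c) (z : Phase d d) : ‖b z‖ ≤ L := by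
  linarith [hl.bound z, norm_nonneg (bbar z), abs_nonneg (c z)]

lemma LowerOrder.norm_bbar (hl : LowerOrder L b bbar c) (z : Phase d d) : ‖bbar z‖ ≤ L := by
  linarith [hl.bound z, norm_nonneg (b z), abs_nonneg (c z)]

lemma LowerOrder.abs_c (hl : LowerOrder L b bbar c) (z : Phase d d) : |c z| ≤ L := by
  linarith [hl.bound z, norm_nonneg (b z), norm_nonneg (bbar z)]

lemma LowerOrder.memL2_smul (hl : LowerOrder L b bbar c) (hu : MemL2 G u) :
    MemL2 G (fun z => u z • bbar z) := by
  refine MemLp.of_le_mul (c := L) hu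
    (hu.1.smul hl.measurable_bbar.aestronglyMeasurable.restrict) (.of_forall fun z => ?_)
  rw [norm_smul, mul_comm]
  exact mul_le_mul_of_nonneg_right (hl.norm_bbar z) (norm_nonneg _)

lemma LowerOrder.memL2_inner (hl : LowerOrder L b bbar c) (hp : MemL2 G p) :
    MemL2 G (fun z => inner ℝ (b z) (p z)) := by
  refine MemLp.of_le_mul (c := L) hp
    (hl.measurable_b.aestronglyMeasurable.restrict.inner hp.1) (.of_forall fun z => ?_)
  exact (norm_inner_le_norm _ _).trans
    (mul_le_mul_of_nonneg_right (hl.norm_b z) (norm_nonneg _))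

lemma LowerOrder.memL2_mul (hl : LowerOrder L b bbar c) (hu : MemL2 G u) (lam : ℝ) :
    MemL2 G (fun z => (c z + lam) * u z) := by
  refine MemLp.of_le_mul (c := L + |lam|) hu
    ((hl.measurable_c.aestronglyMeasurable.restrict.add aestronglyMeasurable_const).mul hu.1)
    (.of_forall fun z => ?_)
  rw [norm_mul, Real.norm_eq_abs (c z + lam)]
  refine mul_le_mul_of_nonneg_right ?_ (norm_nonneg _)
  exact (abs_add_le _ _).trans (by gcongr; exact hl.abs_c z)

lemma memL2_flux (hδ : 0 < δ) (ha : Elliptic δ a) (hl : LowerOrder L b bbar c) (hu : MemL2 G u)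
    (hp : MemL2 G p) (hf : MemL2 G f) : MemL2 G (flux a bbar u p f) :=
  ((hp.toEuclideanLin hδ ha).sub (hl.memL2_smul hu)).add hf

lemma memL2_source (hl : LowerOrder L b bbar c) (hu : MemL2 G u)
    (hp : MemL2 G p) (hg : MemL2 G g) : MemL2 G (source b c lam u p g) :=
  ((hl.memL2_inner hp).neg.sub (hl.memL2_mul hu lam)).add hg

lemma integrable_mul_test {h : Phase d d → ℝ} (hh : MemL2 G h) (φ : 𝓓(G, ℝ)) :
    Integrable (fun z => h z * φ z) (volume.restrict (G : Set (Phase d d))) :=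
  MemLp.integrable_mul (p := 2) (q := 2) hh
    (φ.contDiff.continuous.memLp_of_hasCompactSupport φ.hasCompactSupport)

lemma integrable_fderiv_test {F : Phase d d → Euc d} (hF : MemL2 G F) (φ : 𝓓(G, ℝ)) :
    Integrable (fun z => fderiv ℝ φ z (0, 0, F z)) (volume.restrict (G : Set (Phase d d))) := by
  have hc : Continuous (fderiv ℝ φ) := φ.contDiff.continuous_fderiv (by simp)
  have h1 : MemLp (fun z => ‖fderiv ℝ φ z‖) 2 (volume.restrict (G : Set (Phase d d))) :=
    (hc.memLp_of_hasCompactSupport (φ.hasCompactSupport.fderiv (𝕜 := ℝ))).norm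
  have h2 : Continuous fun w : Euc d => ((0, 0, w) : Phase d d) := by fun_prop
  refine (MemLp.integrable_mul (p := 2) (q := 2) h1 hF.norm).mono'
    (isBoundedBilinearMap_apply.continuous.comp_aestronglyMeasurable₂ hc.aestronglyMeasurable
      (h2.comp_aestronglyMeasurable hF.1)) (.of_forall fun z => ?_)
  refine (ContinuousLinearMap.le_opNorm _ _).trans (le_of_eq ?_)
  simp [Prod.norm_def]

/-- The equation with all terms without `t`- and `x`-derivatives collected. -/
lemma SolvesEq.weak {α : Euc d → Euc d} (h : SolvesEq G α a b bbar c lam u p f g)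
    (hδ : 0 < δ) (ha : Elliptic δ a)
    (hl : LowerOrder L b bbar c) (hu : MemL2 G u) (hp : MemL2 G p) (hf : MemL2 G f)
    (hg : MemL2 G g) (φ : 𝓓(G, ℝ)) :
    (∫ z in (G : Set (Phase d d)), u z * (fderiv ℝ φ z (1, 0, 0) + fderiv ℝ φ z (0, α z.2.2, 0)))
      + ∫ z in (G : Set (Phase d d)), source b c lam u p g z * φ z
    = ∫ z in (G : Set (Phase d d)), fderiv ℝ φ z (0, 0, flux a bbar u p f z) := by
  have h1 := h φ
  have i1 := integrable_fderiv_test (hp.toEuclideanLin hδ ha) φ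
  have i2 := integrable_fderiv_test (hl.memL2_smul hu) φ
  have i3 := integrable_fderiv_test hf φ
  have j1 := integrable_mul_test (hl.memL2_inner hp) φ
  have j2 := integrable_mul_test (hl.memL2_mul hu lam) φ
  have j3 := integrable_mul_test hg φ
  have e1 : ∫ z in (G : Set (Phase d d)), fderiv ℝ φ z (0, 0, flux a bbar u p f z)
      = (∫ z in (G : Set (Phase d d)), fderiv ℝ φ z (0, 0, Matrix.toEuclideanLin (a z) (p z)))
        - (∫ z in (G : Set (Phase d d)), fderiv ℝ φ z (0, 0, u z • bbar z))
        + ∫ z in (G : Set (Phase d d)), fderiv ℝ φ z (0, 0, f z) := by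
    have i12 : Integrable (fun z => fderiv ℝ φ z (0, 0, Matrix.toEuclideanLin (a z) (p z))
      - fderiv ℝ φ z (0, 0, u z • bbar z)) (volume.restrict (G : Set (Phase d d))) := i1.sub i2
    rw [← integral_sub i1 i2, ← integral_add i12 i3]
    refine integral_congr_ae (.of_forall fun z => ?_)
    simp only [flux, ← map_sub, ← map_add]
    simp
  have e2 : ∫ z in (G : Set (Phase d d)), source b c lam u p g z * φ z
      = -(∫ z in (G : Set (Phase d d)), inner ℝ (b z) (p z) * φ z)
        - (∫ z in (G : Set (Phase d d)), (c z + lam) * u z * φ z)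
        + ∫ z in (G : Set (Phase d d)), g z * φ z := by
    have j12 : Integrable (fun z => inner ℝ (b z) (p z) * φ z + (c z + lam) * u z * φ z)
      (volume.restrict (G : Set (Phase d d))) := j1.add j2
    rw [← neg_add', ← integral_add j1 j2, neg_add_eq_sub, ← integral_sub j3 j12]
    refine integral_congr_ae (.of_forall fun z => ?_)
    simp only [source]
    ring
  rw [e1, e2]
  simp only [transport, divV, toDistr] at h1
  linarith

end Coefficients

/-! ### The equation in straightened coordinates. -/

section WeakAlongCharacteristics

variable {d : ℕ} {T : WithTop ℝ}

/-- A real function in the straightened coordinates, as a complex function. -/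
def lift (u : Phase d d → ℝ) (p : ℝ × XV d) : ℂ := (u (shear p) : ℂ)

lemma MemL2.lift {u : Phase d d → ℝ} (hu : MemL2 (before d d T) u) :
    MemLp (lift u) 2 ((volume.restrict (timeBefore T)).prod volume) := by
  have h : MemLp (fun p => u (shear p)) 2 ((volume.restrict (timeBefore T)).prod volume) :=
    MemLp.comp_measurePreserving hu (measurePreserving_shear T)
  exact h.ofReal

lemma MemL2.apply {F : Phase d d → Euc d} (hF : MemL2 (before d d T) F) (j : Fin d) :
    MemL2 (before d d T) (fun z => F z j) :=
  MemLp.of_le hF ((PiLp.continuous_apply 2 _ j).comp_aestronglyMeasurable hF.1)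
    (.of_forall fun z => PiLp.norm_apply_le (F z) j)

lemma pair_lift {τ : Measure ℝ} (w : ℝ → ℝ) (ψ : XV d → ℝ) (u : Phase d d → ℝ) :
    pair τ w (fun e => (ψ e : ℂ)) (lift u)
      = ((∫ p, w p.1 * ψ p.2 * u (shear p) ∂(τ.prod volume) : ℝ) : ℂ) := by
  rw [pair, ← integral_complex_ofReal]
  refine integral_congr_ae (.of_forall fun p => ?_)
  simp [lift]

lemma integrable_pair_lift {w : ℝ → ℝ} (hw : IsWeight (volume.restrict (timeBefore T)) w)
    {ψ : XV d → ℝ} (hψ : MemLp ψ 2) {u : Phase d d → ℝ} (hu : MemL2 (before d d T) u) :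
    Integrable (fun p : ℝ × XV d => w p.1 * ψ p.2 * u (shear p))
      ((volume.restrict (timeBefore T)).prod volume) := by
  have h1 : MemLp (fun e => (ψ e : ℂ)) 2 := hψ.ofReal
  have h := (integrable_pair hw h1 hu.lift).re
  refine h.congr (.of_forall fun p => ?_)
  simp only [Kinetic.lift, ← Complex.ofReal_mul]
  exact Complex.ofReal_re _

lemma integral_fderiv_charTest {θ : ℝ → ℝ} (hθ : ContDiff ℝ ∞ θ) (hc : HasCompactSupport θ)
    {ψ : XV d → ℝ} (hψ : ContDiff ℝ ∞ ψ) (hψc : HasCompactSupport ψ) {F : Phase d d → Euc d}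
    (hF : MemL2 (before d d T) F) :
    ((∫ z in (before d d T : Set (Phase d d)), fderiv ℝ (charTest θ ψ) z (0, 0, F z) : ℝ) : ℂ)
      = ∑ j, pair (volume.restrict (timeBefore T)) (fun t => t * θ t)
            (fun e => ((fderiv ℝ ψ e (dirX j) : ℝ) : ℂ)) (lift fun z => F z j)
        + ∑ j, pair (volume.restrict (timeBefore T)) θ
            (fun e => ((fderiv ℝ ψ e (dirV j) : ℝ) : ℂ)) (lift fun z => F z j) := by
  obtain ⟨w1, w2, w3⟩ := isWeight_of_smooth (I := timeBefore T) hθ hc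
  have i1 : ∀ j, _ := fun j => integrable_pair_lift w3 (memLp_fderiv_apply hψ hψc (dirX j)) (hF.apply j)
  have i2 : ∀ j, _ := fun j => integrable_pair_lift w1 (memLp_fderiv_apply hψ hψc (dirV j)) (hF.apply j)
  simp only [pair_lift, ← Complex.ofReal_sum, ← Complex.ofReal_add]
  congr 1
  rw [← integral_finsetSum _ (fun j _ => i1 j), ← integral_finsetSum _ (fun j _ => i2 j),
    ← integral_add (integrable_finsetSum _ (fun j _ => i1 j))
      (integrable_finsetSum _ (fun j _ => i2 j)), ← integral_shear]
  refine integral_congr_ae (.of_forall fun p => ?_)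
  simp only
  rw [fderiv_charTest_shear_v hθ hψ, Finset.sum_add_distrib]

/-- The kinetic equation and the weak gradient, along the characteristics and after the Fourier
transform. -/
theorem exists_fourierEquation {u h : Phase d d → ℝ} {p F : Phase d d → Euc d}
    (hu : MemL2 (before d d T) u) (hgrad : IsGradV (before d d T) u p)
    (hh : MemL2 (before d d T) h) (hF : MemL2 (before d d T) F)
    (heq : ∀ φ : 𝓓(before d d T, ℝ),
      (∫ z in (before d d T : Set (Phase d d)),
          u z * (fderiv ℝ φ z (1, 0, 0) + fderiv ℝ φ z (0, -z.2.2, 0)))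
        + ∫ z in (before d d T : Set (Phase d d)), h z * φ z
      = ∫ z in (before d d T : Set (Phase d d)), fderiv ℝ φ z (0, 0, F z)) :
    ∃ (Uhat Hhat : ℝ × XV d → ℂ) (Q Fhat : Fin d → ℝ × XV d → ℂ),
      IsPartialFourier (volume.restrict (timeBefore T)) (lift u) Uhat ∧
      IsPartialFourier (volume.restrict (timeBefore T)) (lift h) Hhat ∧
      (∀ j, IsPartialFourier (volume.restrict (timeBefore T)) (lift fun z => p z j) (Q j)) ∧
      (∀ j, IsPartialFourier (volume.restrict (timeBefore T)) (lift fun z => F z j) (Fhat j)) ∧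
      FourierEquation (timeBefore T) Uhat Hhat Q Fhat := by
  obtain ⟨Uhat, hU⟩ := exists_partialFourier hu.lift
  obtain ⟨Hhat, hH⟩ := exists_partialFourier hh.lift
  choose Q hQ using fun j => exists_partialFourier (hgrad.1.apply j).lift
  choose Fhat hFhat using fun j => exists_partialFourier (hF.apply j).lift
  refine ⟨Uhat, Hhat, Q, Fhat, hU, hH, hQ, hFhat, hU.2.1, hH.2.1, fun j => (hQ j).2.1,
    fun j => (hFhat j).2.1, fun j => ?_, fun θ hθ hc hs ψ hψ hψc => ?_⟩
  · refine fourier_gradient (isOpen_timeBefore T) hU (hQ j) j fun θ hθ hc hs ψ hψ hψc => ?_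
    have h1 := hgrad.2 (EuclideanSpace.single j 1) (charTestFunction T hθ hc hs hψ hψc)
    simp only [toDistr, divV, charTestFunction_coe, EuclideanSpace.inner_single_right,
      one_mul, conj_trivial] at h1
    have hm : MemL2 (before d d T) fun z => u z • (EuclideanSpace.single j 1 : Euc d) := by
      refine MemLp.of_le hu (hu.1.smul aestronglyMeasurable_const) (.of_forall fun z => ?_)
      simp [norm_smul]
    -- The weak gradient in direction `j` is the flux formula for the field `u e_j`, of which only
    -- the component `j` survives.
    have h2 := integral_fderiv_charTest hθ hc hψ hψc hm
    have e0 : ∀ k, (lift fun z => (u z • (EuclideanSpace.single j 1 : Euc d)) k)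
        = if k = j then lift u else 0 := fun k => by
      split_ifs with hk
      · subst hk; funext p; simp [lift]
      · funext p; simp [lift, hk]
    have e1 : ∀ w (g : XV d → ℂ), pair (volume.restrict (timeBefore T)) w g 0 = 0 := fun w g => by
      simp [pair]
    simp only [e0, apply_ite, e1, Finset.sum_ite_eq', Finset.mem_univ, if_true] at h2
    rw [← h2, pair_lift, ← Complex.ofReal_neg, ← h1, ← integral_shear]
    congr 1
    refine integral_congr_ae (.of_forall fun p => ?_)
    simp only [charTest_shear]
    ring
  · refine fourier_kinetic hU hH hFhat hθ hc (fun ψ hψ hψc => ?_) hψ hψc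
    rw [← integral_fderiv_charTest hθ hc hψ hψc hF]
    have h1 := heq (charTestFunction T hθ hc hs hψ hψc)
    simp only [charTestFunction_coe] at h1
    rw [← h1, pair_lift, pair_lift, ← Complex.ofReal_add, ← integral_shear, ← integral_shear]
    congr 2
    · refine integral_congr_ae (.of_forall fun p => ?_)
      simp only
      rw [fderiv_charTest_shear_transport hθ hψ]
      ring
    · refine integral_congr_ae (.of_forall fun p => ?_)
      simp only [charTest_shear]
      ring

end WeakAlongCharacteristics

/-! ### Return from the Fourier side. -/

section Plancherel

variable {d : ℕ} {T : WithTop ℝ}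

lemma MemL2.integrable_sq {F : Type*} [NormedAddCommGroup F]
    {G : TopologicalSpace.Opens (Phase d d)} {h : Phase d d → F} (hh : MemL2 G h) :
    Integrable (fun z => ‖h z‖ ^ 2) (volume.restrict (G : Set (Phase d d))) :=
  hh.integrable_norm_pow two_ne_zero

lemma normL2_sq {F : Type*} [NormedAddCommGroup F]
    {G : TopologicalSpace.Opens (Phase d d)} {h : Phase d d → F} (hh : MemL2 G h) :
    normL2 G h ^ 2 = ∫ z in (G : Set (Phase d d)), ‖h z‖ ^ 2 := by
  rw [normL2, ← ENNReal.toReal_pow, eLpNorm_two_sq, integral_eq_lintegral_of_nonneg_ae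
    (.of_forall fun z => by positivity) hh.integrable_sq.1]
  congr 1
  refine lintegral_congr fun z => ?_
  rw [← ofReal_norm, ENNReal.ofReal_pow (norm_nonneg _)]

lemma integral_lift_mul (u v : Phase d d → ℝ) :
    ∫ p, (starRingEnd ℂ (lift u p)) * lift v p ∂((volume.restrict (timeBefore T)).prod volume)
      = ((∫ z in (before d d T : Set (Phase d d)), u z * v z : ℝ) : ℂ) := by
  rw [← integral_shear, ← integral_complex_ofReal]
  refine integral_congr_ae (.of_forall fun p => ?_)
  simp [lift]

/-- Plancherel on almost every time slice, together with the invariance of Lebesgue measure under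
the shear. -/
lemma integral_norm_sq_fourier {u : Phase d d → ℝ} {Uhat : ℝ × XV d → ℂ}
    (hU : IsPartialFourier (volume.restrict (timeBefore T)) (lift u) Uhat) :
    ∫ p, ‖Uhat p‖ ^ 2 ∂((volume.restrict (timeBefore T)).prod volume)
      = ∫ z in (before d d T : Set (Phase d d)), ‖u z‖ ^ 2 := by
  have h := hU.integral_conj_mul hU
  rw [integral_lift_mul] at h
  have h1 : ∀ p, (starRingEnd ℂ (Uhat p)) * Uhat p = ((‖Uhat p‖ ^ 2 : ℝ) : ℂ) := fun p => by
    rw [RCLike.conj_mul]; simp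
  simp only [h1] at h
  rw [integral_complex_ofReal] at h
  rw [Complex.ofReal_injective h]
  refine integral_congr_ae (.of_forall fun z => ?_)
  simp only [Real.norm_eq_abs, sq_abs]
  ring

lemma integral_sum_norm_sq_fourier {F : Phase d d → Euc d} {Fhat : Fin d → ℝ × XV d → ℂ}
    (hF : MemL2 (before d d T) F)
    (h : ∀ j, IsPartialFourier (volume.restrict (timeBefore T)) (lift fun z => F z j) (Fhat j)) :
    ∫ p, ∑ j, ‖Fhat j p‖ ^ 2 ∂((volume.restrict (timeBefore T)).prod volume)
      = ∫ z in (before d d T : Set (Phase d d)), ‖F z‖ ^ 2 := by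
  rw [integral_finsetSum _ fun j _ => (h j).2.1.integrable_norm_pow two_ne_zero]
  simp only [integral_norm_sq_fourier (h _)]
  rw [← integral_finsetSum _ fun j _ => (hF.apply j).integrable_sq]
  refine integral_congr_ae (.of_forall fun z => ?_)
  exact (EuclideanSpace.norm_sq_eq (F z)).symm

variable {u h : Phase d d → ℝ} {p F : Phase d d → Euc d} {Uhat Hhat : ℝ × XV d → ℂ}
  {Q Fhat : Fin d → ℝ × XV d → ℂ}

/-- The energy inequality. -/
lemma FourierEquation.integral_nonneg (H : FourierEquation (timeBefore T) Uhat Hhat Q Fhat)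
    (hU : IsPartialFourier (volume.restrict (timeBefore T)) (lift u) Uhat)
    (hH : IsPartialFourier (volume.restrict (timeBefore T)) (lift h) Hhat)
    (hQ : ∀ j, IsPartialFourier (volume.restrict (timeBefore T)) (lift fun z => p z j) (Q j))
    (hF : ∀ j, IsPartialFourier (volume.restrict (timeBefore T)) (lift fun z => F z j) (Fhat j))
    (mu : MemL2 (before d d T) u) (mh : MemL2 (before d d T) h) (mp : MemL2 (before d d T) p)
    (mF : MemL2 (before d d T) F) :
    0 ≤ ∫ z in (before d d T : Set (Phase d d)), (u z * h z - inner ℝ (p z) (F z)) := by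
  have h1 := H.energy (isOpen_timeBefore T) (isLowerSet_timeBefore T) (timeBefore_nonempty T)
  have i1 := integrable_conj_mul H.memLp_y H.memLp_h
  have i2 : ∀ j, _ := fun j => integrable_conj_mul (H.memLp_Q j) (H.memLp_F j)
  rw [integral_sub i1 (integrable_finsetSum _ fun j _ => i2 j),
    integral_finsetSum _ fun j _ => i2 j, hU.integral_conj_mul hH, integral_lift_mul] at h1
  simp only [(hQ _).integral_conj_mul (hF _), integral_lift_mul] at h1
  rw [← Complex.ofReal_sum, ← Complex.ofReal_sub, Complex.ofReal_re] at h1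
  have k1 : Integrable (fun z => u z * h z) (volume.restrict (before d d T : Set (Phase d d))) :=
    MemLp.integrable_mul (p := 2) (q := 2) mu mh
  have k2 : ∀ j, Integrable (fun z => p z j * F z j)
      (volume.restrict (before d d T : Set (Phase d d))) := fun j =>
    MemLp.integrable_mul (p := 2) (q := 2) (mp.apply j) (mF.apply j)
  rw [← integral_finsetSum _ (fun j _ => k2 j),
    ← integral_sub k1 (integrable_finsetSum _ (fun j _ => k2 j))] at h1
  refine h1.trans_eq (integral_congr_ae (.of_forall fun z => ?_))
  simp only [PiLp.inner_apply, RCLike.inner_apply, conj_trivial]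
  congr 1
  exact Finset.sum_congr rfl fun j _ => mul_comm _ _

/-- The gain of regularity in `x`. -/
lemma FourierEquation.lintegral_le (H : FourierEquation (timeBefore T) Uhat Hhat Q Fhat)
    (hU : IsPartialFourier (volume.restrict (timeBefore T)) (lift u) Uhat)
    (hH : IsPartialFourier (volume.restrict (timeBefore T)) (lift h) Hhat)
    (hQ : ∀ j, IsPartialFourier (volume.restrict (timeBefore T)) (lift fun z => p z j) (Q j))
    (hF : ∀ j, IsPartialFourier (volume.restrict (timeBefore T)) (lift fun z => F z j) (Fhat j))
    (mp : MemL2 (before d d T) p) (mF : MemL2 (before d d T) F) {lam : ℝ} (hlam : 0 < lam) :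
    ∫⁻ q, ENNReal.ofReal (((2 * Real.pi * ‖q.2.fst‖) ^ (1 / 3 : ℝ)) ^ 2 * ‖Uhat q‖ ^ 2)
        ∂((volume.restrict (timeBefore T)).prod volume)
      ≤ ENNReal.ofReal (2000 * ((∫ z in (before d d T : Set (Phase d d)), ‖p z‖ ^ 2)
        + (∫ z in (before d d T : Set (Phase d d)), ‖F z‖ ^ 2)
        + lam * (∫ z in (before d d T : Set (Phase d d)), ‖u z‖ ^ 2)
        + lam⁻¹ * ∫ z in (before d d T : Set (Phase d d)), ‖h z‖ ^ 2)) := by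
  refine (H.gain (isOpen_timeBefore T) (isLowerSet_timeBefore T) (timeBefore_nonempty T)
    hlam).trans (le_of_eq ?_)
  have iQ := integrable_finsetSum Finset.univ
    fun j _ => (H.memLp_Q j).integrable_norm_pow two_ne_zero
  have iF := integrable_finsetSum Finset.univ
    fun j _ => (H.memLp_F j).integrable_norm_pow two_ne_zero
  have iy := (H.memLp_y.integrable_norm_pow two_ne_zero).const_mul lam
  have ih := (H.memLp_h.integrable_norm_pow two_ne_zero).const_mul lam⁻¹
  have i1 : Integrable (fun q => ∑ j, ‖Q j q‖ ^ 2 + ∑ j, ‖Fhat j q‖ ^ 2)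
    ((volume.restrict (timeBefore T)).prod volume) := iQ.add iF
  have i2 : Integrable (fun q => ∑ j, ‖Q j q‖ ^ 2 + ∑ j, ‖Fhat j q‖ ^ 2 + lam * ‖Uhat q‖ ^ 2)
    ((volume.restrict (timeBefore T)).prod volume) := i1.add iy
  have i3 : Integrable (fun q => ∑ j, ‖Q j q‖ ^ 2 + ∑ j, ‖Fhat j q‖ ^ 2 + lam * ‖Uhat q‖ ^ 2
    + lam⁻¹ * ‖Hhat q‖ ^ 2) ((volume.restrict (timeBefore T)).prod volume) := i2.add ih
  rw [← ofReal_integral_eq_lintegral_ofReal i3 (.of_forall fun q => by positivity),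
    integral_add i2 ih, integral_add i1 iy, integral_add iQ iF, integral_const_mul,
    integral_const_mul, integral_norm_sq_fourier hU, integral_norm_sq_fourier hH,
    integral_sum_norm_sq_fourier mp hQ, integral_sum_norm_sq_fourier mF hF,
    ENNReal.ofReal_mul (by norm_num)]
  simp

end Plancherel

/-! ### Pointwise bounds on flux and source. -/

section Estimates

variable {d : ℕ} {G : TopologicalSpace.Opens (Phase d d)} {δ L lam : ℝ}
  {a : Phase d d → Matrix (Fin d) (Fin d) ℝ} {b bbar : Phase d d → Euc d} {c : Phase d d → ℝ}
  {u g : Phase d d → ℝ} {p f : Phase d d → Euc d}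

/-- Ellipticity gives `-δ‖p‖²` and the zeroth-order term `-lam |u|²`. Young's inequality spends
`δ/4` of the first on the lower-order terms and `δ/4` on `f`, and `lam/4` of the second on `g`. The
remaining `(L²/δ + L)|u|²` costs at most another `lam/4`; this is the reason for the threshold on
`lam`. -/
lemma source_mul_sub_inner_flux_le (hδ : 0 < δ) (ha : Elliptic δ a)
    (hl : LowerOrder L b bbar c) (hL : 0 < L) (hlam : 4 * (L ^ 2 / δ + L) ≤ lam) (z : Phase d d) :
    u z * source b c lam u p g z - inner ℝ (p z) (flux a bbar u p f z)
      ≤ δ⁻¹ * ‖f z‖ ^ 2 + lam⁻¹ * ‖g z‖ ^ 2 - (δ / 2 * ‖p z‖ ^ 2 + lam / 2 * ‖u z‖ ^ 2) := by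
  have hlam0 : 0 < lam := lt_of_lt_of_le (by positivity) hlam
  have h1 : δ * ‖p z‖ ^ 2 ≤ inner ℝ (p z) (Matrix.toEuclideanLin (a z) (p z)) := by
    rw [real_inner_comm, inner_toEuclideanLin]; exact ha.lower z (p z)
  have h2 : u z * inner ℝ (p z) (bbar z) ≤ |u z| * (‖p z‖ * ‖bbar z‖) :=
    (le_abs_self _).trans (by rw [abs_mul]; gcongr; exact abs_real_inner_le_norm _ _)
  have h3 : -(u z * inner ℝ (b z) (p z)) ≤ |u z| * (‖b z‖ * ‖p z‖) :=
    (neg_le_abs _).trans (by rw [abs_mul]; gcongr; exact abs_real_inner_le_norm _ _)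
  have h4 : -inner ℝ (p z) (f z) ≤ ‖p z‖ * ‖f z‖ :=
    (neg_le_abs _).trans (abs_real_inner_le_norm _ _)
  have h5 : -(c z * (u z * u z)) ≤ L * |u z| ^ 2 := by
    rw [sq_abs, sq, ← neg_mul]
    exact mul_le_mul_of_nonneg_right ((neg_le_abs _).trans (hl.abs_c z)) (mul_self_nonneg _)
  have h6 : u z * g z ≤ |u z| * |g z| := (le_abs_self _).trans (abs_mul _ _).le
  have h7 : |u z| * (‖p z‖ * ‖bbar z‖) + |u z| * (‖b z‖ * ‖p z‖) ≤ L * (|u z| * ‖p z‖) := by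
    have : ‖b z‖ + ‖bbar z‖ ≤ L := by linarith [hl.bound z, abs_nonneg (c z)]
    calc _ = (‖b z‖ + ‖bbar z‖) * (|u z| * ‖p z‖) := by ring
      _ ≤ _ := by gcongr
  have h8 : L * (|u z| * ‖p z‖) ≤ δ / 4 * ‖p z‖ ^ 2 + L ^ 2 / δ * |u z| ^ 2 := by
    have : 0 ≤ (δ / 2 * ‖p z‖ - L * |u z|) ^ 2 / δ := by positivity
    have e : (δ / 2 * ‖p z‖ - L * |u z|) ^ 2 / δ
      = δ / 4 * ‖p z‖ ^ 2 + L ^ 2 / δ * |u z| ^ 2 - L * (|u z| * ‖p z‖) := by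
      field_simp; ring
    linarith
  have h9 : ‖p z‖ * ‖f z‖ ≤ δ / 4 * ‖p z‖ ^ 2 + δ⁻¹ * ‖f z‖ ^ 2 := by
    have : 0 ≤ (δ / 2 * ‖p z‖ - ‖f z‖) ^ 2 / δ := by positivity
    have e : (δ / 2 * ‖p z‖ - ‖f z‖) ^ 2 / δ
      = δ / 4 * ‖p z‖ ^ 2 + δ⁻¹ * ‖f z‖ ^ 2 - ‖p z‖ * ‖f z‖ := by
      field_simp; ring
    linarith
  have h10 : |u z| * |g z| ≤ lam / 4 * |u z| ^ 2 + lam⁻¹ * |g z| ^ 2 := by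
    have : 0 ≤ (lam / 2 * |u z| - |g z|) ^ 2 / lam := by positivity
    have e : (lam / 2 * |u z| - |g z|) ^ 2 / lam
      = lam / 4 * |u z| ^ 2 + lam⁻¹ * |g z| ^ 2 - |u z| * |g z| := by
      field_simp; ring
    linarith
  have h11 : 4 * (L ^ 2 / δ + L) * |u z| ^ 2 ≤ lam * |u z| ^ 2 := by gcongr
  have e : u z * source b c lam u p g z - inner ℝ (p z) (flux a bbar u p f z)
      = -inner ℝ (p z) (Matrix.toEuclideanLin (a z) (p z)) + u z * inner ℝ (p z) (bbar z)
        + -(u z * inner ℝ (b z) (p z)) + -inner ℝ (p z) (f z) + -(c z * (u z * u z))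
        - lam * |u z| ^ 2 + u z * g z := by
    rw [sq_abs]
    simp only [source, flux, inner_add_right, inner_sub_right, inner_smul_right]
    ring
  rw [e]
  simp only [Real.norm_eq_abs]
  linarith

/-- `L` enters only through `L² ≤ lam`, which keeps the final constant dependent on `d` and `δ`
alone. -/
lemma norm_flux_sq_le (hδ : 0 < δ) (ha : Elliptic δ a) (hl : LowerOrder L b bbar c)
    (hlam : L ^ 2 ≤ lam) (z : Phase d d) :
    ‖flux a bbar u p f z‖ ^ 2
      ≤ 3 * ((δ⁻¹ * d) ^ 2 * ‖p z‖ ^ 2 + lam * ‖u z‖ ^ 2 + ‖f z‖ ^ 2) := by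
  have h1 := norm_toEuclideanLin_le (inv_nonneg.2 hδ.le) (ha.upper z) (p z)
  have h2 : ‖u z • bbar z‖ ≤ L * ‖u z‖ := by
    rw [norm_smul, mul_comm]
    exact mul_le_mul_of_nonneg_right (hl.norm_bbar z) (norm_nonneg _)
  have h3 : ‖flux a bbar u p f z‖ ≤ δ⁻¹ * d * ‖p z‖ + L * ‖u z‖ + ‖f z‖ :=
    (norm_add_le _ _).trans (by gcongr; exact (norm_sub_le _ _).trans (add_le_add h1 h2))
  have h4 : L ^ 2 * ‖u z‖ ^ 2 ≤ lam * ‖u z‖ ^ 2 := by gcongr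
  have h5 := pow_le_pow_left₀ (norm_nonneg _) h3 2
  nlinarith [sq_nonneg (δ⁻¹ * d * ‖p z‖ - L * ‖u z‖), sq_nonneg (δ⁻¹ * d * ‖p z‖ - ‖f z‖),
    sq_nonneg (L * ‖u z‖ - ‖f z‖)]

/-- The powers of `lam` are such that multiplication by `lam⁻¹` leaves `‖p‖²`, `lam ‖u‖²` and `lam⁻¹
‖g‖²`, the quantities of the energy estimate. -/
lemma norm_source_sq_le (hl : LowerOrder L b bbar c) (hL : 0 < L) (hlam1 : L ≤ lam)
    (hlam : L ^ 2 ≤ lam) (z : Phase d d) :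
    ‖source b c lam u p g z‖ ^ 2
      ≤ 3 * (lam * ‖p z‖ ^ 2 + 4 * lam ^ 2 * ‖u z‖ ^ 2 + ‖g z‖ ^ 2) := by
  have h1 : ‖-inner ℝ (b z) (p z)‖ ≤ L * ‖p z‖ := by
    rw [norm_neg]
    exact (norm_inner_le_norm _ _).trans
      (mul_le_mul_of_nonneg_right (hl.norm_b z) (norm_nonneg _))
  have h2 : ‖(c z + lam) * u z‖ ≤ 2 * lam * ‖u z‖ := by
    rw [norm_mul]
    refine mul_le_mul_of_nonneg_right ?_ (norm_nonneg _)
    refine (norm_add_le _ _).trans ?_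
    rw [Real.norm_eq_abs, Real.norm_of_nonneg (hL.le.trans hlam1)]
    linarith [hl.abs_c z]
  have h3 : ‖source b c lam u p g z‖ ≤ L * ‖p z‖ + 2 * lam * ‖u z‖ + ‖g z‖ :=
    (norm_add_le _ _).trans (by gcongr; exact (norm_sub_le _ _).trans (add_le_add h1 h2))
  have h4 : L ^ 2 * ‖p z‖ ^ 2 ≤ lam * ‖p z‖ ^ 2 := by gcongr
  have h5 := pow_le_pow_left₀ (norm_nonneg _) h3 2
  nlinarith [sq_nonneg (L * ‖p z‖ - 2 * lam * ‖u z‖), sq_nonneg (L * ‖p z‖ - ‖g z‖),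
    sq_nonneg (2 * lam * ‖u z‖ - ‖g z‖)]

end Estimates

/-! ### The a priori estimates. -/

section APriori

lemma integrable_inner_of_memLp {α E : Type*} [MeasurableSpace α] {μ : Measure α}
    [NormedAddCommGroup E] [InnerProductSpace ℝ E] {f g : α → E} (hf : MemLp f 2 μ)
    (hg : MemLp g 2 μ) : Integrable (fun x => inner ℝ (f x) (g x)) μ :=
  (MemLp.integrable_mul (p := 2) (q := 2) hf.norm hg.norm).mono' (hf.1.inner hg.1)
    (.of_forall fun _ => norm_inner_le_norm _ _)

variable {d : ℕ} {T : WithTop ℝ} {δ L lam : ℝ}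
  {a : Phase d d → Matrix (Fin d) (Fin d) ℝ} {b bbar : Phase d d → Euc d} {c : Phase d d → ℝ}
  {u g : Phase d d → ℝ} {p f : Phase d d → Euc d}

lemma energy_bound (hδ : 0 < δ) (ha : Elliptic δ a)
    (hl : LowerOrder L b bbar c) (hL : 0 < L) (hlam : 4 * (L ^ 2 / δ + L) ≤ lam)
    {G : TopologicalSpace.Opens (Phase d d)}
    (hu : MemL2 G u) (hp : MemL2 G p) (hf : MemL2 G f) (hg : MemL2 G g)
    (h : 0 ≤ ∫ z in (G : Set (Phase d d)),
      (u z * source b c lam u p g z - inner ℝ (p z) (flux a bbar u p f z))) :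
    δ / 2 * normL2 G p ^ 2 + lam / 2 * normL2 G u ^ 2
      ≤ δ⁻¹ * normL2 G f ^ 2 + lam⁻¹ * normL2 G g ^ 2 := by
  rw [normL2_sq hu, normL2_sq hp, normL2_sq hf, normL2_sq hg]
  have i1 := hf.integrable_sq.const_mul δ⁻¹
  have i2 := hg.integrable_sq.const_mul lam⁻¹
  have i3 := hp.integrable_sq.const_mul (δ / 2)
  have i4 := hu.integrable_sq.const_mul (lam / 2)
  have i12 : Integrable (fun z => δ⁻¹ * ‖f z‖ ^ 2 + lam⁻¹ * ‖g z‖ ^ 2)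
    (volume.restrict (G : Set (Phase d d))) := i1.add i2
  have i34 : Integrable (fun z => δ / 2 * ‖p z‖ ^ 2 + lam / 2 * ‖u z‖ ^ 2)
    (volume.restrict (G : Set (Phase d d))) := i3.add i4
  have k : Integrable (fun z => u z * source b c lam u p g z
      - inner ℝ (p z) (flux a bbar u p f z)) (volume.restrict (G : Set (Phase d d))) :=
    (MemLp.integrable_mul (p := 2) (q := 2) hu (memL2_source hl hu hp hg)).sub
      (integrable_inner_of_memLp hp (memL2_flux hδ ha hl hu hp hf))
  have h1 := integral_mono k (i12.sub i34) fun z =>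
    source_mul_sub_inner_flux_le (u := u) (g := g) (p := p) (f := f) hδ ha hl hL hlam z
  have h2 := h.trans h1
  simp only [Pi.sub_apply] at h2
  rw [integral_sub i12 i34, integral_add i1 i2, integral_add i3 i4] at h2
  simp only [integral_const_mul] at h2
  linarith

lemma normL2_flux_sq_le (hδ : 0 < δ) (ha : Elliptic δ a) (hl : LowerOrder L b bbar c)
    (hlam : L ^ 2 ≤ lam) {G : TopologicalSpace.Opens (Phase d d)}
    (hu : MemL2 G u) (hp : MemL2 G p) (hf : MemL2 G f) :
    normL2 G (flux a bbar u p f) ^ 2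
      ≤ 3 * ((δ⁻¹ * d) ^ 2 * normL2 G p ^ 2 + lam * normL2 G u ^ 2 + normL2 G f ^ 2) := by
  have hF := memL2_flux hδ ha hl hu hp hf
  rw [normL2_sq hF, normL2_sq hu, normL2_sq hp, normL2_sq hf, ← integral_const_mul,
    ← integral_const_mul]
  have i1 := hp.integrable_sq.const_mul ((δ⁻¹ * d) ^ 2)
  have i2 := hu.integrable_sq.const_mul lam
  have i12 : Integrable (fun z => (δ⁻¹ * d) ^ 2 * ‖p z‖ ^ 2 + lam * ‖u z‖ ^ 2)
    (volume.restrict (G : Set (Phase d d))) := i1.add i2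
  rw [← integral_add i1 i2, ← integral_add i12 hf.integrable_sq, ← integral_const_mul]
  exact integral_mono hF.integrable_sq ((i12.add hf.integrable_sq).const_mul 3)
    fun z => norm_flux_sq_le hδ ha hl hlam z

lemma normL2_source_sq_le (hl : LowerOrder L b bbar c) (hL : 0 < L) (hlam1 : L ≤ lam)
    (hlam : L ^ 2 ≤ lam) {G : TopologicalSpace.Opens (Phase d d)}
    (hu : MemL2 G u) (hp : MemL2 G p) (hg : MemL2 G g) :
    normL2 G (source b c lam u p g) ^ 2
      ≤ 3 * (lam * normL2 G p ^ 2 + 4 * lam ^ 2 * normL2 G u ^ 2 + normL2 G g ^ 2) := by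
  have hF := memL2_source (lam := lam) hl hu hp hg
  rw [normL2_sq hF, normL2_sq hu, normL2_sq hp, normL2_sq hg, ← integral_const_mul,
    ← integral_const_mul]
  have i1 := hp.integrable_sq.const_mul lam
  have i2 := hu.integrable_sq.const_mul (4 * lam ^ 2)
  have i12 : Integrable (fun z => lam * ‖p z‖ ^ 2 + 4 * lam ^ 2 * ‖u z‖ ^ 2)
    (volume.restrict (G : Set (Phase d d))) := i1.add i2
  rw [← integral_add i1 i2, ← integral_add i12 hg.integrable_sq, ← integral_const_mul]
  exact integral_mono hF.integrable_sq ((i12.add hg.integrable_sq).const_mul 3)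
    fun z => norm_source_sq_le hl hL hlam1 hlam z

/-- The constant in the estimate of `(-Δ_x)^{1/6} u`. -/
def gainConst (d : ℕ) (δ : ℝ) : ℝ := 2000 * ((16 + 3 * (δ⁻¹ * d) ^ 2) * (2 / δ ^ 2) + 3)

/-- The a priori estimates, with the gain of `1/3` derivative in `x` expressed through the Fourier
transform along the characteristics. -/
theorem a_priori (hδ : 0 < δ) (hδ1 : δ < 1) (ha : Elliptic δ a)
    (hl : LowerOrder L b bbar c) (hL : 0 < L) (hlam : 4 * (L ^ 2 / δ + L) ≤ lam)
    (hu : MemL2 (before d d T) u) (hp : IsGradV (before d d T) u p) (hf : MemL2 (before d d T) f)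
    (hg : MemL2 (before d d T) g)
    (heq : SolvesEq (before d d T) (fun v => -v) a b bbar c lam u p f g) :
    normL2 (before d d T) p ^ 2 + lam * normL2 (before d d T) u ^ 2
        ≤ 2 / δ ^ 2 * (normL2 (before d d T) f ^ 2 + lam⁻¹ * normL2 (before d d T) g ^ 2) ∧
    ∃ Uhat, IsPartialFourier (volume.restrict (timeBefore T)) (lift u) Uhat ∧
      ∫⁻ q, ENNReal.ofReal (((2 * Real.pi * ‖q.2.fst‖) ^ (1 / 3 : ℝ)) ^ 2 * ‖Uhat q‖ ^ 2)
          ∂((volume.restrict (timeBefore T)).prod volume)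
        ≤ ENNReal.ofReal (gainConst d δ *
            (normL2 (before d d T) f ^ 2 + lam⁻¹ * normL2 (before d d T) g ^ 2)) := by
  have hlam0 : 0 < lam := lt_of_lt_of_le (by positivity) hlam
  have hL2 : L ^ 2 ≤ L ^ 2 / δ := by
    rw [le_div_iff₀ hδ]; exact mul_le_of_le_one_right (sq_nonneg L) hδ1.le
  have hlam1 : L ≤ lam := by nlinarith [sq_nonneg L]
  have hlam2 : L ^ 2 ≤ lam := by nlinarith [sq_nonneg L]
  have hF := memL2_flux hδ ha hl hu hp.1 hf
  have hh := memL2_source (lam := lam) hl hu hp.1 hg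
  obtain ⟨Uhat, Hhat, Q, Fhat, h1, h2, h3, h4, h5⟩ := exists_fourierEquation hu hp hh hF
    (heq.weak hδ ha hl hu hp.1 hf hg)
  have e1 := energy_bound hδ ha hl hL hlam hu hp.1 hf hg
    (h5.integral_nonneg h1 h2 h3 h4 hu hh hp.1 hF)
  have e2 := h5.lintegral_le h1 h2 h3 h4 hp.1 hF hlam0
  have e3 := normL2_flux_sq_le hδ ha hl hlam2 hu hp.1 hf
  have e4 := normL2_source_sq_le hl hL hlam1 hlam2 hu hp.1 hg
  rw [← normL2_sq hp.1, ← normL2_sq hF, ← normL2_sq hu, ← normL2_sq hh] at e2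
  set A := normL2 (before d d T) p ^ 2
  set B := normL2 (before d d T) u ^ 2
  set R1 := normL2 (before d d T) f ^ 2
  set R2 := normL2 (before d d T) g ^ 2
  set D := normL2 (before d d T) (source b c lam u p g) ^ 2
  have hA : 0 ≤ A := sq_nonneg _
  have hB : 0 ≤ lam * B := mul_nonneg hlam0.le (sq_nonneg _)
  have hR1 : 0 ≤ R1 := sq_nonneg _
  have hR2 : 0 ≤ lam⁻¹ * R2 := mul_nonneg (inv_nonneg.2 hlam0.le) (sq_nonneg _)
  -- `δ < 1` is used twice, to replace `1/2` by `δ/2` on the left and `1` by `δ⁻¹` on the right, so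
  -- that both sides carry a common factor.
  have hS : A + lam * B ≤ 2 / δ ^ 2 * (R1 + lam⁻¹ * R2) := by
    have k1 : δ / 2 * (A + lam * B) ≤ δ⁻¹ * (R1 + lam⁻¹ * R2) := by
      have k2 : δ / 2 * (lam * B) ≤ 1 / 2 * (lam * B) := by gcongr
      have k3 : 1 * (lam⁻¹ * R2) ≤ δ⁻¹ * (lam⁻¹ * R2) := by
        gcongr
        exact (one_le_inv₀ hδ).2 hδ1.le
      linarith
    calc A + lam * B = 2 / δ * (δ / 2 * (A + lam * B)) := by field_simp
      _ ≤ 2 / δ * (δ⁻¹ * (R1 + lam⁻¹ * R2)) := by gcongr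
      _ = _ := by field_simp
  refine ⟨hS, Uhat, h1, e2.trans (ENNReal.ofReal_le_ofReal ?_)⟩
  have e5 : lam⁻¹ * D ≤ 3 * (A + 4 * (lam * B) + lam⁻¹ * R2) := by
    calc lam⁻¹ * D ≤ lam⁻¹ * (3 * (lam * A + 4 * lam ^ 2 * B + R2)) := by gcongr
      _ = _ := by field_simp
  rw [gainConst, mul_assoc]
  refine mul_le_mul_of_nonneg_left ?_ (by norm_num)
  -- With `K = (δ⁻¹ d)²`, the four terms of `e2` add up to at most `(4 + 3K) A + 16 lam B + 3 (R1 +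
  -- lam⁻¹ R2)`; the coefficient `16 = 3 + 1 + 12` comes from the flux, `u` itself and the source.
  have hK : 0 ≤ (δ⁻¹ * d) ^ 2 := sq_nonneg _
  have e6 : (16 + 3 * (δ⁻¹ * d) ^ 2) * (A + lam * B)
      ≤ (16 + 3 * (δ⁻¹ * d) ^ 2) * (2 / δ ^ 2 * (R1 + lam⁻¹ * R2)) := by gcongr
  have e7 : 0 ≤ (δ⁻¹ * d) ^ 2 * (lam * B) := mul_nonneg hK hB
  linarith

end APriori

/-! ### Multipliers in `x` and the Fourier transform in `(x, v)`. -/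

section PartialInversion

variable {d : ℕ}

/-- `(x, v)` as a point of `XV d`. -/
abbrev xv (x v : Euc d) : XV d := WithLp.toLp 2 (x, v)

lemma inner_xv (x v y w : Euc d) : inner ℝ (xv x v) (xv y w) = inner ℝ x y + inner ℝ v w := by
  simp [WithLp.prod_inner_apply]

lemma measurePreserving_xv : MeasurePreserving (WithLp.toLp 2 : Euc d × Euc d → XV d)
    (volume.prod volume) volume := WithLp.volume_preserving_toLp _ _

lemma integral_xv (f : XV d → ℂ) :
    ∫ e, f e = ∫ q : Euc d × Euc d, f (xv q.1 q.2) ∂(volume.prod volume) :=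
  (measurePreserving_xv.integral_comp (MeasurableEquiv.toLp 2 _).measurableEmbedding f).symm

lemma Integrable.comp_xv {f : XV d → ℂ} (hf : Integrable f) :
    Integrable (fun q : Euc d × Euc d => f (xv q.1 q.2)) (volume.prod volume) :=
  (measurePreserving_xv.integrable_comp_emb (MeasurableEquiv.toLp 2 _).measurableEmbedding).2 hf

lemma integrable_fourierChar_smul {V : Type*} [NormedAddCommGroup V] [InnerProductSpace ℝ V]
    [MeasurableSpace V] [BorelSpace V] [SecondCountableTopology V] {μ : Measure V} {f : V → ℂ}
    (hf : Integrable f μ) (w : V) :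
    Integrable (fun v => Real.fourierChar (inner ℝ v w) • f v) μ := by
  refine hf.norm.mono' ?_ (.of_forall fun v => by rw [Circle.norm_smul])
  have h : Continuous fun v => Real.fourierChar (inner ℝ v w) := by fun_prop
  exact h.aestronglyMeasurable.smul hf.1

lemma fourierChar_inner_xv (x v y w : Euc d) (z : ℂ) :
    Real.fourierChar (inner ℝ (xv x v) (xv y w)) • z
      = Real.fourierChar (inner ℝ v w) • (Real.fourierChar (inner ℝ x y) • z) := by
  rw [inner_xv, add_comm, AddChar.map_add_eq_mul, mul_smul]

lemma fourier_xv {Φ : XV d → ℂ} (hΦ : Integrable Φ) (k η : Euc d) :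
    𝓕 Φ (xv k η) = 𝓕 (fun v => 𝓕 (fun x => Φ (xv x v)) k) η := by
  simp only [Real.fourier_eq, ← inner_neg_right]
  rw [integral_xv, integral_prod_symm]
  · refine integral_congr_ae (.of_forall fun v => ?_)
    simp only [Circle.smul_def (inner ℝ v (-η) |> Real.fourierChar), smul_eq_mul]
    rw [← integral_const_mul]
    refine integral_congr_ae (.of_forall fun x => ?_)
    exact fourierChar_inner_xv x v (-k) (-η) _
  · exact Integrable.comp_xv (integrable_fourierChar_smul hΦ (-xv k η))

lemma continuous_fourier_slice {Φ : XV d → ℂ} (hΦ : Continuous Φ) (hc : HasCompactSupport Φ)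
    (k : Euc d) : Continuous fun v => 𝓕 (fun x => Φ (xv x v)) k := by
  simp only [Real.fourier_eq]
  have hfst : Continuous fun e : XV d => e.fst := WithLp.continuous_fst 2 _ _
  have hxv : Continuous fun q : Euc d × Euc d => xv q.2 q.1 :=
    (WithLp.prod_continuous_toLp 2 _ _).comp continuous_swap
  rw [← continuousOn_univ]
  refine continuousOn_integral_of_compact_support (k := (fun e : XV d => e.fst) '' tsupport Φ)
    (hc.isCompact.image hfst) ?_ fun v x _ hx => ?_
  · refine Continuous.continuousOn ?_
    have h1 : Continuous fun q : Euc d × Euc d => Real.fourierChar (-inner ℝ q.2 k) := by fun_prop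
    exact h1.smul (hΦ.comp hxv)
  · have : Φ (xv x v) = 0 := by
      by_contra h
      exact hx ⟨xv x v, subset_tsupport _ h, rfl⟩
    rw [this, smul_zero]

/-- A multiplier in `x` acts on the slices in `x`. -/
theorem fourierInv_mul_fourier_xv {Φ : XV d → ℂ} (hΦ : Continuous Φ) (hc : HasCompactSupport Φ)
    (h1 : Integrable (𝓕 Φ)) {m : Euc d → ℂ} (h2 : Integrable fun e => m e.fst * 𝓕 Φ e)
    (x v : Euc d) :
    𝓕⁻ (fun e => m e.fst * 𝓕 Φ e) (xv x v)
      = 𝓕⁻ (fun k => m k * 𝓕 (fun y => Φ (xv y v)) k) x := by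
  have hΦi : Integrable Φ := hΦ.integrable_of_hasCompactSupport hc
  rw [Real.fourierInv_eq, Real.fourierInv_eq, integral_xv,
    integral_prod _ (Integrable.comp_xv (integrable_fourierChar_smul h2 (xv x v)))]
  refine integral_congr_ae ?_
  -- The `η`-integral is done first. The multiplier does not see `η`, so this integral is Fourier
  -- inversion in `v`; its integrability hypothesis holds for almost every `k` by Fubini.
  filter_upwards [(Integrable.comp_xv h1).prod_right_ae] with k hk
  have e1 : ∀ η, 𝓕 Φ (xv k η) = 𝓕 (fun v => 𝓕 (fun x => Φ (xv x v)) k) η := fourier_xv hΦi k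
  have e2 : 𝓕⁻ (𝓕 (fun v => 𝓕 (fun x => Φ (xv x v)) k)) v = 𝓕 (fun x => Φ (xv x v)) k := by
    refine congrFun (Continuous.fourierInv_fourier_eq (continuous_fourier_slice hΦ hc k) ?_ ?_) v
    · have := (Integrable.comp_xv (integrable_fourierChar_smul hΦi (xv (-k) 0))).integral_prod_right
      refine this.congr (.of_forall fun v => ?_)
      simp only
      rw [Real.fourier_eq]
      refine integral_congr_ae (.of_forall fun x => ?_)
      simp only
      rw [inner_xv, inner_zero_right, add_zero, inner_neg_right]
    · exact hk.congr (.of_forall e1)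
  have e3 : ∀ η, Real.fourierChar (inner ℝ (xv k η) (xv x v)) • (m k * 𝓕 Φ (xv k η))
      = (Real.fourierChar (inner ℝ k x) • m k)
        * (Real.fourierChar (inner ℝ η v) • 𝓕 (fun v => 𝓕 (fun x => Φ (xv x v)) k) η) := fun η => by
    rw [fourierChar_inner_xv, e1]
    simp only [Circle.smul_def, smul_eq_mul]
    ring
  rw [← e2, Real.fourierInv_eq (𝓕 fun v => 𝓕 (fun x => Φ (xv x v)) k)]
  refine (integral_congr_ae (.of_forall e3)).trans ?_
  rw [integral_const_mul]
  simp only [Circle.smul_def, smul_eq_mul]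
  ring

lemma fourier_comp_sub (ψ : Euc d → ℂ) (y k : Euc d) :
    𝓕 (fun x => ψ (x - y)) k = Real.fourierChar (-inner ℝ y k) • 𝓕 ψ k := by
  rw [Real.fourier_eq, Real.fourier_eq, ← integral_add_right_eq_self _ y,
    Circle.smul_def, smul_eq_mul, ← integral_const_mul]
  refine integral_congr_ae (.of_forall fun x => ?_)
  simp only [add_sub_cancel_right]
  rw [inner_add_left, neg_add_rev, AddChar.map_add_eq_mul, mul_smul]
  rfl

/-- A translation is a unimodular factor on the Fourier side, which commutes with the multiplier. It
is needed because the shear translates `x` by `t v`. -/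
lemma fracLaplacian_comp_sub (s : ℝ) (ψ : Euc d → ℂ) (y x : Euc d) :
    fracLaplacian s (fun x => ψ (x - y)) x = fracLaplacian s ψ (x - y) := by
  simp only [fracLaplacian, Real.fourierInv_eq, fourier_comp_sub]
  refine integral_congr_ae (.of_forall fun k => ?_)
  simp only
  rw [inner_sub_right, sub_eq_add_neg, AddChar.map_add_eq_mul, mul_smul, real_inner_comm k y]
  simp only [Circle.smul_def, smul_eq_mul]
  ring

end PartialInversion

lemma contDiff_slice {E : Type*} [NormedAddCommGroup E] [NormedSpace ℝ E] {g : ℝ × E → ℂ}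
    (hg : ContDiff ℝ ∞ g) (t : ℝ) : ContDiff ℝ ∞ fun e => g (t, e) :=
  hg.comp (contDiff_prodMk_right t)

lemma hasCompactSupport_slice {E : Type*} [TopologicalSpace E] [R1Space E] {g : ℝ × E → ℂ}
    (hc : HasCompactSupport g) (t : ℝ) : HasCompactSupport fun e => g (t, e) := by
  refine HasCompactSupport.intro (hc.isCompact.image continuous_snd) fun e he => ?_
  by_contra h
  exact he ⟨(t, e), subset_tsupport _ h, rfl⟩

section Slices

variable {E : Type*} [NormedAddCommGroup E] [NormedSpace ℝ E] {g : ℝ × E → ℂ}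

/-- The slices of a smooth compactly supported function, as Schwartz functions. -/
def slice (hg : ContDiff ℝ ∞ g) (hc : HasCompactSupport g) (t : ℝ) : 𝓢(E, ℂ) :=
  (hasCompactSupport_slice hc t).toSchwartzMap (contDiff_slice hg t)

lemma coe_slice (hg : ContDiff ℝ ∞ g) (hc : HasCompactSupport g) (t : ℝ) :
    ⇑(slice hg hc t) = fun e => g (t, e) := rfl

lemma lineDeriv_slice (hg : ContDiff ℝ ∞ g) (hc : HasCompactSupport g) (t : ℝ) (v e : E) :
    LineDeriv.lineDerivOp v (slice hg hc t) e = fderiv ℝ g (t, e) (0, v) := by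
  rw [SchwartzMap.lineDerivOp_apply_eq_fderiv, coe_slice]
  have h1 : HasFDerivAt g (fderiv ℝ g (t, e)) (t, e) :=
    (hg.differentiable (by simp) _).hasFDerivAt
  have h2 := h1.comp e (hasFDerivAt_prodMk_right t e)
  have h3 : fderiv ℝ (fun e => g (t, e)) e = _ := h2.fderiv
  rw [h3]
  simp

end Slices

/-! ### Partial Fourier transforms of test functions. -/

section PartialFourierSlices

variable {E : Type*} [NormedAddCommGroup E] [InnerProductSpace ℝ E] [FiniteDimensional ℝ E]
  [MeasurableSpace E] [BorelSpace E]

lemma IsFourierL2.eLpNorm_eq {f g : E → ℂ} (h : IsFourierL2 f g) :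
    eLpNorm g 2 = eLpNorm f 2 := by
  obtain ⟨hf, hg, h⟩ := h
  have h1 : ‖(Lp.fourierTransformₗᵢ E ℂ) (hf.toLp f)‖ = ‖hf.toLp f‖ :=
    LinearIsometryEquiv.norm_map _ _
  have h2 : (Lp.fourierTransformₗᵢ E ℂ) (hf.toLp f) = hg.toLp g := h
  rw [h2, Lp.norm_toLp, Lp.norm_toLp] at h1
  exact (ENNReal.toReal_eq_toReal_iff' hg.2.ne hf.2.ne).1 h1

lemma memLp_two_iff_sq {α : Type*} [MeasurableSpace α] {μ : Measure α} {f : α → ℂ} :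
    MemLp f 2 μ ↔ AEStronglyMeasurable f μ ∧ eLpNorm f 2 μ ^ 2 < ⊤ := by
  rw [MemLp]
  simp

variable {τ : Measure ℝ}

lemma eLpNorm_sq_eq_of_slices {A B : ℝ × E → ℂ} (hA : AEStronglyMeasurable A (τ.prod volume))
    (hB : AEStronglyMeasurable B (τ.prod volume))
    (h : ∀ t, IsFourierL2 (fun e => A (t, e)) (fun e => B (t, e))) :
    eLpNorm B 2 (τ.prod volume) ^ 2 = eLpNorm A 2 (τ.prod volume) ^ 2 := by
  rw [eLpNorm_two_sq_prod hA, eLpNorm_two_sq_prod hB]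
  exact lintegral_congr fun t => by rw [(h t).eLpNorm_eq]

lemma isPartialFourier_of_forall {A B : ℝ × E → ℂ} (hA : MemLp A 2 (τ.prod volume))
    (hB : AEStronglyMeasurable B (τ.prod volume))
    (h : ∀ t, IsFourierL2 (fun e => A (t, e)) (fun e => B (t, e))) : IsPartialFourier τ A B := by
  refine ⟨hA, memLp_two_iff_sq.2 ⟨hB, ?_⟩, .of_forall h⟩
  rw [eLpNorm_sq_eq_of_slices hA.1 hB h]
  exact (memLp_two_iff_sq.1 hA).2

lemma isPartialFourier_of_forall' {A B : ℝ × E → ℂ} (hA : AEStronglyMeasurable A (τ.prod volume))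
    (hB : MemLp B 2 (τ.prod volume))
    (h : ∀ t, IsFourierL2 (fun e => A (t, e)) (fun e => B (t, e))) : IsPartialFourier τ A B := by
  refine ⟨memLp_two_iff_sq.2 ⟨hA, ?_⟩, hB, .of_forall h⟩
  rw [← eLpNorm_sq_eq_of_slices hA hB.1 h]
  exact (memLp_two_iff_sq.1 hB).2

variable {g : ℝ × E → ℂ}

lemma coe_fourier_slice (hg : ContDiff ℝ ∞ g) (hc : HasCompactSupport g) (t : ℝ) :
    ⇑(𝓕 (slice hg hc t) : 𝓢(E, ℂ)) = 𝓕 (fun e => g (t, e)) := by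
  rw [SchwartzMap.fourier_coe, coe_slice]

lemma isPartialFourier_slice [SFinite τ] [IsLocallyFiniteMeasure τ] (hg : ContDiff ℝ ∞ g)
    (hc : HasCompactSupport g) :
    IsPartialFourier τ g (fun p => 𝓕 (fun e => g (p.1, e)) p.2) :=
  isPartialFourier_of_forall (hg.continuous.memLp_of_hasCompactSupport hc)
    (stronglyMeasurable_fourier_slice hg.continuous.stronglyMeasurable).aestronglyMeasurable
    fun t => isFourierL2_of_fourier (slice hg hc t).integrable ((slice hg hc t).memLp 2 volume)

end PartialFourierSlices

/-! ### The multiplier of `(-Δ_x)^{1/6}` on test functions. -/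

section Multiplier

variable {d : ℕ}

/-- The multiplier of `(-Δ_x)^{1/6}`. -/
def mult (k : Euc d) : ℝ := (2 * Real.pi * ‖k‖) ^ (1 / 3 : ℝ)

lemma mult_nonneg (k : Euc d) : 0 ≤ mult k := by unfold mult; positivity

lemma continuous_mult : Continuous (mult : Euc d → ℝ) := by
  unfold mult
  exact (continuous_const.mul continuous_norm).rpow_const fun _ => Or.inr (by norm_num)

lemma continuous_mult_fst : Continuous fun e : XV d => (mult e.fst : ℂ) :=
  Complex.continuous_ofReal.comp (continuous_mult.comp (WithLp.continuous_fst 2 _ _))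

lemma rpow_third_le {x : ℝ} (hx : 0 ≤ x) : (x ^ (1 / 3 : ℝ)) ^ 2 ≤ 1 + x ^ 2 := by
  rcases le_total x 1 with h | h
  · have := Real.rpow_le_one hx h (z := 1 / 3) (by norm_num)
    have h0 : 0 ≤ x ^ (1 / 3 : ℝ) := by positivity
    nlinarith [sq_nonneg x]
  · have h1 := Real.rpow_le_rpow_of_exponent_le h (y := (1 / 3 : ℝ)) (z := 1) (by norm_num)
    rw [Real.rpow_one] at h1
    have h0 : 0 ≤ x ^ (1 / 3 : ℝ) := by positivity
    nlinarith [pow_le_pow_left₀ h0 h1 2]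

/-- A crude bound by the symbol of `1 - Δ_x`: the multiplier of a test function is then controlled
in `L₂` by the function and its first `x`-derivatives. -/
lemma mult_sq_le (k : Euc d) : mult k ^ 2 ≤ 1 + ∑ j, (2 * Real.pi * k j) ^ 2 := by
  refine (rpow_third_le (by positivity)).trans (le_of_eq ?_)
  rw [mul_pow, EuclideanSpace.norm_sq_eq, Finset.mul_sum]
  congr 1
  refine Finset.sum_congr rfl fun j _ => ?_
  rw [mul_pow (2 * Real.pi), Real.norm_eq_abs, sq_abs]

/-- `mult` is not smooth at the origin, so the product need not be Schwartz; polynomial growth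
against rapid decay still gives integrability. -/
lemma integrable_mult_mul (χ : 𝓢(XV d, ℂ)) : Integrable fun e => (mult e.fst : ℂ) * χ e := by
  have h1 := (χ.integrable (μ := volume)).norm.add (χ.integrable_pow_mul volume 2 |>.const_mul
    ((2 * Real.pi) ^ 2 + 1))
  refine h1.mono' (continuous_mult_fst.aestronglyMeasurable.mul
    χ.continuous.aestronglyMeasurable) (.of_forall fun e => ?_)
  rw [norm_mul, Complex.norm_real, Real.norm_of_nonneg (mult_nonneg _)]
  have h2 : ‖e.fst‖ ≤ ‖e‖ := WithLp.norm_fst_le _ e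
  have h3 : mult e.fst ≤ 1 + ((2 * Real.pi) ^ 2 + 1) * ‖e‖ ^ 2 := by
    have h4 : mult e.fst ^ 2 ≤ 1 + (2 * Real.pi * ‖e.fst‖) ^ 2 := rpow_third_le (by positivity)
    have h5 : (2 * Real.pi * ‖e.fst‖) ^ 2 ≤ (2 * Real.pi) ^ 2 * ‖e‖ ^ 2 := by
      rw [mul_pow]; gcongr
    rcases le_total (mult e.fst) 1 with h | h
    · have : 0 ≤ ((2 * Real.pi) ^ 2 + 1) * ‖e‖ ^ 2 := by positivity
      linarith
    · nlinarith [sq_nonneg ‖e‖]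
  calc mult e.fst * ‖χ e‖ ≤ (1 + ((2 * Real.pi) ^ 2 + 1) * ‖e‖ ^ 2) * ‖χ e‖ := by gcongr
    _ = _ := by simp only [Pi.add_apply]; ring

lemma norm_mult_mul_fourier_sq_le (χ : 𝓢(XV d, ℂ)) (e : XV d) :
    ‖(mult e.fst : ℂ) * 𝓕 χ e‖ ^ 2
      ≤ ‖𝓕 χ e‖ ^ 2 + ∑ j, ‖(𝓕 (LineDeriv.lineDerivOp (dirX (d := d) j) χ) : 𝓢(XV d, ℂ)) e‖ ^ 2 := by
  have h1 : ∀ j, ‖(𝓕 (LineDeriv.lineDerivOp (dirX (d := d) j) χ) : 𝓢(XV d, ℂ)) e‖ ^ 2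
      = (2 * Real.pi * e.fst j) ^ 2 * ‖𝓕 χ e‖ ^ 2 := fun j => by
    have : (inner ℝ · (dirX j) : XV d → ℝ).HasTemperateGrowth :=
      ((innerSL ℝ).flip (dirX j)).hasTemperateGrowth
    rw [SchwartzMap.fourier_lineDerivOp_eq, smul_apply,
      SchwartzMap.smulLeftCLM_apply_apply this, inner_dirX, norm_smul, norm_smul, ← mul_assoc,
      mul_pow]
    congr 1
    simp [mul_pow]
  simp only [h1]
  rw [norm_mul, mul_pow, Complex.norm_real, Real.norm_eq_abs, sq_abs, ← Finset.sum_mul, ← one_add_mul]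
  gcongr
  exact mult_sq_le _

variable {τ : Measure ℝ} [IsLocallyFiniteMeasure τ] {g : ℝ × XV d → ℂ}

/-- Plancherel on each slice bounds the norm by those of `g` and its first `x`-derivatives, which
are continuous with compact support in all variables. -/
lemma memLp_mult_fourier (hg : ContDiff ℝ ∞ g) (hc : HasCompactSupport g) :
    MemLp (fun p : ℝ × XV d => (mult p.2.fst : ℂ) * 𝓕 (fun e => g (p.1, e)) p.2) 2
      (τ.prod volume) := by
  have hm : AEStronglyMeasurable
      (fun p : ℝ × XV d => (mult p.2.fst : ℂ) * 𝓕 (fun e => g (p.1, e)) p.2) (τ.prod volume) :=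
    (continuous_mult_fst.comp continuous_snd).aestronglyMeasurable.mul
      (stronglyMeasurable_fourier_slice hg.continuous.stronglyMeasurable).aestronglyMeasurable
  refine memLp_two_iff_sq.2 ⟨hm, ?_⟩
  have hD : ∀ j, MemLp (fun p : ℝ × XV d => fderiv ℝ g p (0, dirX j)) 2 (τ.prod volume) := fun j =>
    ((hg.continuous_fderiv (by simp)).clm_apply continuous_const).memLp_of_hasCompactSupport
      (hc.fderiv_apply (𝕜 := ℝ) _)
  have hg2 : MemLp g 2 (τ.prod volume) := hg.continuous.memLp_of_hasCompactSupport hc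
  have key : ∀ t, eLpNorm (fun e : XV d => (mult e.fst : ℂ) * 𝓕 (fun e => g (t, e)) e) 2 ^ 2
      ≤ eLpNorm (fun e => g (t, e)) 2 ^ 2
        + ∑ j, eLpNorm (fun e => fderiv ℝ g (t, e) (0, dirX j)) 2 ^ 2 := fun t => by
    have hF : ∀ χ : 𝓢(XV d, ℂ), eLpNorm χ 2 ^ 2 = ∫⁻ e, ‖𝓕 χ e‖ₑ ^ 2 := fun χ => by
      rw [← (isFourierL2_of_fourier χ.integrable (χ.memLp 2 volume)).eLpNorm_eq, eLpNorm_two_sq,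
        SchwartzMap.fourier_coe]
    have e1 := hF (slice hg hc t)
    have e2 : ∀ j, _ := fun j => hF (LineDeriv.lineDerivOp (dirX (d := d) j) (slice hg hc t))
    have e3 : ∀ j, ⇑(LineDeriv.lineDerivOp (dirX j) (slice hg hc t) : 𝓢(XV d, ℂ))
        = fun e => fderiv ℝ g (t, e) (0, dirX j) := fun j =>
      funext fun e => lineDeriv_slice hg hc t (dirX j) e
    rw [coe_slice] at e1
    simp only [e3] at e2
    rw [e1]
    simp only [e2]
    rw [← lintegral_finsetSum' _ fun j _ => (SchwartzMap.continuous _).aemeasurable.enorm.pow_const 2,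
      ← lintegral_add_left' ((SchwartzMap.continuous _).aemeasurable.enorm.pow_const 2), eLpNorm_two_sq]
    refine lintegral_mono fun e => ?_
    have := ENNReal.ofReal_le_ofReal (norm_mult_mul_fourier_sq_le (slice hg hc t) e)
    rw [ENNReal.ofReal_add (by positivity) (by positivity),
      ENNReal.ofReal_sum_of_nonneg fun _ _ => by positivity] at this
    simp only [ENNReal.ofReal_pow (norm_nonneg _), ofReal_norm] at this
    rwa [coe_fourier_slice] at this
  rw [eLpNorm_two_sq_prod hm]
  refine (lintegral_mono key).trans_lt ?_
  have hms : ∀ {f : ℝ × XV d → ℂ}, MemLp f 2 (τ.prod volume) →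
      AEMeasurable (fun t => eLpNorm (fun e => f (t, e)) 2 ^ 2) τ := fun hf => by
    simp only [eLpNorm_two_sq]
    exact (hf.1.enorm.pow_const 2).lintegral_prod_right'
  rw [lintegral_add_left' (hms hg2), lintegral_finsetSum' _ fun j _ => hms (hD j)]
  refine ENNReal.add_lt_top.2 ⟨?_, ENNReal.sum_lt_top.2 fun j _ => ?_⟩
  · rw [← eLpNorm_two_sq_prod hg2.1]
    exact ENNReal.pow_lt_top hg2.2
  · rw [← eLpNorm_two_sq_prod (hD j).1]
    exact ENNReal.pow_lt_top (hD j).2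

/-- The multiplier applied in the Fourier variable of the slices. -/
lemma isPartialFourier_mult (hg : ContDiff ℝ ∞ g) (hc : HasCompactSupport g) :
    IsPartialFourier τ
      (fun p => 𝓕⁻ (fun e : XV d => (mult e.fst : ℂ) * 𝓕 (fun e => g (p.1, e)) e) p.2)
      (fun p => (mult p.2.fst : ℂ) * 𝓕 (fun e => g (p.1, e)) p.2) := by
  have hS : StronglyMeasurable
      (fun p : ℝ × XV d => (mult p.2.fst : ℂ) * 𝓕 (fun e => g (p.1, e)) p.2) :=
    (continuous_mult_fst.comp continuous_snd).stronglyMeasurable.mul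
      (stronglyMeasurable_fourier_slice hg.continuous.stronglyMeasurable)
  refine isPartialFourier_of_forall' (stronglyMeasurable_fourierInv_slice hS).aestronglyMeasurable
    (memLp_mult_fourier hg hc) fun t => ?_
  have hi : Integrable fun e : XV d => (mult e.fst : ℂ) * 𝓕 (fun e => g (t, e)) e := by
    rw [← coe_fourier_slice hg hc t]
    exact integrable_mult_mul _
  refine isFourierL2_of_fourierInv hi ?_
  -- With the Dirac measure at `t` in place of `τ`, the bound on the product becomes a bound on the
  -- single slice.
  have := memLp_mult_fourier (τ := Measure.dirac t) hg hc
  rw [Measure.dirac_prod] at this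
  exact (memLp_map_measure_iff this.1 (measurable_prodMk_left).aemeasurable).1 this

end Multiplier

/-! ### Identification of `(-Δ_x)^{1/6} u`. -/

section FracLaplacian

variable {d : ℕ} {T : WithTop ℝ}

lemma contDiff_shear : ContDiff ℝ ∞ (shear : ℝ × XV d → Phase d d) := by
  have h : ContDiff ℝ ∞ fun p : ℝ × XV d =>
      (WithLp.prodContinuousLinearEquiv 2 ℝ (Euc d) (Euc d)) p.2 :=
    (WithLp.prodContinuousLinearEquiv 2 ℝ (Euc d) (Euc d)).contDiff.comp contDiff_snd
  exact contDiff_fst.prodMk ((h.fst.sub (contDiff_fst.smul h.snd)).prodMk h.snd)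

lemma contDiff_lift {φ : Phase d d → ℝ} (hφ : ContDiff ℝ ∞ φ) : ContDiff ℝ ∞ (lift φ) :=
  Complex.ofRealCLM.contDiff.comp (hφ.comp contDiff_shear)

lemma hasCompactSupport_lift {φ : Phase d d → ℝ} (hφ : HasCompactSupport φ) :
    HasCompactSupport (lift φ) :=
  (hφ.comp_homeomorph shear).comp_left Complex.ofReal_zero

lemma two_mul_sixth : (2 * (1 / 6) : ℝ) = 1 / 3 := by norm_num

/-- Along the characteristics, `(-Δ_x)^{1/6}` is the multiplier `mult`. -/
lemma fracLaplacianX_shear {φ : Phase d d → ℝ} (hφ : ContDiff ℝ ∞ φ) (hc : HasCompactSupport φ)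
    (p : ℝ × XV d) :
    fracLaplacianX (1 / 6) φ (shear p)
      = (𝓕⁻ (fun e : XV d => (mult e.fst : ℂ) * 𝓕 (fun e => lift φ (p.1, e)) e) p.2).re := by
  obtain ⟨t, e⟩ := p
  obtain ⟨x, v, rfl⟩ : ∃ x v, e = xv x v := ⟨e.fst, e.snd, rfl⟩
  have h1 := contDiff_lift hφ
  have h2 := hasCompactSupport_lift hc
  have key := fourierInv_mul_fourier_xv (Φ := fun e => lift φ (t, e)) (m := fun k => (mult k : ℂ))
    (contDiff_slice h1 t).continuous (hasCompactSupport_slice h2 t)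
    (by rw [← coe_fourier_slice h1 h2 t]; exact (𝓕 (slice h1 h2 t) : 𝓢(XV d, ℂ)).integrable)
    (by rw [← coe_fourier_slice h1 h2 t]; exact integrable_mult_mul _) x v
  rw [key, fracLaplacianX]
  congr 1
  -- For fixed `t` and `v`, the straightened function is `φ` translated by `t v` in `x`.
  have h3 := fracLaplacian_comp_sub (1 / 6) (fun y => (φ (t, y, v) : ℂ)) (t • v) x
  refine h3.symm.trans ?_
  simp only [fracLaplacian, two_mul_sixth]
  rfl

lemma lintegral_mult_enorm {Uhat : ℝ × XV d → ℂ} {τ : Measure ℝ} :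
    ∫⁻ q, ‖(mult q.2.fst : ℂ) * Uhat q‖ₑ ^ 2 ∂(τ.prod volume)
      = ∫⁻ q, ENNReal.ofReal (mult q.2.fst ^ 2 * ‖Uhat q‖ ^ 2) ∂(τ.prod volume) := by
  refine lintegral_congr fun q => ?_
  rw [← ofReal_norm, ← ENNReal.ofReal_pow (norm_nonneg _), norm_mul, Complex.norm_real, mul_pow,
    Real.norm_eq_abs, sq_abs]

lemma IsPartialFourier.eLpNorm_sq_eq {τ : Measure ℝ} [SFinite τ] {A B : ℝ × XV d → ℂ}
    (h : IsPartialFourier τ A B) :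
    eLpNorm B 2 (τ.prod volume) ^ 2 = eLpNorm A 2 (τ.prod volume) ^ 2 := by
  rw [eLpNorm_two_sq_prod h.1.1, eLpNorm_two_sq_prod h.2.1.1]
  refine lintegral_congr_ae ?_
  filter_upwards [h.2.2] with t ht
  rw [ht.eLpNorm_eq]

/-- The function is found by multiplying `Uhat` by `mult`, inverting the transform and undoing the
shear. Since `mult` is real, Plancherel applied twice moves it from `u` to the test function. The
real part is harmless because `u` and the test functions are real. -/
theorem exists_isFracLaplacianX {u : Phase d d → ℝ} {Uhat : ℝ × XV d → ℂ}
    (hU : IsPartialFourier (volume.restrict (timeBefore T)) (lift u) Uhat) {M : ℝ} (hM : 0 ≤ M)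
    (hle : ∫⁻ q, ENNReal.ofReal (mult q.2.fst ^ 2 * ‖Uhat q‖ ^ 2)
      ∂((volume.restrict (timeBefore T)).prod volume) ≤ ENNReal.ofReal M) :
    ∃ w : Phase d d → ℝ, MemL2 (before d d T) w ∧ IsFracLaplacianX (1 / 6) (before d d T) u w ∧
      normL2 (before d d T) w ^ 2 ≤ M := by
  set τ := volume.restrict (timeBefore T)
  have hsq : eLpNorm (fun q : ℝ × XV d => (mult q.2.fst : ℂ) * Uhat q) 2 (τ.prod volume) ^ 2
      ≤ ENNReal.ofReal M := by
    rw [eLpNorm_two_sq, lintegral_mult_enorm]; exact hle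
  have hV : MemLp (fun q : ℝ × XV d => (mult q.2.fst : ℂ) * Uhat q) 2 (τ.prod volume) :=
    memLp_two_iff_sq.2 ⟨(continuous_mult_fst.comp continuous_snd).aestronglyMeasurable.mul hU.2.1.1,
      hsq.trans_lt ENNReal.ofReal_lt_top⟩
  obtain ⟨W, hW⟩ := exists_partialFourierInv hV
  have hsymm : MeasurePreserving (shear.symm : Phase d d → ℝ × XV d)
      (volume.restrict (before d d T : Set (Phase d d))) (τ.prod volume) :=
    (measurePreserving_shear T).symm shear.toMeasurableEquiv
  have hWs := hW.1.comp_measurePreserving hsymm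
  have hw : MemL2 (before d d T) fun z => (W (shear.symm z)).re := hWs.re
  refine ⟨fun z => (W (shear.symm z)).re, hw, fun φ => ?_, ?_⟩
  · have h1 : ContDiff ℝ ∞ (lift φ) := contDiff_lift φ.contDiff
    have h2 : HasCompactSupport (lift φ) := hasCompactSupport_lift φ.hasCompactSupport
    have i1 := (isPartialFourier_slice (τ := τ) h1 h2).integral_conj_mul hW
    have i2 := (isPartialFourier_mult (τ := τ) h1 h2).integral_conj_mul hU
    have e1 : ∫ z in (before d d T : Set (Phase d d)), (W (shear.symm z)).re * φ z
        = (∫ p, (starRingEnd ℂ (lift φ p)) * W p ∂(τ.prod volume)).re := by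
      rw [← integral_shear, ← RCLike.re_eq_complex_re, ← integral_re (integrable_conj_mul
        (h1.continuous.memLp_of_hasCompactSupport h2) hW.1)]
      refine integral_congr_ae (.of_forall fun p => ?_)
      simp [lift, mul_comm]
    have e2 : ∫ z in (before d d T : Set (Phase d d)), u z * fracLaplacianX (1 / 6) φ z
        = (∫ p, (starRingEnd ℂ (𝓕⁻ (fun e : XV d => (mult e.fst : ℂ)
            * 𝓕 (fun e => lift φ (p.1, e)) e) p.2)) * lift u p ∂(τ.prod volume)).re := by
      rw [← integral_shear, ← RCLike.re_eq_complex_re, ← integral_re (integrable_conj_mul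
        (isPartialFourier_mult (τ := τ) h1 h2).1 hU.1)]
      refine integral_congr_ae (.of_forall fun p => ?_)
      simp only
      rw [fracLaplacianX_shear φ.contDiff φ.hasCompactSupport]
      simp [lift, mul_comm]
    rw [toDistr, e1, e2, ← i1, ← i2]
    congr 2
    funext p
    simp only [map_mul, Complex.conj_ofReal]
    ring
  · rw [normL2, ← ENNReal.toReal_pow]
    refine ENNReal.toReal_le_of_le_ofReal hM ?_
    calc eLpNorm (fun z => (W (shear.symm z)).re) 2
          (volume.restrict (before d d T : Set (Phase d d))) ^ 2
        ≤ eLpNorm (W ∘ shear.symm) 2 (volume.restrict (before d d T : Set (Phase d d))) ^ 2 := by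
          gcongr
          refine eLpNorm_mono fun z => ?_
          exact Complex.abs_re_le_norm _
      _ = eLpNorm W 2 (τ.prod volume) ^ 2 := by
          rw [eLpNorm_comp_measurePreserving hW.1.1 hsymm]
      _ ≤ ENNReal.ofReal M := by rw [← hW.eLpNorm_sq_eq]; exact hsq

end FracLaplacian

end Kinetic

end


/-! ### Choice of the constants. -/

theorem corollary1p11 (d : ℕ) (hd : 1 ≤ d) (δ : ℝ) (hδ : δ ∈ Set.Ioo (0 : ℝ) 1) :
    ∃ N : ℝ, 0 < N ∧ ∀ L : ℝ, 0 < L → ∃ lam₀ : ℝ, 0 < lam₀ ∧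
      ∀ (T : WithTop ℝ)
        (a : Kinetic.Phase d d → Matrix (Fin d) (Fin d) ℝ)
        (b bbar : Kinetic.Phase d d → Kinetic.Euc d) (c : Kinetic.Phase d d → ℝ),
        Kinetic.Elliptic δ a → Kinetic.LowerOrder L b bbar c →
      ∀ (lam : ℝ), lam₀ ≤ lam →
      ∀ (u : Kinetic.Phase d d → ℝ) (p f : Kinetic.Phase d d → Kinetic.Euc d)
        (g : Kinetic.Phase d d → ℝ),
        Kinetic.MemKinetic (Kinetic.before d d T) (fun v => -v) u →
        Kinetic.IsGradV (Kinetic.before d d T) u p →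
        Kinetic.MemL2 (Kinetic.before d d T) f →
        Kinetic.MemL2 (Kinetic.before d d T) g →
        Kinetic.SolvesEq (Kinetic.before d d T) (fun v => -v) a b bbar c lam u p f g →
        (Real.sqrt lam * Kinetic.normL2 (Kinetic.before d d T) u
            + Kinetic.normL2 (Kinetic.before d d T) p
          ≤ N * Kinetic.normL2 (Kinetic.before d d T) f
            + N * (Real.sqrt lam)⁻¹ * Kinetic.normL2 (Kinetic.before d d T) g) ∧
        ∃ w : Kinetic.Phase d d → ℝ,
          Kinetic.MemL2 (Kinetic.before d d T) w ∧
          Kinetic.IsFracLaplacianX (1 / 6) (Kinetic.before d d T) u w ∧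
          Kinetic.normL2 (Kinetic.before d d T) w
            ≤ N * Kinetic.normL2 (Kinetic.before d d T) f
              + N * (Real.sqrt lam)⁻¹ * Kinetic.normL2 (Kinetic.before d d T) g := by
  obtain ⟨hδ0, hδ1⟩ := hδ
  have hK : 0 ≤ Kinetic.gainConst d δ := by unfold Kinetic.gainConst; positivity
  -- The sum of the constants of the two estimates, free of `L`; the threshold for `lam` is the one
  -- that absorbs the lower-order terms.
  refine ⟨2 / δ + √(Kinetic.gainConst d δ), by positivity, fun L hL =>
    ⟨4 * (L ^ 2 / δ + L), by positivity, ?_⟩⟩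
  intro T a b bbar c ha hl lam hlam u p f g hu hp hf hg heq
  have hlam0 : 0 < lam := lt_of_lt_of_le (by positivity) hlam
  obtain ⟨h1, Uhat, hU, h2⟩ := Kinetic.a_priori hδ0 hδ1 ha hl hL hlam hu.1 hp hf hg heq
  have hf0 : 0 ≤ Kinetic.normL2 (Kinetic.before d d T) f := ENNReal.toReal_nonneg
  have hg0 : 0 ≤ Kinetic.normL2 (Kinetic.before d d T) g := ENNReal.toReal_nonneg
  have hs : 0 < √lam := Real.sqrt_pos.2 hlam0
  have hss : √lam ^ 2 = lam := Real.sq_sqrt hlam0.le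
  set R := Kinetic.normL2 (Kinetic.before d d T) f
    + (√lam)⁻¹ * Kinetic.normL2 (Kinetic.before d d T) g with hR
  have hR0 : 0 ≤ R := by positivity
  have hRR : Kinetic.normL2 (Kinetic.before d d T) f ^ 2
      + lam⁻¹ * Kinetic.normL2 (Kinetic.before d d T) g ^ 2 ≤ R ^ 2 := by
    have e : lam⁻¹ = (√lam)⁻¹ ^ 2 := by rw [inv_pow, hss]
    have : 0 ≤ Kinetic.normL2 (Kinetic.before d d T) f
      * ((√lam)⁻¹ * Kinetic.normL2 (Kinetic.before d d T) g) := by positivity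
    rw [e, hR]
    nlinarith
  have hNR : ∀ N : ℝ, N * Kinetic.normL2 (Kinetic.before d d T) f
      + N * (√lam)⁻¹ * Kinetic.normL2 (Kinetic.before d d T) g = N * R := fun N => by
    rw [hR]; ring
  rw [hNR]
  constructor
  · have h3 : √lam * Kinetic.normL2 (Kinetic.before d d T) u
        + Kinetic.normL2 (Kinetic.before d d T) p ≤ 2 / δ * R := by
      -- `(x + y)² ≤ 2(x² + y²)` turns the constant `2/δ²` for squares into `4/δ² = (2/δ)²`.
      refine (abs_le_of_sq_le_sq' (le_trans ?_ (?_ : 2 * (2 / δ ^ 2 * R ^ 2) ≤ _)) (by positivity)).2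
      · have h4 := h1.trans (mul_le_mul_of_nonneg_left hRR (by positivity))
        rw [← hss] at h4
        nlinarith [sq_nonneg (√lam * Kinetic.normL2 (Kinetic.before d d T) u
          - Kinetic.normL2 (Kinetic.before d d T) p)]
      · refine le_of_eq ?_
        field_simp
    refine h3.trans ?_
    gcongr
    exact le_add_of_nonneg_right (Real.sqrt_nonneg _)
  · obtain ⟨w, hw1, hw2, hw3⟩ := Kinetic.exists_isFracLaplacianX hU
      (M := Kinetic.gainConst d δ * R ^ 2) (by positivity)
      (h2.trans (ENNReal.ofReal_le_ofReal (by gcongr)))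
    refine ⟨w, hw1, hw2, ?_⟩
    have h3 : Kinetic.normL2 (Kinetic.before d d T) w ≤ √(Kinetic.gainConst d δ) * R := by
      refine (abs_le_of_sq_le_sq' (hw3.trans (le_of_eq ?_)) (by positivity)).2
      rw [mul_pow, Real.sq_sqrt hK]
    refine h3.trans ?_
    gcongr
    exact le_add_of_nonneg_left (by positivity)
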